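/- **Setting.** Let $\Bbbk$ be a field of characteristic $0$, $\mathbb{K}=\Bbbk[[\hbar]]$, $I=\{1,\dots,n\}$, $A=(a_{ij})_{i,j\in I}$ a generalized Cartan matrix, and $d_i$ ($i\in I$) positive integers such that $DA$ is symmetric, where $D=\mathrm{diag}(d_1,\dots,d_n)$. A matrix $P=(p_{ij})\in M_n(\mathbb{K})$ is *of Cartan type* (with Cartan matrix $A$) if $P+P^T=2DA$. A *realization* of $P$ is $\mathcal{R}=(\mathfrak{h},\{\alpha_i\},\{T_i^\pm\})$ with $\mathfrak{h}$ a free $\mathbb{K}$-module of finite rank (the *rank* of $\mathcal R$), $\alpha_i\in\mathfrak{h}^*$, $T_i^\pm\in\mathfrak{h}$, such that $\alpha_j(T_i^+)=p_{ij}$, $\alpha_j(T_i^-)=p_{ji}$ and the elements $S_i=\frac12(T_i^++T_i^-)$ are linearly independent modulo $\hbar\mathfrak{h}$. It is *straight* if the $\alpha_i$ are linearly independent modulo $\hbar\mathfrak{h}^*$, *small* if the $S_i$ span the same submodule as all the $T_i^\pm$, *split* if the $T_i^\pm$ ($2n$ elements) are linearly independent modulo $\hbar\mathfrak{h}$, *minimal*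 if the $T_i^{\pm}$ span $\mathfrak{h}$. Put $q_i=e^{\hbar d_i}$ and $(q_{ij}/q_{ji})^{c}=e^{c\hbar(p_{ij}-p_{ji})}$. The FoMpQUEA $U_{P,\hbar}^{\mathcal R}(\mathfrak g)$ is the unital associative $\hbar$-adically complete $\mathbb{K}$-algebra topologically generated by the $\mathbb{K}$-module $\mathfrak h$ and elements $E_i,F_i$ ($i\in I$) with relations, for $T,T',T''\in\mathfrak h$ and $i,j\in I$, $$TE_j-E_jT=\alpha_j(T)E_j,\quad TF_j-F_jT=-\alpha_j(T)F_j,\quad T'T''=T''T',\quad E_iF_j-F_jE_i=\delta_{ij}\frac{e^{\hbar T_i^+}-e^{-\hbar T_i^-}}{q_i-q_i^{-1}},$$ $$\sum_{s=0}^{1-a_{ij}}(-1)^s\binom{1-a_{ij}}{s}_{q_i}(q_{ij}/q_{ji})^{s/2}E_i^{1-a_{ij}-s}E_jE_i^s=0\qquad(i\ne j),$$ $$\sum_{s=0}^{1-a_{ij}}(-1)^s\binom{1-a_{ij}}{s}_{q_i}(q_{ij}/q_{ji})^{-s/2}F_i^{1-a_{ij}-s}F_jF_i^s=0\qquad(i\ne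 j),$$ with symmetric $q$-binomials (the fraction means that numerator and denominator are first divided by $\hbar$). It is a topological Hopf algebra (coproduct with values in the $\hbar$-completed tensor square) by $$\Delta(E_i)=E_i\otimes1+e^{\hbar T_i^+}\otimes E_i,\quad \Delta(T)=T\otimes1+1\otimes T,\quad \Delta(F_i)=F_i\otimes e^{-\hbar T_i^-}+1\otimes F_i,$$ $\epsilon(E_i)=\epsilon(T)=\epsilon(F_i)=0$, $S(E_i)=-e^{-\hbar T_i^+}E_i$, $S(T)=-T$, $S(F_i)=-F_ie^{\hbar T_i^-}$. It is called straight, small, … and of rank $t$ if $\mathcal R$ is. The *Borel FoMpQUEAs* $U_{P,\hbar}^{\mathcal R}(\mathfrak b_+)$ and $U_{P,\hbar}^{\mathcal R}(\mathfrak b_-)$ are the smallest $\hbar$-adically complete unital subalgebras containing $\mathfrak h$ and all $E_i$, respectively $\mathfrak h$ and all $F_i$; they are Hopf subalgebras. A *twist* of a topological Hopf algebra $H$ is an invertible $\mathcal F\in H\widehat\otimes H$ with $\mathcal F_{12}(\Delta\otimes\mathrm{id})(\mathcal F)=\mathcal F_{23}(\mathrm{id}\otimes\Delta)(\mathcal F)$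 and $(\epsilon\otimes\mathrm{id})(\mathcal F)=1=(\mathrm{id}\otimes\epsilon)(\mathcal F)$; the twist deformation $H^{\mathcal F}$ has the algebra structure and counit of $H$, coproduct $\mathcal F\Delta(\cdot)\mathcal F^{-1}$ and antipode $v\,S(\cdot)\,v^{-1}$, where $v=m(\mathrm{id}\otimes S)(\mathcal F)$ and $v^{-1}=m(S\otimes\mathrm{id})(\mathcal F^{-1})$. For a realization $\mathcal R$ of rank $t$, a $\mathbb K$-basis $(H_g)$ of $\mathfrak h$ and $\Phi=(\phi_{gk})\in\mathfrak{so}_t(\mathbb K)$ (i.e. $\Phi^T=-\Phi$), the *toral twist* is $$\mathcal F_\Phi=\exp\Big(\tfrac{\hbar}{2}\sum_{g,k}\phi_{gk}\,H_g\otimes H_k\Big).$$ **Theorem.** Let $P$ and $P'$ be two matrices of Cartan type with the same Cartan matrix $A$ (and the same $D$), so that $P_s=P'_s=DA$. In each claim below the basis of $\mathfrak h$ used to form $\mathcal F_\Phi$ may be prescribed arbitrarily, and $\mathcal F_\Phi$ is a twist. (a) For every straight realization $\mathcal R$ of $P$, of rank $t$, there exists a straight realization $\check{\mathcal R}'$ of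 $P'$ of the same rank and $\Phi\in\mathfrak{so}_t(\mathbb K)$ such that, as topological Hopf algebras, $U_{P',\hbar}^{\check{\mathcal R}'}(\mathfrak g)\cong\big(U_{P,\hbar}^{\mathcal R}(\mathfrak g)\big)^{\mathcal F_\Phi}$. Conversely, for every straight realization $\mathcal R'$ of $P'$, of rank $t$, there exists a straight realization $\hat{\mathcal R}$ of $P$ of the same rank and $\Phi\in\mathfrak{so}_t(\mathbb K)$ such that $U_{P',\hbar}^{\mathcal R'}(\mathfrak g)\cong\big(U_{P,\hbar}^{\hat{\mathcal R}}(\mathfrak g)\big)^{\mathcal F_\Phi}$. (b) If $\mathcal R$ and $\mathcal R'$ are straight small realizations of $P$ and $P'$ of the same rank $t$, there exists $\Phi\in\mathfrak{so}_t(\mathbb K)$ such that $U_{P',\hbar}^{\mathcal R'}(\mathfrak g)\cong\big(U_{P,\hbar}^{\mathcal R}(\mathfrak g)\big)^{\mathcal F_\Phi}$. (c) Every straight small FoMpQUEA is isomorphic to a toral twist deformation of Drinfeld's standard FoMpQUEA over $DA$ of the same rank. That is, for every straight small realization $\mathcal R'$ of $P'$ there is a straight small realization $\mathcal R_0$ of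 $DA$ with $T_i^+=T_i^-$ for all $i$ and of the same rank; and for every straight realization $\mathcal R_0$ of $DA$ of the same rank $t$ as $\mathcal R'$ which either satisfies $T_i^+=T_i^-$ for all $i$, or is split and minimal, there exists $\Phi\in\mathfrak{so}_t(\mathbb K)$ such that $U_{P',\hbar}^{\mathcal R'}(\mathfrak g)\cong\big(U_{DA,\hbar}^{\mathcal R_0}(\mathfrak g)\big)^{\mathcal F_\Phi}$. (d) The statements (a), (b), (c) hold, with the same $\Phi$, with $\mathfrak b_+$, and with $\mathfrak b_-$, in place of $\mathfrak g$; here $\mathcal F_\Phi^{\pm1}$ lies in the completed tensor square of the Borel subalgebra. -/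

import Mathlib

open scoped PowerSeries TensorProduct

noncomputable section

namespace FoMp

universe u v w

/-! ## Adic completion of a (non-commutative) algebra

Mathlib provides the `I`-adic completion of a module; here the completion of an algebra gets its
ring and algebra structure (Mathlib has it for the base ring only). -/

section CompletionAlgebra

variable {R : Type u} [CommRing R] (I : Ideal R) {B : Type v} [Ring B] [Algebra R B]

theorem mul_mem_pow_smul_top_left (n : ℕ) {x : B}
    (hx : x ∈ (I ^ n • ⊤ : Submodule R B)) (y : B) : x * y ∈ (I ^ n • ⊤ : Submodule R B) := by
  have h : (I ^ n • ⊤ : Submodule R B) ≤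
      (I ^ n • ⊤ : Submodule R B).comap (LinearMap.mulRight R y) := by
    rw [Submodule.smul_le]
    intro r hr z _
    simp only [Submodule.mem_comap, LinearMap.mulRight_apply, smul_mul_assoc]
    exact Submodule.smul_mem_smul hr trivial
  exact h hx

theorem mul_mem_pow_smul_top_right (n : ℕ) (x : B) {y : B}
    (hy : y ∈ (I ^ n • ⊤ : Submodule R B)) : x * y ∈ (I ^ n • ⊤ : Submodule R B) := by
  have h : (I ^ n • ⊤ : Submodule R B) ≤
      (I ^ n • ⊤ : Submodule R B).comap (LinearMap.mulLeft R x) := by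
    rw [Submodule.smul_le]
    intro r hr z _
    simp only [Submodule.mem_comap, LinearMap.mulLeft_apply, mul_smul_comm]
    exact Submodule.smul_mem_smul hr trivial
  exact h hy

/-- The multiplication of `B / I ^ n B`. -/
def quotMul (n : ℕ) : (B ⧸ (I ^ n • ⊤ : Submodule R B)) →ₗ[R]
    (B ⧸ (I ^ n • ⊤ : Submodule R B)) →ₗ[R] (B ⧸ (I ^ n • ⊤ : Submodule R B)) :=
  LinearMap.liftQ₂ _ _ ((LinearMap.mul R B).compr₂ (Submodule.mkQ (I ^ n • ⊤ : Submodule R B)))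
    (fun _ hx => LinearMap.ext fun y =>
      (Submodule.Quotient.mk_eq_zero _).mpr (mul_mem_pow_smul_top_left I n hx y))
    (fun _ hy => LinearMap.ext fun x =>
      (Submodule.Quotient.mk_eq_zero _).mpr (mul_mem_pow_smul_top_right I n x hy))

theorem quotMul_mk (n : ℕ) (x y : B) :
    quotMul I n (Submodule.Quotient.mk x) (Submodule.Quotient.mk y) =
      (Submodule.Quotient.mk (x * y) : B ⧸ (I ^ n • ⊤ : Submodule R B)) := rfl

instance (priority := low) instMulCompletion : Mul (AdicCompletion I B) where
  mul x y := ⟨fun n => quotMul I n (x.val n) (y.val n), by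
    intro m n hmn
    have hx := x.property hmn
    have hy := y.property hmn
    change _ = quotMul I m (x.val m) (y.val m)
    change AdicCompletion.transitionMap I B hmn (quotMul I n (x.val n) (y.val n)) = _
    change AdicCompletion.transitionMap I B hmn (x.val n) = x.val m at hx
    change AdicCompletion.transitionMap I B hmn (y.val n) = y.val m at hy
    obtain ⟨a, ha⟩ := Submodule.Quotient.mk_surjective _ (x.val n)
    obtain ⟨b, hb⟩ := Submodule.Quotient.mk_surjective _ (y.val n)
    rw [← hx, ← hy, ← ha, ← hb]
    rfl⟩

instance (priority := low) instOneCompletion : One (AdicCompletion I B) where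
  one := AdicCompletion.of I B 1

theorem completion_mul_val (x y : AdicCompletion I B) (n : ℕ) :
    (x * y).val n = quotMul I n (x.val n) (y.val n) := rfl

theorem completion_one_val (n : ℕ) :
    (1 : AdicCompletion I B).val n = Submodule.Quotient.mk 1 := rfl

instance (priority := low) instRingCompletion : Ring (AdicCompletion I B) where
  __ := (inferInstance : AddCommGroup (AdicCompletion I B))
  left_distrib x y z := AdicCompletion.ext fun n => by
    simp [completion_mul_val, AdicCompletion.val_add_apply]
  right_distrib x y z := AdicCompletion.ext fun n => by
    simp [completion_mul_val, AdicCompletion.val_add_apply]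
  zero_mul x := AdicCompletion.ext fun n => by
    simp [completion_mul_val, AdicCompletion.val_zero_apply]
  mul_zero x := AdicCompletion.ext fun n => by
    simp [completion_mul_val, AdicCompletion.val_zero_apply]
  mul_assoc x y z := AdicCompletion.ext fun n => by
    obtain ⟨a, ha⟩ := Submodule.Quotient.mk_surjective _ (x.val n)
    obtain ⟨b, hb⟩ := Submodule.Quotient.mk_surjective _ (y.val n)
    obtain ⟨c, hc⟩ := Submodule.Quotient.mk_surjective _ (z.val n)
    simp only [completion_mul_val, ← ha, ← hb, ← hc, quotMul_mk, mul_assoc]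
  one_mul x := AdicCompletion.ext fun n => by
    obtain ⟨a, ha⟩ := Submodule.Quotient.mk_surjective _ (x.val n)
    simp only [completion_mul_val, completion_one_val, ← ha, quotMul_mk, one_mul]
  mul_one x := AdicCompletion.ext fun n => by
    obtain ⟨a, ha⟩ := Submodule.Quotient.mk_surjective _ (x.val n)
    simp only [completion_mul_val, completion_one_val, ← ha, quotMul_mk, mul_one]

instance (priority := low) instAlgebraCompletion : Algebra R (AdicCompletion I B) :=
  Algebra.ofModule
    (fun r x y => AdicCompletion.ext fun n => by
      simp only [completion_mul_val, AdicCompletion.val_smul_apply, map_smul,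
        LinearMap.smul_apply])
    (fun r x y => AdicCompletion.ext fun n => by
      simp only [completion_mul_val, AdicCompletion.val_smul_apply, map_smul])

theorem completion_of_mul (x y : B) :
    AdicCompletion.of I B (x * y) = AdicCompletion.of I B x * AdicCompletion.of I B y := rfl

theorem completion_of_one : AdicCompletion.of I B 1 = 1 := rfl

/-- The extension to the completion of a linear map into an adically complete module. -/
def extend {M : Type v} [AddCommGroup M] [Module R M] {N : Type w} [AddCommGroup N] [Module R N]
    [IsAdicComplete I N] (f : M →ₗ[R] N) : AdicCompletion I M →ₗ[R] N :=
  (AdicCompletion.ofLinearEquiv I N).symm.toLinearMap ∘ₗ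
    (AdicCompletion.map I f).restrictScalars R

theorem extend_of {M : Type v} [AddCommGroup M] [Module R M] {N : Type w} [AddCommGroup N]
    [Module R N] [IsAdicComplete I N] (f : M →ₗ[R] N) (x : M) :
    extend I f (AdicCompletion.of I M x) = f x := by
  simp [extend, AdicCompletion.map_of]

/-- The map of completions induced by a linear map, as a map over the base ring. -/
def cmap {M : Type v} [AddCommGroup M] [Module R M] {N : Type w} [AddCommGroup N] [Module R N]
    (f : M →ₗ[R] N) : AdicCompletion I M →ₗ[R] AdicCompletion I N :=
  (AdicCompletion.map I f).restrictScalars R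

end CompletionAlgebra

/-! ## The ring of formal power series, completions, exponentials -/

section Formal

variable (k : Type u) [Field k]

/-- The ideal generated by the formal parameter `ħ` in `k⟦ħ⟧`. -/
abbrev hIdeal : Ideal k⟦X⟧ := Ideal.span {PowerSeries.X}

/-- The `ħ`-adic completion of a `k⟦ħ⟧`-module. -/
abbrev HComp (M : Type v) [AddCommGroup M] [Module k⟦X⟧ M] : Type v :=
  AdicCompletion (hIdeal k) M

/-- The `ħ`-completed tensor product. -/
abbrev CTensor (M : Type v) (N : Type w) [AddCommGroup M] [Module k⟦X⟧ M]
    [AddCommGroup N] [Module k⟦X⟧ N] : Type _ :=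
  HComp k (M ⊗[k⟦X⟧] N)

instance isAdicComplete_HComp (M : Type v) [AddCommGroup M] [Module k⟦X⟧ M] :
    IsAdicComplete (hIdeal k) (HComp k M) :=
  AdicCompletion.isAdicComplete (Submodule.fg_span_singleton _)

/-- The sum `∑ ħ ^ n a n` in an `ħ`-adically complete module. -/
def hsum {M : Type v} [AddCommGroup M] [Module k⟦X⟧ M] [IsAdicComplete (hIdeal k) M]
    (a : ℕ → M) : M :=
  (AdicCompletion.ofLinearEquiv (hIdeal k) M).symm
    (AdicCompletion.mk (hIdeal k) M
      (AdicCompletion.AdicCauchySequence.mk (hIdeal k) M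
        (fun n => ∑ j ∈ Finset.range n, (PowerSeries.X : k⟦X⟧) ^ j • a j)
        (fun n => by
          rw [Finset.sum_range_succ, SModEq.sub_mem, sub_add_cancel_left, neg_mem_iff]
          exact Submodule.smul_mem_smul
            (Ideal.pow_mem_pow (Ideal.mem_span_singleton_self _) n) trivial)))

theorem hsum_spec {M : Type v} [AddCommGroup M] [Module k⟦X⟧ M] [IsAdicComplete (hIdeal k) M]
    (a : ℕ → M) (n : ℕ) :
    hsum k a - ∑ j ∈ Finset.range n, (PowerSeries.X : k⟦X⟧) ^ j • a j ∈
      (hIdeal k ^ n • ⊤ : Submodule k⟦X⟧ M) := by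
  have h : AdicCompletion.of (hIdeal k) M (hsum k a) = _ :=
    AdicCompletion.of_ofLinearEquiv_symm (hIdeal k) _
  have h' := congrArg (fun z => z.val n) h
  exact (Submodule.Quotient.eq _).mp h'

/-- `exp (ħ x) = ∑ ħ ^ n x ^ n / n!` in an `ħ`-adically complete algebra. -/
def hexp {H : Type v} [Ring H] [Algebra k⟦X⟧ H] [IsAdicComplete (hIdeal k) H] (x : H) : H :=
  hsum k fun n => PowerSeries.C ((n.factorial : k)⁻¹) • x ^ n

/-- `(exp (ħ x) - 1) / ħ = ∑ ħ ^ n x ^ (n + 1) / (n + 1)!`. -/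
def hexpDiv {H : Type v} [Ring H] [Algebra k⟦X⟧ H] [IsAdicComplete (hIdeal k) H] (x : H) : H :=
  hsum k fun n => PowerSeries.C (((n + 1).factorial : k)⁻¹) • x ^ (n + 1)

theorem X_smul_hexpDiv {H : Type v} [Ring H] [Algebra k⟦X⟧ H] [IsAdicComplete (hIdeal k) H]
    (x : H) : (PowerSeries.X : k⟦X⟧) • hexpDiv k x = hexp k x - 1 := by
  refine (IsHausdorff.eq_iff_smodEq (I := hIdeal k)).mpr fun n => ?_
  rw [SModEq.sub_mem]
  have h1 := hsum_spec k (fun n => PowerSeries.C (((n + 1).factorial : k)⁻¹) • x ^ (n + 1)) n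
  have h2 := hsum_spec k (fun n => PowerSeries.C ((n.factorial : k)⁻¹) • x ^ n) (n + 1)
  have h2' := Submodule.smul_mono_left (N := (⊤ : Submodule k⟦X⟧ H))
    (Ideal.pow_le_pow_right (I := hIdeal k) (Nat.le_succ n)) h2
  have h1' := Submodule.smul_mem _ (PowerSeries.X : k⟦X⟧) h1
  have h := sub_mem h1' h2'
  convert h using 1
  change _ = (PowerSeries.X : k⟦X⟧) • (hexpDiv k x - _) - (hexp k x - _)
  rw [Finset.sum_range_succ', smul_sub, Finset.smul_sum]
  simp only [pow_succ', pow_zero, Nat.factorial_zero, Nat.cast_one, inv_one, map_one, one_smul,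
    smul_smul, mul_assoc]
  abel

variable {k}

/-- The scalar `exp (ħ c)` of `k⟦ħ⟧`. -/
abbrev sexp (c : k⟦X⟧) : k⟦X⟧ := hexp k c

/-- The symmetric `q`-number `[m] = (q ^ m - q⁻¹ ^ m) / (q - q⁻¹)`, i.e.
`q ^ (m - 1) + q ^ (m - 3) + ⋯ + q ^ (1 - m)`, for `q = exp (ħ d)`. -/
def qNum (d : k⟦X⟧) (m : ℕ) : k⟦X⟧ :=
  ∑ s ∈ Finset.range m, sexp (((m : ℤ) - 1 - 2 * s : ℤ) • d)

/-- The symmetric `q`-factorial for `q = exp (ħ d)`. -/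
def qFact (d : k⟦X⟧) (m : ℕ) : k⟦X⟧ := ∏ s ∈ Finset.range m, qNum d (s + 1)

/-- The symmetric `q`-binomial coefficient for `q = exp (ħ d)`; the `q`-factorials are units of
`k⟦ħ⟧`, as their constant terms are factorials. -/
def qBinom (d : k⟦X⟧) (m s : ℕ) : k⟦X⟧ :=
  qFact d m * (qFact d s)⁻¹ * (qFact d (m - s))⁻¹

end Formal

/-! ## Realizations of a multiparameter matrix -/

section Realizations

/-- A symmetrizable generalized Cartan matrix `A`, with positive integers `d i` such that
`D A` is symmetric for `D = diag (d i)`. -/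
structure CartanDatum (n : ℕ) where
  A : Matrix (Fin n) (Fin n) ℤ
  d : Fin n → ℕ
  diag : ∀ i, A i i = 2
  nonpos : ∀ i j, i ≠ j → A i j ≤ 0
  zero_symm : ∀ i j, A i j = 0 → A j i = 0
  d_pos : ∀ i, 0 < d i
  symm : ∀ i j, (d i : ℤ) * A i j = d j * A j i

/-- The matrix `D A`, with entries in `k⟦ħ⟧`. -/
def CartanDatum.DA {n : ℕ} (C : CartanDatum n) (k : Type u) [Field k] :
    Matrix (Fin n) (Fin n) k⟦X⟧ :=
  Matrix.of fun i j => (((C.d i : ℤ) * C.A i j : ℤ) : k⟦X⟧)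

/-- `P` is of Cartan type with Cartan matrix `A` when `P + Pᵀ = 2 D A`. -/
def CartanDatum.IsCartanType {n : ℕ} (C : CartanDatum n) {k : Type u} [Field k]
    (P : Matrix (Fin n) (Fin n) k⟦X⟧) : Prop :=
  P + P.transpose = (2 : k⟦X⟧) • C.DA k

/-- Linear independence of a family modulo `ħ`. -/
def LinIndepModH (k : Type u) [Field k] {ι : Type w} {M : Type v} [AddCommGroup M]
    [Module k⟦X⟧ M] (x : ι → M) : Prop :=
  LinearIndependent (k⟦X⟧ ⧸ hIdeal k)
    (fun i => (Submodule.Quotient.mk (x i) : M ⧸ (hIdeal k • ⊤ : Submodule k⟦X⟧ M)))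

variable {k : Type u} [Field k] {n : ℕ}

/-- The element `S = (T⁺ + T⁻) / 2`. -/
def halfSum {M : Type v} [AddCommGroup M] [Module k⟦X⟧ M] (x y : M) : M :=
  PowerSeries.C (2⁻¹ : k) • (x + y)

/-- A realization of the matrix `P` on the `k⟦ħ⟧`-module `𝔥` (which is assumed free of finite rank
in the statements): roots `α j`, and coroots `T⁺ i` and `T⁻ i`. -/
structure Realization (P : Matrix (Fin n) (Fin n) k⟦X⟧) (𝔥 : Type v) [AddCommGroup 𝔥]
    [Module k⟦X⟧ 𝔥] where
  α : Fin n → Module.Dual k⟦X⟧ 𝔥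
  Tp : Fin n → 𝔥
  Tm : Fin n → 𝔥
  α_Tp : ∀ i j, α j (Tp i) = P i j
  α_Tm : ∀ i j, α j (Tm i) = P j i
  indep : LinIndepModH k fun i => halfSum (k := k) (Tp i) (Tm i)

variable {P : Matrix (Fin n) (Fin n) k⟦X⟧} {𝔥 : Type v} [AddCommGroup 𝔥] [Module k⟦X⟧ 𝔥]

namespace Realization

/-- Straight: the roots are linearly independent modulo `ħ`. -/
def IsStraight (R : Realization P 𝔥) : Prop := LinIndepModH k R.α

/-- Small: the elements `S i` have the same span as the coroots. -/
def IsSmall (R : Realization P 𝔥) : Prop :=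
  Submodule.span k⟦X⟧ (Set.range fun i => halfSum (k := k) (R.Tp i) (R.Tm i)) =
    Submodule.span k⟦X⟧ (Set.range R.Tp ∪ Set.range R.Tm)

/-- Split: the coroots `T⁺ i`, `T⁻ i` are linearly independent modulo `ħ`. -/
def IsSplit (R : Realization P 𝔥) : Prop := LinIndepModH k (Sum.elim R.Tp R.Tm)

/-- Minimal: the coroots span `𝔥`. -/
def IsMinimal (R : Realization P 𝔥) : Prop :=
  Submodule.span k⟦X⟧ (Set.range R.Tp ∪ Set.range R.Tm) = ⊤

end Realization

end Realizations

/-! ## Formal multiparameter quantum universal enveloping algebras -/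

section Algebras

variable {k : Type u} [Field k] {n : ℕ}

/-- Symbols for the generators. -/
inductive Gen (n : ℕ) (𝔥 : Type v) : Type v
  | T (x : 𝔥) : Gen n 𝔥
  | E (i : Fin n) : Gen n 𝔥
  | F (i : Fin n) : Gen n 𝔥

/-- The `ħ`-adically completed free `k⟦ħ⟧`-algebra on the symbols for the generators. -/
abbrev FreeComp (k : Type u) [Field k] (n : ℕ) (𝔥 : Type v) : Type (max u v) :=
  HComp k (FreeAlgebra k⟦X⟧ (Gen n 𝔥))

/-- A generator in the completed free algebra. -/
def fgen (k : Type u) [Field k] {𝔥 : Type v} (g : Gen n 𝔥) : FreeComp k n 𝔥 :=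
  AdicCompletion.of (hIdeal k) _ (FreeAlgebra.ι k⟦X⟧ g)

variable {P : Matrix (Fin n) (Fin n) k⟦X⟧} {𝔥 : Type v} [AddCommGroup 𝔥] [Module k⟦X⟧ 𝔥]

/-- The factor `q_{ij} ^ (s / 2) * q_{ji} ^ (- s / 2)`, where `q_{ij} = exp (ħ p_{ij})`. -/
def qSkew (P : Matrix (Fin n) (Fin n) k⟦X⟧) (i j : Fin n) (s : ℤ) : k⟦X⟧ :=
  sexp (PowerSeries.C ((s : k) / 2) * (P i j - P j i))

/-- `1 - a_{ij}`, a positive integer when `i ≠ j`. -/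
def serreExp (C : CartanDatum n) (i j : Fin n) : ℕ := (1 - C.A i j).toNat

/-- The (two-sided) quantum Serre sum
`∑ (-1) ^ s [1 - a_{ij} choose s]_{q_i} (q_{ij} / q_{ji}) ^ (± s / 2) x ^ (1 - a_{ij} - s) y x ^ s`,
with `σ = ± 1` the sign of the exponent. -/
def serreSum (C : CartanDatum n) (P : Matrix (Fin n) (Fin n) k⟦X⟧) (σ : ℤ) (i j : Fin n)
    {H : Type w} [Ring H] [Algebra k⟦X⟧ H] (x y : H) : H :=
  ∑ s ∈ Finset.range (serreExp C i j + 1),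
    ((-1) ^ s * qBinom (C.d i : k⟦X⟧) (serreExp C i j) s * qSkew P i j (σ * s)) •
      (x ^ (serreExp C i j - s) * y * x ^ s)

/-- The element `(q_i - q_i⁻¹) / ħ` of `k⟦ħ⟧`, where `q_i = exp (ħ d_i)`; its constant term is
`2 d_i`. -/
def qDenom (k : Type u) [Field k] (C : CartanDatum n) (i : Fin n) : k⟦X⟧ :=
  hexpDiv k (C.d i : k⟦X⟧) - hexpDiv k (-(C.d i : k⟦X⟧))

/-- The element `(exp (ħ x) - exp (- ħ y)) / (q_i - q_i⁻¹)`, where numerator and denominator are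
first divided by `ħ`; the denominator is then a unit of `k⟦ħ⟧` in characteristic zero. -/
def qQuot (k : Type u) [Field k] (C : CartanDatum n) (i : Fin n) {H : Type w} [Ring H] [Algebra k⟦X⟧ H]
    [IsAdicComplete (hIdeal k) H] (x y : H) : H :=
  (qDenom k C i)⁻¹ • (hexpDiv k x - hexpDiv k (-y))

/-- The defining relations. -/
inductive Rel (C : CartanDatum n) (R : Realization P 𝔥) :
    FreeComp k n 𝔥 → FreeComp k n 𝔥 → Prop
  | T_add (x y : 𝔥) : Rel C R (fgen k (.T (x + y))) (fgen k (.T x) + fgen k (.T y))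
  | T_smul (c : k⟦X⟧) (x : 𝔥) : Rel C R (fgen k (.T (c • x))) (c • fgen k (.T x))
  | T_T (x y : 𝔥) :
      Rel C R (fgen k (.T x) * fgen k (.T y)) (fgen k (.T y) * fgen k (.T x))
  | T_E (x : 𝔥) (j : Fin n) :
      Rel C R (fgen k (.T x) * fgen k (.E j) - fgen k (.E j) * fgen k (.T x))
        (R.α j x • fgen k (.E j))
  | T_F (x : 𝔥) (j : Fin n) :
      Rel C R (fgen k (.T x) * fgen k (.F j) - fgen k (.F j) * fgen k (.T x))
        (-(R.α j x) • fgen k (.F j))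
  | E_F (i j : Fin n) :
      Rel C R (fgen k (.E i) * fgen k (.F j) - fgen k (.F j) * fgen k (.E i))
        (if i = j then qQuot k C i (fgen k (.T (R.Tp i))) (fgen k (.T (R.Tm i))) else 0)
  | serre_E (i j : Fin n) (hij : i ≠ j) :
      Rel C R (serreSum C P 1 i j (fgen k (.E i)) (fgen k (.E j))) 0
  | serre_F (i j : Fin n) (hij : i ≠ j) :
      Rel C R (serreSum C P (-1) i j (fgen k (.F i)) (fgen k (.F j))) 0

/-- The FoMpQUEA over `P` with realization `R`: the `ħ`-adically complete algebra topologically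
generated by `𝔥`, `E i`, `F i` subject to the defining relations, i.e. the `ħ`-adic completion of
the quotient of the completed free algebra by the ideal that the relations generate. -/
def FoMpQUEA (C : CartanDatum n) (R : Realization P 𝔥) : Type (max u v) :=
  HComp k (RingQuot (Rel C R))

namespace FoMpQUEA

variable (C : CartanDatum n) (R : Realization P 𝔥)

instance : Ring (FoMpQUEA C R) := inferInstanceAs (Ring (HComp k (RingQuot (Rel C R))))

instance : Algebra k⟦X⟧ (FoMpQUEA C R) :=
  inferInstanceAs (Algebra k⟦X⟧ (HComp k (RingQuot (Rel C R))))

instance : IsAdicComplete (hIdeal k) (FoMpQUEA C R) :=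
  inferInstanceAs (IsAdicComplete (hIdeal k) (HComp k (RingQuot (Rel C R))))

/-- A generator of the FoMpQUEA. -/
def gen (g : Gen n 𝔥) : FoMpQUEA C R :=
  AdicCompletion.of (hIdeal k) (RingQuot (Rel C R)) (RingQuot.mkAlgHom k⟦X⟧ (Rel C R) (fgen k g))

/-- The element of the FoMpQUEA given by `x` in `𝔥`. -/
abbrev T (x : 𝔥) : FoMpQUEA C R := gen C R (.T x)

/-- The generator `E i`. -/
abbrev E (i : Fin n) : FoMpQUEA C R := gen C R (.E i)

/-- The generator `F i`. -/
abbrev F (i : Fin n) : FoMpQUEA C R := gen C R (.F i)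

end FoMpQUEA

/-- The two signs, for the two Borel subalgebras. -/
inductive BorelSign : Type
  | plus : BorelSign
  | minus : BorelSign

/-- The generators of a Borel subalgebra: `𝔥` and all `E i`, or `𝔥` and all `F i`. -/
def borelGen (C : CartanDatum n) (R : Realization P 𝔥) : BorelSign → Set (FoMpQUEA C R)
  | .plus => Set.range (FoMpQUEA.T C R) ∪ Set.range (FoMpQUEA.E C R)
  | .minus => Set.range (FoMpQUEA.T C R) ∪ Set.range (FoMpQUEA.F C R)

/-- The Borel FoMpQUEA: the smallest `ħ`-adically complete unital subalgebra that contains the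
generators. -/
def borel (C : CartanDatum n) (R : Realization P 𝔥) (s : BorelSign) :
    Subalgebra k⟦X⟧ (FoMpQUEA C R) :=
  sInf {B | borelGen C R s ⊆ B ∧ IsAdicComplete (hIdeal k) B}

end Algebras

/-! ## Topological Hopf algebras and their twist deformations -/

section Hopf

variable {k : Type u} [Field k]

section Canonical

variable (M : Type v) [AddCommGroup M] [Module k⟦X⟧ M] (N : Type w) [AddCommGroup N]
  [Module k⟦X⟧ N]

theorem cmap_add (f g : M →ₗ[k⟦X⟧] N) :
    cmap (hIdeal k) (f + g) = cmap (hIdeal k) f + cmap (hIdeal k) g := by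
  ext x m
  rfl

theorem cmap_smul (c : k⟦X⟧) (f : M →ₗ[k⟦X⟧] N) :
    cmap (hIdeal k) (c • f) = c • cmap (hIdeal k) f := by
  ext x m
  rfl

/-- The canonical map from the tensor product of a completion with a module to the completed
tensor product. -/
def completeLeft : HComp k M ⊗[k⟦X⟧] N →ₗ[k⟦X⟧] CTensor k M N :=
  TensorProduct.lift (LinearMap.flip
    { toFun := fun y => cmap (hIdeal k) ((TensorProduct.mk k⟦X⟧ M N).flip y)
      map_add' := fun y z => by rw [map_add, cmap_add]
      map_smul' := fun c y => by rw [map_smul, cmap_smul]; rfl })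

/-- The canonical map from the tensor product of a module with a completion to the completed
tensor product. -/
def completeRight : M ⊗[k⟦X⟧] HComp k N →ₗ[k⟦X⟧] CTensor k M N :=
  TensorProduct.lift
    { toFun := fun x => cmap (hIdeal k) (TensorProduct.mk k⟦X⟧ M N x)
      map_add' := fun y z => by rw [map_add, cmap_add]
      map_smul' := fun c y => by rw [map_smul, cmap_smul]; rfl }

end Canonical

/-- Structure maps of a topological Hopf algebra on an algebra `H` over `k⟦ħ⟧` (for which the
axioms are stated separately). -/
structure HopfData (k : Type u) [Field k] (H : Type v) [Ring H] [Algebra k⟦X⟧ H] where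
  comul : H →ₐ[k⟦X⟧] CTensor k H H
  counit : H →ₐ[k⟦X⟧] k⟦X⟧
  antipode : H →ₗ[k⟦X⟧] H

namespace HopfData

variable {H : Type v} [Ring H] [Algebra k⟦X⟧ H] (𝓗 : HopfData k H)

/-- The map `Δ ⊗ id` on the completed tensor square. -/
def comulLeft : CTensor k H H →ₗ[k⟦X⟧] CTensor k (H ⊗[k⟦X⟧] H) H :=
  extend (hIdeal k) (completeLeft (k := k) (H ⊗[k⟦X⟧] H) H ∘ₗ
    TensorProduct.map 𝓗.comul.toLinearMap LinearMap.id)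

/-- The map `id ⊗ Δ` on the completed tensor square. -/
def comulRight : CTensor k H H →ₗ[k⟦X⟧] CTensor k H (H ⊗[k⟦X⟧] H) :=
  extend (hIdeal k) (completeRight (k := k) H (H ⊗[k⟦X⟧] H) ∘ₗ
    TensorProduct.map LinearMap.id 𝓗.comul.toLinearMap)

/-- The associativity isomorphism of the completed tensor cube. -/
def cassoc (k : Type u) [Field k] (H : Type v) [Ring H] [Algebra k⟦X⟧ H] :
    CTensor k (H ⊗[k⟦X⟧] H) H →ₗ[k⟦X⟧] CTensor k H (H ⊗[k⟦X⟧] H) :=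
  cmap (hIdeal k) (TensorProduct.assoc k⟦X⟧ H H H).toLinearMap

variable [IsAdicComplete (hIdeal k) H]

/-- The map `m (ε ⊗ id)` on the completed tensor square. -/
def counitLeft : CTensor k H H →ₗ[k⟦X⟧] H :=
  extend (hIdeal k) ((TensorProduct.lid k⟦X⟧ H).toLinearMap ∘ₗ
    TensorProduct.map 𝓗.counit.toLinearMap LinearMap.id)

/-- The map `m (id ⊗ ε)` on the completed tensor square. -/
def counitRight : CTensor k H H →ₗ[k⟦X⟧] H :=
  extend (hIdeal k) ((TensorProduct.rid k⟦X⟧ H).toLinearMap ∘ₗ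
    TensorProduct.map LinearMap.id 𝓗.counit.toLinearMap)

/-- The map `m (S ⊗ id)` on the completed tensor square. -/
def antipodeLeft : CTensor k H H →ₗ[k⟦X⟧] H :=
  extend (hIdeal k) (LinearMap.mul' k⟦X⟧ H ∘ₗ TensorProduct.map 𝓗.antipode LinearMap.id)

/-- The map `m (id ⊗ S)` on the completed tensor square. -/
def antipodeRight : CTensor k H H →ₗ[k⟦X⟧] H :=
  extend (hIdeal k) (LinearMap.mul' k⟦X⟧ H ∘ₗ TensorProduct.map LinearMap.id 𝓗.antipode)

/-- The axioms of a topological Hopf algebra. -/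
structure IsHopf : Prop where
  coassoc : ∀ x, cassoc k H (𝓗.comulLeft (𝓗.comul x)) = 𝓗.comulRight (𝓗.comul x)
  counit_left : ∀ x, 𝓗.counitLeft (𝓗.comul x) = x
  counit_right : ∀ x, 𝓗.counitRight (𝓗.comul x) = x
  antipode_left : ∀ x, 𝓗.antipodeLeft (𝓗.comul x) = algebraMap k⟦X⟧ H (𝓗.counit x)
  antipode_right : ∀ x, 𝓗.antipodeRight (𝓗.comul x) = algebraMap k⟦X⟧ H (𝓗.counit x)

/-- `F` is a twist: `F₁₂ (Δ ⊗ id) F = F₂₃ (id ⊗ Δ) F` and `(ε ⊗ id) F = 1 = (id ⊗ ε) F`. -/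
structure IsTwist (F : (CTensor k H H)ˣ) : Prop where
  cocycle :
    cassoc k H (cmap (hIdeal k) ((TensorProduct.mk k⟦X⟧ (H ⊗[k⟦X⟧] H) H).flip 1) F.val *
        𝓗.comulLeft F.val) =
      cmap (hIdeal k) (TensorProduct.mk k⟦X⟧ H (H ⊗[k⟦X⟧] H) 1) F.val * 𝓗.comulRight F.val
  counit_left : 𝓗.counitLeft F.val = 1
  counit_right : 𝓗.counitRight F.val = 1

/-- The twist deformation by `F`: same algebra and counit, coproduct `x ↦ F Δ(x) F⁻¹`, antipode
`x ↦ v S(x) v⁻¹` with `v = m (id ⊗ S) F` and `v⁻¹ = m (S ⊗ id) F⁻¹`. -/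
def twist (F : (CTensor k H H)ˣ) : HopfData k H where
  comul :=
    { toFun := fun x => F.val * 𝓗.comul x * F.inv
      map_one' := by simp
      map_mul' := fun x y => by
        rw [map_mul]
        calc F.val * (𝓗.comul x * 𝓗.comul y) * F.inv
            = F.val * 𝓗.comul x * 1 * 𝓗.comul y * F.inv := by simp only [mul_assoc, one_mul]
          _ = _ := by rw [← F.inv_val]; simp only [mul_assoc]
      map_zero' := by simp
      map_add' := fun x y => by rw [map_add, mul_add, add_mul]
      commutes' := fun c => by
        rw [AlgHom.commutes, ← Algebra.commutes, mul_assoc, F.val_inv, mul_one] }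
  counit := 𝓗.counit
  antipode := LinearMap.mulLeft k⟦X⟧ (𝓗.antipodeRight F.val) ∘ₗ
    LinearMap.mulRight k⟦X⟧ (𝓗.antipodeLeft F.inv) ∘ₗ 𝓗.antipode

end HopfData

section Iso

variable {H' : Type v} [Ring H'] [Algebra k⟦X⟧ H'] {H : Type w} [Ring H] [Algebra k⟦X⟧ H]

/-- The map `f ⊗ f` on completed tensor squares. -/
def cmapSq (f : H' →ₗ[k⟦X⟧] H) : CTensor k H' H' →ₗ[k⟦X⟧] CTensor k H H :=
  cmap (hIdeal k) (TensorProduct.map f f)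

/-- `e` is an isomorphism of topological Hopf algebras. -/
structure IsHopfIso (𝓗' : HopfData k H') (𝓗 : HopfData k H) (e : H' ≃ₐ[k⟦X⟧] H) : Prop where
  comul : ∀ x, cmapSq e.toLinearMap (𝓗'.comul x) = 𝓗.comul (e x)
  counit : ∀ x, 𝓗'.counit x = 𝓗.counit (e x)
  antipode : ∀ x, e (𝓗'.antipode x) = 𝓗.antipode (e x)

/-- An element of the completed tensor square of `H` lies in that of the subalgebra `B`, i.e. in
the image of the latter. -/
def MemSq (B : Subalgebra k⟦X⟧ H) (z : CTensor k H H) : Prop :=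
  ∃ δ : CTensor k B B, cmapSq B.val.toLinearMap δ = z

/-- `B` is a Hopf subalgebra: the coproduct and the antipode restrict to `B`. -/
structure IsHopfSubalgebra (𝓗 : HopfData k H) (B : Subalgebra k⟦X⟧ H) : Prop where
  comul : ∀ x ∈ B, MemSq B (𝓗.comul x)
  antipode : ∀ x ∈ B, 𝓗.antipode x ∈ B

/-- `e` is an isomorphism of topological Hopf algebras between two Hopf subalgebras, for the
restricted structures. -/
structure IsHopfIsoOn (𝓗' : HopfData k H') (B' : Subalgebra k⟦X⟧ H') (𝓗 : HopfData k H)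
    (B : Subalgebra k⟦X⟧ H) (e : B' ≃ₐ[k⟦X⟧] B) : Prop where
  left_sub : IsHopfSubalgebra 𝓗' B'
  right_sub : IsHopfSubalgebra 𝓗 B
  comul : ∀ (x : B') (δ : CTensor k B' B'), cmapSq B'.val.toLinearMap δ = 𝓗'.comul x →
    cmapSq B.val.toLinearMap (cmapSq e.toLinearMap δ) = 𝓗.comul (e x)
  counit : ∀ x : B', 𝓗'.counit x = 𝓗.counit (e x)
  antipode : ∀ x y : B', 𝓗'.antipode x = y → (e y : H) = 𝓗.antipode (e x)

end Iso

end Hopf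

/-! ## Toral twist deformations of FoMpQUEAs -/

section Toral

variable {k : Type u} [Field k] {n : ℕ} {P P' : Matrix (Fin n) (Fin n) k⟦X⟧}
  {𝔥 : Type v} [AddCommGroup 𝔥] [Module k⟦X⟧ 𝔥] {𝔥' : Type w} [AddCommGroup 𝔥'] [Module k⟦X⟧ 𝔥']

/-- The topological Hopf algebra structure of a FoMpQUEA, characterized by its values on the
generators. -/
structure IsFoMpHopf (C : CartanDatum n) (R : Realization P 𝔥) (𝓗 : HopfData k (FoMpQUEA C R)) :
    Prop where
  isHopf : 𝓗.IsHopf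
  comul_T : ∀ x : 𝔥, 𝓗.comul (FoMpQUEA.T C R x) = AdicCompletion.of (hIdeal k) _
    (FoMpQUEA.T C R x ⊗ₜ[k⟦X⟧] 1 + 1 ⊗ₜ[k⟦X⟧] FoMpQUEA.T C R x)
  comul_E : ∀ i, 𝓗.comul (FoMpQUEA.E C R i) = AdicCompletion.of (hIdeal k) _
    (FoMpQUEA.E C R i ⊗ₜ[k⟦X⟧] 1 +
      hexp k (FoMpQUEA.T C R (R.Tp i)) ⊗ₜ[k⟦X⟧] FoMpQUEA.E C R i)
  comul_F : ∀ i, 𝓗.comul (FoMpQUEA.F C R i) = AdicCompletion.of (hIdeal k) _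
    (FoMpQUEA.F C R i ⊗ₜ[k⟦X⟧] hexp k (-FoMpQUEA.T C R (R.Tm i)) +
      1 ⊗ₜ[k⟦X⟧] FoMpQUEA.F C R i)
  counit_T : ∀ x : 𝔥, 𝓗.counit (FoMpQUEA.T C R x) = 0
  counit_E : ∀ i, 𝓗.counit (FoMpQUEA.E C R i) = 0
  counit_F : ∀ i, 𝓗.counit (FoMpQUEA.F C R i) = 0
  antipode_T : ∀ x : 𝔥, 𝓗.antipode (FoMpQUEA.T C R x) = -FoMpQUEA.T C R x
  antipode_E : ∀ i, 𝓗.antipode (FoMpQUEA.E C R i) =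
    -(hexp k (-FoMpQUEA.T C R (R.Tp i)) * FoMpQUEA.E C R i)
  antipode_F : ∀ i, 𝓗.antipode (FoMpQUEA.F C R i) =
    -(FoMpQUEA.F C R i * hexp k (FoMpQUEA.T C R (R.Tm i)))

/-- The element `exp (ħ / 2 ∑ φ g h • H g ⊗ H h)`. -/
def toralTwist (C : CartanDatum n) (R : Realization P 𝔥) {t : ℕ}
    (b : Module.Basis (Fin t) k⟦X⟧ 𝔥) (Φ : Matrix (Fin t) (Fin t) k⟦X⟧) :
    CTensor k (FoMpQUEA C R) (FoMpQUEA C R) :=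
  hexp k (AdicCompletion.of (hIdeal k) _ (PowerSeries.C (2⁻¹ : k) •
    ∑ g, ∑ h, Φ g h • (FoMpQUEA.T C R (b g) ⊗ₜ[k⟦X⟧] FoMpQUEA.T C R (b h))))

/-- The FoMpQUEA of `R'` is isomorphic, as a topological Hopf algebra, to the toral twist
deformation of the FoMpQUEA of `R` given by `Φ` with respect to the basis `b` of `𝔥`. -/
def IsToralTwist (C : CartanDatum n) (R' : Realization P' 𝔥') (R : Realization P 𝔥) {t : ℕ}
    (b : Module.Basis (Fin t) k⟦X⟧ 𝔥) (Φ : Matrix (Fin t) (Fin t) k⟦X⟧) : Prop :=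
  ∃ (𝓗' : HopfData k (FoMpQUEA C R')) (𝓗 : HopfData k (FoMpQUEA C R))
    (F : (CTensor k (FoMpQUEA C R) (FoMpQUEA C R))ˣ) (e : FoMpQUEA C R' ≃ₐ[k⟦X⟧] FoMpQUEA C R),
    IsFoMpHopf C R' 𝓗' ∧ IsFoMpHopf C R 𝓗 ∧
    F.val = toralTwist C R b Φ ∧ 𝓗.IsTwist F ∧
    IsHopfIso 𝓗' (𝓗.twist F) e

/-- The Borel FoMpQUEA of `R'` (for one of the two signs) is isomorphic, as a topological Hopf
algebra, to the toral twist deformation of the Borel FoMpQUEA of `R` given by `Φ` with respect to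
the basis `b` of `𝔥`. The Borel FoMpQUEAs are Hopf subalgebras, and the twist and its inverse lie
in the completed tensor square of the Borel FoMpQUEA. -/
def IsBorelToralTwist (C : CartanDatum n) (s : BorelSign) (R' : Realization P' 𝔥')
    (R : Realization P 𝔥) {t : ℕ} (b : Module.Basis (Fin t) k⟦X⟧ 𝔥)
    (Φ : Matrix (Fin t) (Fin t) k⟦X⟧) : Prop :=
  ∃ (𝓗' : HopfData k (FoMpQUEA C R')) (𝓗 : HopfData k (FoMpQUEA C R))
    (F : (CTensor k (FoMpQUEA C R) (FoMpQUEA C R))ˣ) (e : borel C R' s ≃ₐ[k⟦X⟧] borel C R s),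
    IsFoMpHopf C R' 𝓗' ∧ IsFoMpHopf C R 𝓗 ∧
    F.val = toralTwist C R b Φ ∧ 𝓗.IsTwist F ∧
    MemSq (borel C R s) F.val ∧ MemSq (borel C R s) F.inv ∧
    IsHopfSubalgebra 𝓗 (borel C R s) ∧
    IsHopfIsoOn 𝓗' (borel C R' s) (𝓗.twist F) (borel C R s) e

end Toral

end FoMp

/-! Fix straight realizations of `P` and `P'` of the same rank. The vectors `S i = (T⁺ i + T⁻ i) /
2` satisfy `α j (S i) = (D A) i j` whichever of the two matrices is used. A straight realization
therefore carries two independent families, `α` and `S`, paired by `D A`, and two such systems of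
the same rank are isomorphic by some `g : 𝔥' ≃ 𝔥` (`exists_linearEquiv`). What `g` fails to match is
the difference `T⁺ - T⁻`. The defect is a family `L i` with `g (T'⁺ i) = T⁺ i - 2 L i` and `g (T'⁻
i) = T⁻ i + 2 L i`. The matrix `α i (L j)` is skew because `P` and `P'` have the same symmetric part
(`ToralShift`, `exists_toralShift`).

A skew defect gives an isomorphism of algebras `T x ↦ T (g x)`, `E i ↦ exp (-ħ L i) E i`, `F i ↦ exp
(-ħ L i) F i` (`ToralShift.genRel`, `ToralShift.equiv`). In the Serre relations the toral factors
multiply the parameter `(q_ij / q_ji) ^ (1/2)` by exactly the amount by which `P'` changes it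
(`exists_serreG_toral`). In the relation between `E i` and `F i` the factor `exp (-2 ħ L i)` shifts
the two exponents (`hexp_mul_qQuot`).

On the other side, let `c` be a skew tensor on `𝔥` and put `L i = (α i ⊗ id) c`. Conjugation by `exp
(ħ c)` multiplies `E i ⊗ 1` by `1 ⊗ exp (ħ L i)` and `1 ⊗ E i` by `exp (-ħ L i) ⊗ 1` (`conj_tl`,
`conj_tr`), with inverse factors for `F i`. The rescaled generators then have, in the twisted
coalgebra, the coproducts prescribed for the coroots `T⁺ i - 2 L i` and `T⁻ i + 2 L i`
(`ToralShift.comul_hom`). Skewness of `c` makes the twisting element `v` equal to `1`, so the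
antipode is unchanged (`twist_antipode`).

It remains to find `c` from `L`. The roots are independent modulo `ħ`, hence have a dual family `θ
i`, and `c = ∑ θ i ∧ L i - ∑ α j (L i) θ i ⊗ θ j` works (`exists_skew_contract`). Then `Φ = 2 c`,
written in any prescribed basis (`exists_toralTwist`).

The topological Hopf structure is itself constructed. The coproduct comes from the universal
property, whose hard relation is the Serre relation for a sum of skew-commuting elements; it follows
from a factorization of the Serre sum into iterated `q`-commutators (`serreG_succ`,
`serreG_add_add`). The antipode is a homomorphism to the opposite algebra. For the Borel subalgebras
all maps are restricted, since they preserve generators and sums of series in powers of `ħ`. -/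

namespace FoMp

universe v' w'

/-! ### Series in powers of `ħ` -/

section HsumCalculus

variable {k : Type u} [Field k]

theorem mem_hpow_iff {M : Type v} [AddCommGroup M] [Module k⟦X⟧ M] {n : ℕ} {x : M} :
    x ∈ (hIdeal k ^ n • ⊤ : Submodule k⟦X⟧ M) ↔ ∃ y, x = (PowerSeries.X : k⟦X⟧) ^ n • y := by
  rw [hIdeal, Ideal.span_singleton_pow, Submodule.ideal_span_singleton_smul]
  constructor
  · intro h
    obtain ⟨y, -, hy⟩ := (Submodule.mem_smul_pointwise_iff_exists _ _ _).mp h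
    exact ⟨y, hy.symm⟩
  · rintro ⟨y, rfl⟩
    exact Submodule.smul_mem_pointwise_smul _ _ _ trivial

theorem X_pow_smul_mem {M : Type v} [AddCommGroup M] [Module k⟦X⟧ M] (n : ℕ) (y : M) :
    (PowerSeries.X : k⟦X⟧) ^ n • y ∈ (hIdeal k ^ n • ⊤ : Submodule k⟦X⟧ M) :=
  mem_hpow_iff.mpr ⟨y, rfl⟩

theorem map_mem_hpow {M : Type v} [AddCommGroup M] [Module k⟦X⟧ M] {N : Type w} [AddCommGroup N]
    [Module k⟦X⟧ N] (f : M →ₗ[k⟦X⟧] N) {n : ℕ} {x : M}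
    (hx : x ∈ (hIdeal k ^ n • ⊤ : Submodule k⟦X⟧ M)) :
    f x ∈ (hIdeal k ^ n • ⊤ : Submodule k⟦X⟧ N) := by
  obtain ⟨y, rfl⟩ := mem_hpow_iff.mp hx
  rw [map_smul]
  exact X_pow_smul_mem n _

theorem eq_zero_of_forall_mem {M : Type v} [AddCommGroup M] [Module k⟦X⟧ M]
    [IsHausdorff (hIdeal k) M] {x : M}
    (h : ∀ n, x ∈ (hIdeal k ^ n • ⊤ : Submodule k⟦X⟧ M)) : x = 0 :=
  IsHausdorff.haus ‹_› x fun n => by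
    rw [SModEq.zero]; exact h n

theorem eq_of_forall_sub_mem {M : Type v} [AddCommGroup M] [Module k⟦X⟧ M]
    [IsHausdorff (hIdeal k) M] {x y : M}
    (h : ∀ n, x - y ∈ (hIdeal k ^ n • ⊤ : Submodule k⟦X⟧ M)) : x = y :=
  sub_eq_zero.mp (eq_zero_of_forall_mem h)

/-- Partial sums determine a sum by separatedness; identities of series are reduced to congruences
modulo `ħ ^ n`. -/
theorem eq_hsum {M : Type v} [AddCommGroup M] [Module k⟦X⟧ M] [IsAdicComplete (hIdeal k) M]
    {a : ℕ → M} {x : M} (h : ∀ n, x - ∑ j ∈ Finset.range n, (PowerSeries.X : k⟦X⟧) ^ j • a j ∈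
      (hIdeal k ^ n • ⊤ : Submodule k⟦X⟧ M)) : x = hsum k a :=
  eq_of_forall_sub_mem fun n => by
    have := sub_mem (h n) (hsum_spec k a n)
    simpa using this

/-- Linearity alone suffices: a linear map sends `ħ ^ n M` into `ħ ^ n N`, so it is continuous. -/
theorem map_hsum {M : Type v} [AddCommGroup M] [Module k⟦X⟧ M] [IsAdicComplete (hIdeal k) M]
    {N : Type w} [AddCommGroup N] [Module k⟦X⟧ N] [IsAdicComplete (hIdeal k) N]
    (f : M →ₗ[k⟦X⟧] N) (a : ℕ → M) : f (hsum k a) = hsum k fun n => f (a n) :=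
  eq_hsum fun n => by
    have := map_mem_hpow f (hsum_spec k a n)
    simpa [map_sub, map_sum, map_smul] using this

theorem hsum_add {M : Type v} [AddCommGroup M] [Module k⟦X⟧ M] [IsAdicComplete (hIdeal k) M]
    (a b : ℕ → M) : (hsum k fun n => a n + b n) = hsum k a + hsum k b :=
  (eq_hsum fun n => by
    have := add_mem (hsum_spec k a n) (hsum_spec k b n)
    convert this using 1
    simp only [smul_add, Finset.sum_add_distrib]
    abel).symm

theorem hsum_zero {M : Type v} [AddCommGroup M] [Module k⟦X⟧ M] [IsAdicComplete (hIdeal k) M] :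
    hsum k (fun _ => (0 : M)) = 0 :=
  (eq_hsum fun n => by simp).symm

theorem hsum_succ {M : Type v} [AddCommGroup M] [Module k⟦X⟧ M] [IsAdicComplete (hIdeal k) M]
    (a : ℕ → M) :
    hsum k a = a 0 + (PowerSeries.X : k⟦X⟧) • hsum k fun n => a (n + 1) :=
  (eq_hsum fun n => by
    cases n with
    | zero => simp
    | succ n =>
      obtain ⟨y, hy⟩ := mem_hpow_iff.mp (hsum_spec k (fun n => a (n + 1)) n)
      refine mem_hpow_iff.mpr ⟨y, ?_⟩
      rw [Finset.sum_range_succ', pow_succ', mul_smul, ← hy, smul_sub, Finset.smul_sum]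
      simp only [pow_succ', mul_smul, pow_zero, one_smul]
      abel).symm

theorem mul_hsum {H : Type v} [Ring H] [Algebra k⟦X⟧ H] [IsAdicComplete (hIdeal k) H]
    (x : H) (a : ℕ → H) : x * hsum k a = hsum k fun n => x * a n :=
  map_hsum (LinearMap.mulLeft k⟦X⟧ x) a

theorem hsum_mul {H : Type v} [Ring H] [Algebra k⟦X⟧ H] [IsAdicComplete (hIdeal k) H]
    (x : H) (a : ℕ → H) : hsum k a * x = hsum k fun n => a n * x :=
  map_hsum (LinearMap.mulRight k⟦X⟧ x) a

/-- Splitting off `a 0` writes both the product and the Cauchy product as `a 0 * hsum k b` plus `ħ`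
times the same expression for the shifted sequence. Each step of the induction thus gains one power
of `ħ`. -/
theorem hsum_mul_hsum_sub_mem {H : Type v} [Ring H] [Algebra k⟦X⟧ H]
    [IsAdicComplete (hIdeal k) H] (n : ℕ) (a b : ℕ → H) :
    hsum k a * hsum k b - (hsum k fun n => ∑ p ∈ Finset.HasAntidiagonal.antidiagonal n,
        a p.1 * b p.2) ∈
      (hIdeal k ^ n • ⊤ : Submodule k⟦X⟧ H) := by
  induction n generalizing a with
  | zero => simp
  | succ n ih =>
    obtain ⟨y, hy⟩ := (mem_hpow_iff (k := k)).mp (ih fun n => a (n + 1))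
    refine mem_hpow_iff.mpr ⟨y, ?_⟩
    rw [pow_succ', mul_smul, ← hy, hsum_succ (k := k) a]
    have h1 : (hsum k fun n => ∑ p ∈ Finset.HasAntidiagonal.antidiagonal n, a p.1 * b p.2) =
        a 0 * hsum k b + (PowerSeries.X : k⟦X⟧) •
          hsum k fun n => ∑ p ∈ Finset.HasAntidiagonal.antidiagonal n, a (p.1 + 1) * b p.2 := by
      rw [hsum_succ, hsum_succ (k := k) b]
      simp only [Finset.Nat.sum_antidiagonal_succ, Finset.Nat.antidiagonal_zero,
        Finset.sum_singleton]
      rw [hsum_add, smul_add, mul_add, mul_smul_comm, mul_hsum, add_assoc]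
    rw [h1, add_mul, smul_mul_assoc, smul_sub]
    abel

theorem hsum_mul_hsum {H : Type v} [Ring H] [Algebra k⟦X⟧ H]
    [IsAdicComplete (hIdeal k) H] (a b : ℕ → H) :
    hsum k a * hsum k b = hsum k fun n => ∑ p ∈ Finset.HasAntidiagonal.antidiagonal n, a p.1 * b p.2 :=
  eq_of_forall_sub_mem fun n => hsum_mul_hsum_sub_mem n a b

end HsumCalculus

/-! ### Maps out of a completion -/

section Completion

variable {k : Type u} [Field k]

theorem exists_of_sub_mem {M : Type v} [AddCommGroup M] [Module k⟦X⟧ M] (x : HComp k M) (n : ℕ) :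
    ∃ m : M, x - AdicCompletion.of (hIdeal k) M m ∈
      (hIdeal k ^ n • ⊤ : Submodule k⟦X⟧ (HComp k M)) := by
  obtain ⟨m, hm⟩ := Submodule.Quotient.mk_surjective _ (x.val n)
  refine ⟨m, ?_⟩
  rw [AdicCompletion.pow_smul_top_eq_ker_eval (Submodule.fg_span_singleton _),
    LinearMap.mem_ker, map_sub, AdicCompletion.eval_apply, AdicCompletion.eval_of, ← hm]
  simp

/-- Linear maps from a completion to a Hausdorff module are determined by their values on the
uncompleted module. -/
theorem hcomp_ext {M : Type v} [AddCommGroup M] [Module k⟦X⟧ M] {N : Type w} [AddCommGroup N]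
    [Module k⟦X⟧ N] [IsHausdorff (hIdeal k) N] {f g : HComp k M →ₗ[k⟦X⟧] N}
    (h : ∀ m, f (AdicCompletion.of (hIdeal k) M m) = g (AdicCompletion.of (hIdeal k) M m)) :
    f = g := by
  refine LinearMap.ext fun x => eq_of_forall_sub_mem (k := k) fun n => ?_
  obtain ⟨m, hm⟩ := exists_of_sub_mem x n
  have := map_mem_hpow (f - g) hm
  simpa [h m] using this

theorem ctensor_ext {M : Type v} [AddCommGroup M] [Module k⟦X⟧ M] {M' : Type v'} [AddCommGroup M']
    [Module k⟦X⟧ M'] {N : Type w} [AddCommGroup N]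
    [Module k⟦X⟧ N] [IsHausdorff (hIdeal k) N] {f g : CTensor k M M' →ₗ[k⟦X⟧] N}
    (h : ∀ m m', f (AdicCompletion.of (hIdeal k) _ (m ⊗ₜ m')) =
      g (AdicCompletion.of (hIdeal k) _ (m ⊗ₜ m'))) :
    f = g := by
  refine hcomp_ext fun z => ?_
  induction z using TensorProduct.induction_on with
  | zero => simp
  | tmul x y => exact h x y
  | add x y hx hy => simp only [map_add, hx, hy]

theorem cmap_of {M : Type v} [AddCommGroup M] [Module k⟦X⟧ M] {N : Type w} [AddCommGroup N]
    [Module k⟦X⟧ N] (f : M →ₗ[k⟦X⟧] N) (x : M) :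
    cmap (hIdeal k) f (AdicCompletion.of (hIdeal k) M x) =
      AdicCompletion.of (hIdeal k) N (f x) :=
  AdicCompletion.map_of _ _ _

variable (k) in
/-- The canonical map to the completion, as a homomorphism of algebras. -/
def ofAlg (B : Type v) [Ring B] [Algebra k⟦X⟧ B] : B →ₐ[k⟦X⟧] HComp k B :=
  AlgHom.ofLinearMap (AdicCompletion.of (hIdeal k) B) rfl fun _ _ => rfl

/-- The extension to the completion of a homomorphism of algebras into a complete algebra. -/
def extendAlg {B : Type v} [Ring B] [Algebra k⟦X⟧ B] {A : Type w} [Ring A] [Algebra k⟦X⟧ A]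
    [IsAdicComplete (hIdeal k) A] (f : B →ₐ[k⟦X⟧] A) : HComp k B →ₐ[k⟦X⟧] A :=
  AlgHom.ofLinearMap (extend (hIdeal k) f.toLinearMap)
    (by rw [← completion_of_one, extend_of]; simp)
    (fun x y => by
      -- Multiplicativity is linear in each variable separately, so density of the uncompleted
      -- algebra is applied first in `x`, then in `y`.
      suffices h : (extend (hIdeal k) f.toLinearMap) ∘ₗ LinearMap.mulRight k⟦X⟧ y =
          LinearMap.mulRight k⟦X⟧ (extend (hIdeal k) f.toLinearMap y) ∘ₗ
            extend (hIdeal k) f.toLinearMap from LinearMap.congr_fun h x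
      refine hcomp_ext fun b => ?_
      suffices h : (extend (hIdeal k) f.toLinearMap) ∘ₗ
            LinearMap.mulLeft k⟦X⟧ (AdicCompletion.of (hIdeal k) B b) =
          LinearMap.mulLeft k⟦X⟧ (f b) ∘ₗ
            extend (hIdeal k) f.toLinearMap by
        simpa [extend_of] using LinearMap.congr_fun h y
      refine hcomp_ext fun c => ?_
      simp [← completion_of_mul, extend_of])

theorem extendAlg_of {B : Type v} [Ring B] [Algebra k⟦X⟧ B] {A : Type w} [Ring A]
    [Algebra k⟦X⟧ A] [IsAdicComplete (hIdeal k) A] (f : B →ₐ[k⟦X⟧] A) (b : B) :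
    extendAlg f (AdicCompletion.of (hIdeal k) B b) = f b :=
  extend_of _ _ _

/-- The homomorphism of completions induced by a homomorphism of algebras. -/
def cmapAlg {B : Type v} [Ring B] [Algebra k⟦X⟧ B] {A : Type w} [Ring A] [Algebra k⟦X⟧ A]
    (f : B →ₐ[k⟦X⟧] A) : HComp k B →ₐ[k⟦X⟧] HComp k A :=
  extendAlg ((ofAlg k A).comp f)

theorem cmapAlg_of {B : Type v} [Ring B] [Algebra k⟦X⟧ B] {A : Type w} [Ring A]
    [Algebra k⟦X⟧ A] (f : B →ₐ[k⟦X⟧] A) (b : B) :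
    cmapAlg f (AdicCompletion.of (hIdeal k) B b) = AdicCompletion.of (hIdeal k) A (f b) :=
  extendAlg_of _ _

/-- The structure maps of the statement are only linear maps. Recognizing them as homomorphisms of
algebras is what allows identities to be checked on generators. -/
theorem cmap_eq_cmapAlg {B : Type v} [Ring B] [Algebra k⟦X⟧ B] {A : Type w} [Ring A]
    [Algebra k⟦X⟧ A] (f : B →ₐ[k⟦X⟧] A) {g : B →ₗ[k⟦X⟧] A} (h : ∀ x, g x = f x) (x : HComp k B) :
    cmap (hIdeal k) g x = cmapAlg f x := by
  refine LinearMap.congr_fun (f := cmap (hIdeal k) g) (g := (cmapAlg f).toLinearMap) ?_ x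
  refine hcomp_ext fun b => ?_
  simp [cmap_of, cmapAlg_of, h]

end Completion

/-! ### The completed tensor product as an algebra with two commuting legs -/

section CompletedTensor

variable {k : Type u} [Field k] {A : Type v} [Ring A] [Algebra k⟦X⟧ A] {B : Type w} [Ring B]
  [Algebra k⟦X⟧ B]

variable (k A B) in
/-- The map `x ↦ x ⊗ 1` to the completed tensor product. -/
def tl : A →ₐ[k⟦X⟧] CTensor k A B :=
  (ofAlg k (A ⊗[k⟦X⟧] B)).comp Algebra.TensorProduct.includeLeft

variable (k A B) in
/-- The map `y ↦ 1 ⊗ y` to the completed tensor product. -/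
def tr : B →ₐ[k⟦X⟧] CTensor k A B :=
  (ofAlg k (A ⊗[k⟦X⟧] B)).comp Algebra.TensorProduct.includeRight

theorem tl_apply (x : A) : tl k A B x = AdicCompletion.of (hIdeal k) _ (x ⊗ₜ[k⟦X⟧] 1) := rfl

theorem tr_apply (y : B) : tr k A B y = AdicCompletion.of (hIdeal k) _ (1 ⊗ₜ[k⟦X⟧] y) := rfl

theorem tl_mul_tr (x : A) (y : B) :
    tl k A B x * tr k A B y = AdicCompletion.of (hIdeal k) _ (x ⊗ₜ[k⟦X⟧] y) := by
  rw [tl_apply, tr_apply, ← completion_of_mul, Algebra.TensorProduct.tmul_mul_tmul, mul_one,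
    one_mul]

theorem tr_mul_tl (x : A) (y : B) :
    tr k A B y * tl k A B x = tl k A B x * tr k A B y := by
  rw [tl_mul_tr, tl_apply, tr_apply, ← completion_of_mul, Algebra.TensorProduct.tmul_mul_tmul,
    mul_one, one_mul]

theorem commute_tl_tr (x : A) (y : B) : Commute (tl k A B x) (tr k A B y) :=
  (tr_mul_tl x y).symm

/-- The homomorphism from a completed tensor product given by two commuting homomorphisms. -/
def ctLift {D : Type w'} [Ring D] [Algebra k⟦X⟧ D] [IsAdicComplete (hIdeal k) D]
    (f : A →ₐ[k⟦X⟧] D) (g : B →ₐ[k⟦X⟧] D) (h : ∀ x y, Commute (f x) (g y)) :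
    CTensor k A B →ₐ[k⟦X⟧] D :=
  extendAlg (Algebra.TensorProduct.lift f g h)

section

variable {D : Type w'} [Ring D] [Algebra k⟦X⟧ D] [IsAdicComplete (hIdeal k) D]
  (f : A →ₐ[k⟦X⟧] D) (g : B →ₐ[k⟦X⟧] D) (h : ∀ x y, Commute (f x) (g y))

theorem ctLift_of (x : A) (y : B) :
    ctLift f g h (AdicCompletion.of (hIdeal k) _ (x ⊗ₜ[k⟦X⟧] y)) = f x * g y := by
  rw [ctLift, extendAlg_of, Algebra.TensorProduct.lift_tmul]

theorem ctLift_tl (x : A) : ctLift f g h (tl k A B x) = f x := by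
  rw [tl_apply, ctLift_of, map_one, mul_one]

theorem ctLift_tr (y : B) : ctLift f g h (tr k A B y) = g y := by
  rw [tr_apply, ctLift_of, map_one, one_mul]

end

/-- The homomorphism `f ⊗ g` of completed tensor products. -/
def ctMap {A' : Type v'} [Ring A'] [Algebra k⟦X⟧ A'] {B' : Type w'} [Ring B'] [Algebra k⟦X⟧ B']
    (f : A →ₐ[k⟦X⟧] A') (g : B →ₐ[k⟦X⟧] B') : CTensor k A B →ₐ[k⟦X⟧] CTensor k A' B' :=
  cmapAlg (Algebra.TensorProduct.map f g)

section

variable {A' : Type v'} [Ring A'] [Algebra k⟦X⟧ A'] {B' : Type w'} [Ring B'] [Algebra k⟦X⟧ B']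
  (f : A →ₐ[k⟦X⟧] A') (g : B →ₐ[k⟦X⟧] B')

theorem ctMap_tl (x : A) : ctMap f g (tl k A B x) = tl k A' B' (f x) := by
  rw [tl_apply, ctMap, cmapAlg_of, Algebra.TensorProduct.map_tmul, map_one, tl_apply]

theorem ctMap_tr (y : B) : ctMap f g (tr k A B y) = tr k A' B' (g y) := by
  rw [tr_apply, ctMap, cmapAlg_of, Algebra.TensorProduct.map_tmul, map_one, tr_apply]

end

theorem cmapSq_eq_ctMap {A' : Type v'} [Ring A'] [Algebra k⟦X⟧ A'] (f : A →ₐ[k⟦X⟧] A')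
    (x : CTensor k A A) : cmapSq f.toLinearMap x = ctMap f f x :=
  cmap_eq_cmapAlg _ (fun _ => rfl) x

/-- Homomorphisms from a completed tensor product to a complete algebra are determined by their
values on the two factors. -/
theorem ct_algHom_ext {D : Type w'} [Ring D] [Algebra k⟦X⟧ D] [IsHausdorff (hIdeal k) D]
    {f g : CTensor k A B →ₐ[k⟦X⟧] D} (h1 : ∀ x, f (tl k A B x) = g (tl k A B x))
    (h2 : ∀ y, f (tr k A B y) = g (tr k A B y)) : f = g := by
  apply AlgHom.toLinearMap_injective
  refine ctensor_ext fun x y => ?_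
  simp only [AlgHom.toLinearMap_apply, ← tl_mul_tr, map_mul, h1, h2]

end CompletedTensor

/-! ### Exponentials, their quotients by `ħ`, and weight vectors -/

section Exponential

variable {k : Type u} [Field k] {H : Type v} [Ring H] [Algebra k⟦X⟧ H]
  [IsAdicComplete (hIdeal k) H] {H' : Type w} [Ring H'] [Algebra k⟦X⟧ H']
  [IsAdicComplete (hIdeal k) H']

theorem map_hexp (f : H →ₐ[k⟦X⟧] H') (x : H) : f (hexp k x) = hexp k (f x) := by
  rw [hexp, ← AlgHom.toLinearMap_apply, map_hsum]
  simp [hexp, map_smul, map_pow]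

theorem map_hexpDiv (f : H →ₐ[k⟦X⟧] H') (x : H) : f (hexpDiv k x) = hexpDiv k (f x) := by
  rw [hexpDiv, ← AlgHom.toLinearMap_apply, map_hsum]
  simp [hexpDiv, map_smul, map_pow]

theorem map_qQuot {n : ℕ} (C : CartanDatum n) (i : Fin n) (f : H →ₐ[k⟦X⟧] H') (x y : H) :
    f (qQuot k C i x y) = qQuot k C i (f x) (f y) := by
  simp only [qQuot, map_smul, map_sub, map_hexpDiv, map_neg]

theorem hexp_zero : hexp k (0 : H) = 1 := by
  rw [hexp, hsum_succ]
  simp [hsum_zero]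

theorem qQuot_zero {n : ℕ} (C : CartanDatum n) (i : Fin n) : qQuot k C i (0 : H) 0 = 0 := by
  simp [qQuot]

theorem op_hexp [IsAdicComplete (hIdeal k) Hᵐᵒᵖ] (x : H) :
    MulOpposite.op (hexp k x) = hexp k (MulOpposite.op x) := by
  have := map_hsum (MulOpposite.opLinearEquiv k⟦X⟧ : H ≃ₗ[k⟦X⟧] Hᵐᵒᵖ).toLinearMap
    (fun n => PowerSeries.C ((n.factorial : k)⁻¹) • x ^ n)
  simpa [hexp] using this

theorem op_hexpDiv [IsAdicComplete (hIdeal k) Hᵐᵒᵖ] (x : H) :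
    MulOpposite.op (hexpDiv k x) = hexpDiv k (MulOpposite.op x) := by
  have := map_hsum (MulOpposite.opLinearEquiv k⟦X⟧ : H ≃ₗ[k⟦X⟧] Hᵐᵒᵖ).toLinearMap
    (fun n => PowerSeries.C (((n + 1).factorial : k)⁻¹) • x ^ (n + 1))
  simpa [hexpDiv] using this

theorem op_qQuot [IsAdicComplete (hIdeal k) Hᵐᵒᵖ] {n : ℕ} (C : CartanDatum n) (i : Fin n)
    (x y : H) : MulOpposite.op (qQuot k C i x y) =
      qQuot k C i (MulOpposite.op x) (MulOpposite.op y) := by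
  simp only [qQuot, MulOpposite.op_smul, MulOpposite.op_sub, op_hexpDiv, MulOpposite.op_neg]

theorem hexp_eq_one_add (x : H) :
    hexp k x = 1 + (PowerSeries.X : k⟦X⟧) • hexpDiv k x := by
  rw [X_smul_hexpDiv]; abel

/-- Termwise from `a ^ n * x = x * b ^ n`. With `b = a` it gives commutation, with `b = a + c` the
passage past a weight vector, and with a toral `b - a` the conjugation by a twist. -/
theorem hexp_intertwine {a b x : H} (h : a * x = x * b) : hexp k a * x = x * hexp k b := by
  have hn : ∀ n : ℕ, a ^ n * x = x * b ^ n := fun n =>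
    SemiconjBy.eq (SemiconjBy.pow_right (a := x) (x := b) (y := a) h.symm n) |>.symm
  rw [hexp, hexp, hsum_mul, mul_hsum]
  simp only [smul_mul_assoc, mul_smul_comm, hn]

theorem commute_hexp_left {a x : H} (h : Commute a x) : Commute (hexp k a) x :=
  hexp_intertwine h

theorem hexp_algebraMap (c : k⟦X⟧) :
    hexp k (algebraMap k⟦X⟧ H c) = algebraMap k⟦X⟧ H (sexp c) :=
  (map_hexp (Algebra.ofId k⟦X⟧ H) c).symm

theorem map_zsmul_sexp (c : k⟦X⟧) : hexp k (c • (1 : H)) = sexp c • (1 : H) := by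
  rw [← Algebra.algebraMap_eq_smul_one, hexp_algebraMap, Algebra.algebraMap_eq_smul_one]

theorem sexp_zero : sexp (0 : k⟦X⟧) = 1 := hexp_zero

theorem commute_hexp_hexp {x y : H} (h : Commute x y) : Commute (hexp k x) (hexp k y) :=
  commute_hexp_left (commute_hexp_left h.symm).symm

theorem commute_hexpDiv_left {a x : H} (h : Commute a x) : Commute (hexpDiv k a) x := by
  change hexpDiv k a * x = x * hexpDiv k a
  have hn : ∀ n : ℕ, a ^ n * x = x * a ^ n := fun n => (h.pow_left n)
  rw [hexpDiv, hsum_mul, mul_hsum]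
  simp only [smul_mul_assoc, mul_smul_comm, hn]

variable [CharZero k]

theorem factorial_coeff {i j n : ℕ} (h : i + j = n) :
    (n.factorial : k)⁻¹ * (n.choose i : k) = (i.factorial : k)⁻¹ * (j.factorial : k)⁻¹ := by
  subst h
  have h := Nat.add_choose_mul_factorial_mul_factorial i j
  rw [← Nat.choose_symm_add] at h
  have h1 : (((i + j).choose i : ℕ) : k) * i.factorial * j.factorial = (i + j).factorial := by
    exact_mod_cast h
  have hi : (i.factorial : k) ≠ 0 := by exact_mod_cast i.factorial_ne_zero
  have hj : (j.factorial : k) ≠ 0 := by exact_mod_cast j.factorial_ne_zero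
  have hn : ((i + j).factorial : k) ≠ 0 := by exact_mod_cast (i + j).factorial_ne_zero
  field_simp
  linear_combination h1

theorem smul_add_pow {A : Type v} [Ring A] [Algebra k⟦X⟧ A] {x y : A} (h : Commute x y) (n : ℕ) :
    PowerSeries.C ((n.factorial : k)⁻¹) • (x + y) ^ n =
      ∑ p ∈ Finset.HasAntidiagonal.antidiagonal n,
        (PowerSeries.C ((p.1.factorial : k)⁻¹) • x ^ p.1) *
          (PowerSeries.C ((p.2.factorial : k)⁻¹) • y ^ p.2) := by
  rw [h.add_pow', Finset.smul_sum]
  refine Finset.sum_congr rfl fun p hp => ?_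
  have hp' := Finset.HasAntidiagonal.mem_antidiagonal.mp hp
  rw [smul_mul_smul_comm, ← map_mul, ← factorial_coeff hp', ← Nat.cast_smul_eq_nsmul k⟦X⟧,
    smul_smul, map_mul, map_natCast]

theorem hexp_add {x y : H} (h : Commute x y) : hexp k (x + y) = hexp k x * hexp k y := by
  simp only [hexp, hsum_mul_hsum, smul_add_pow h]

/-- Dividing `exp (ħ (x + y)) - 1` by `ħ` cannot be done by cancellation, as `ħ` is not known to be
regular in the algebra; the rule is proved on the series instead. -/
theorem hexpDiv_add {x y : H} (h : Commute x y) :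
    hexpDiv k (x + y) = hexpDiv k x + hexp k x * hexpDiv k y := by
  simp only [hexp, hexpDiv, hsum_mul_hsum, smul_add_pow h, Finset.Nat.sum_antidiagonal_succ']
  rw [← hsum_add]
  simp

theorem hexp_neg_mul_self (x : H) : hexp k (-x) * hexp k x = 1 := by
  rw [← hexp_add (Commute.neg_left (Commute.refl x)), neg_add_cancel, hexp_zero]

theorem hexp_mul_neg_self (x : H) : hexp k x * hexp k (-x) = 1 := by
  rw [← hexp_add (Commute.neg_right (Commute.refl x)), add_neg_cancel, hexp_zero]

theorem sexp_add (a b : k⟦X⟧) : sexp (a + b) = sexp a * sexp b := hexp_add (Commute.all a b)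

theorem sexp_neg_mul (a : k⟦X⟧) : sexp (-a) * sexp a = 1 := hexp_neg_mul_self a

theorem sexp_pow (a : k⟦X⟧) (n : ℕ) : sexp a ^ n = sexp ((n : k⟦X⟧) * a) := by
  induction n with
  | zero => simp [sexp_zero]
  | succ n ih => rw [pow_succ, ih, ← sexp_add]; congr 1; push_cast; ring

/-- Commuting the exponential of a toral element past a weight vector. -/
theorem hexp_weight {a x : H} {c : k⟦X⟧} (h : a * x = x * a + c • x) :
    hexp k a * x = sexp c • (x * hexp k a) := by
  have h' : a * x = x * (a + c • 1) := by rw [h, mul_add, mul_smul_comm, mul_one]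
  rw [hexp_intertwine h', hexp_add ((Commute.one_right a).smul_right c), map_zsmul_sexp,
    mul_smul_comm, mul_one, mul_smul_comm]

/-- Shift of the arguments of `(exp (ħ x) - exp (- ħ y)) / (q - q⁻¹)`. -/
theorem hexp_mul_qQuot {n : ℕ} (C : CartanDatum n) (i : Fin n) {x y z : H} (hx : Commute z x)
    (hy : Commute z y) :
    hexp k z * qQuot k C i x y = qQuot k C i (x + z) (y - z) := by
  simp only [qQuot, mul_smul_comm, mul_sub]
  have e1 : x + z = z + x := add_comm _ _
  have e2 : -(y - z) = z + -y := by abel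
  rw [e1, e2, hexpDiv_add hx, hexpDiv_add hy.neg_right]
  abel_nf

/-- This is the right-hand side of the `E`-`F` relation under the coproduct: `exp (ħ x₁)` and `exp
(-ħ y₂)` are the grouplike factors on the two legs. -/
theorem qQuot_add {n : ℕ} (C : CartanDatum n) (i : Fin n) {x₁ x₂ y₁ y₂ : H}
    (h12 : Commute x₁ x₂) (hy12 : Commute y₁ y₂) (hxy : Commute x₁ y₂) :
    qQuot k C i (x₁ + x₂) (y₁ + y₂) =
      qQuot k C i x₁ y₁ * hexp k (-y₂) + hexp k x₁ * qQuot k C i x₂ y₂ := by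
  have e : -(y₁ + y₂) = -y₂ + -y₁ := by abel
  simp only [qQuot, mul_smul_comm, smul_mul_assoc, mul_sub, sub_mul, e, ← smul_add]
  rw [hexpDiv_add h12, hexpDiv_add (hy12.symm.neg_left.neg_right)]
  have c1 : Commute (hexpDiv k x₁) (hexp k (-y₂)) :=
    commute_hexpDiv_left (commute_hexp_left hxy.neg_right.symm).symm
  have c2 : Commute (hexpDiv k (-y₁)) (hexp k (-y₂)) :=
    commute_hexpDiv_left (commute_hexp_left hy12.neg_left.neg_right.symm).symm
  rw [c2.eq]
  rw [hexp_eq_one_add x₁, hexp_eq_one_add (-y₂)]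
  congr 1
  simp only [add_mul, mul_add, one_mul, mul_one, smul_mul_assoc, mul_smul_comm]
  abel

/-- Shifting the arguments by `-x + y` exchanges `x` and `y`, and the exchanged quotient is minus
the one at `(-x, -y)`. Used for the antipode. -/
theorem qQuot_neg {n : ℕ} (C : CartanDatum n) (i : Fin n) {x y : H} (h : Commute x y) :
    qQuot k C i (-x) (-y) = -(hexp k (-x) * hexp k y * qQuot k C i x y) := by
  rw [← hexp_add h.neg_left, hexp_mul_qQuot]
  · simp only [qQuot, ← smul_neg]
    congr 1
    have e1 : x + (-x + y) = y := by abel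
    have e2 : -(y - (-x + y)) = -x := by abel
    rw [e1, e2, neg_neg]; abel
  · exact ((Commute.refl x).neg_left).add_left h.symm
  · exact h.neg_left.add_left (Commute.refl y)

end Exponential

/-! ### Universal property of the FoMpQUEA -/

section UniversalProperty

variable {k : Type u} [Field k] {n : ℕ} {P : Matrix (Fin n) (Fin n) k⟦X⟧} {𝔥 : Type v}
  [AddCommGroup 𝔥] [Module k⟦X⟧ 𝔥]

/-- The elements `t x`, `e i`, `f i` of a complete algebra satisfy the defining relations. -/
structure GenRel (C : CartanDatum n) (R : Realization P 𝔥) {A : Type w} [Ring A] [Algebra k⟦X⟧ A]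
    [IsAdicComplete (hIdeal k) A] (t : 𝔥 →ₗ[k⟦X⟧] A) (e f : Fin n → A) : Prop where
  tt : ∀ x y, t x * t y = t y * t x
  te : ∀ x j, t x * e j - e j * t x = R.α j x • e j
  tf : ∀ x j, t x * f j - f j * t x = -(R.α j x) • f j
  ef : ∀ i j, e i * f j - f j * e i =
    if i = j then qQuot k C i (t (R.Tp i)) (t (R.Tm i)) else 0
  se : ∀ i j, i ≠ j → serreSum C P 1 i j (e i) (e j) = 0
  sf : ∀ i j, i ≠ j → serreSum C P (-1) i j (f i) (f j) = 0

theorem map_serreSum (C : CartanDatum n) (σ : ℤ) (i j : Fin n) {A : Type w} [Ring A]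
    [Algebra k⟦X⟧ A] {B : Type w'} [Ring B] [Algebra k⟦X⟧ B] (g : A →ₐ[k⟦X⟧] B) (x y : A) :
    g (serreSum C P σ i j x y) = serreSum C P σ i j (g x) (g y) := by
  simp only [serreSum, map_sum, map_smul, map_mul, map_pow]

theorem GenRel.map {C : CartanDatum n} {R : Realization P 𝔥} {A : Type w} [Ring A] [Algebra k⟦X⟧ A]
    [IsAdicComplete (hIdeal k) A] {t : 𝔥 →ₗ[k⟦X⟧] A} {e f : Fin n → A} (h : GenRel C R t e f)
    {B : Type w'} [Ring B] [Algebra k⟦X⟧ B] [IsAdicComplete (hIdeal k) B] (g : A →ₐ[k⟦X⟧] B) :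
    GenRel C R (g.toLinearMap ∘ₗ t) (fun i => g (e i)) (fun i => g (f i)) where
  tt x y := by simpa using congrArg g (h.tt x y)
  te x j := by simpa using congrArg g (h.te x j)
  tf x j := by simpa using congrArg g (h.tf x j)
  ef i j := by
    have := congrArg g (h.ef i j)
    rw [apply_ite g, map_qQuot, map_zero] at this
    simpa using this
  se i j hij := by rw [← map_serreSum, h.se i j hij, map_zero]
  sf i j hij := by rw [← map_serreSum, h.sf i j hij, map_zero]

/-- The images of the symbols for the generators. -/
def genVal {A : Type w} (t : 𝔥 → A) (e f : Fin n → A) : Gen n 𝔥 → A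
  | .T x => t x
  | .E i => e i
  | .F i => f i

namespace FoMpQUEA

variable (C : CartanDatum n) (R : Realization P 𝔥)

/-- The completed free algebra maps to the FoMpQUEA. -/
def ofFree : FreeComp k n 𝔥 →ₐ[k⟦X⟧] FoMpQUEA C R :=
  (ofAlg k (RingQuot (Rel C R))).comp (RingQuot.mkAlgHom k⟦X⟧ (Rel C R))

theorem ofFree_fgen (g : Gen n 𝔥) : ofFree C R (fgen k g) = gen C R g := rfl

theorem ofFree_rel {x y : FreeComp k n 𝔥} (h : Rel C R x y) : ofFree C R x = ofFree C R y :=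
  congrArg (AdicCompletion.of (hIdeal k) (RingQuot (Rel C R))) (RingQuot.mkAlgHom_rel k⟦X⟧ h)

/-- The linear map from `𝔥` to the FoMpQUEA. -/
def tLin : 𝔥 →ₗ[k⟦X⟧] FoMpQUEA C R where
  toFun := T C R
  map_add' x y := by
    simpa [map_add, ofFree_fgen] using ofFree_rel C R (Rel.T_add x y)
  map_smul' c x := by
    simpa [map_smul, ofFree_fgen] using ofFree_rel C R (Rel.T_smul c x)

theorem tLin_apply (x : 𝔥) : tLin C R x = T C R x := rfl

theorem genRel : GenRel C R (tLin C R) (E C R) (F C R) where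
  tt x y := by simpa [ofFree_fgen, tLin_apply] using ofFree_rel C R (Rel.T_T x y)
  te x j := by simpa [ofFree_fgen, tLin_apply] using ofFree_rel C R (Rel.T_E x j)
  tf x j := by simpa [ofFree_fgen, tLin_apply] using ofFree_rel C R (Rel.T_F x j)
  ef i j := by
    have := ofFree_rel C R (Rel.E_F i j)
    rw [apply_ite (ofFree C R), map_qQuot] at this
    simpa [ofFree_fgen, tLin_apply] using this
  se i j hij := by
    have := ofFree_rel C R (Rel.serre_E i j hij)
    rwa [map_serreSum, map_zero] at this
  sf i j hij := by
    have := ofFree_rel C R (Rel.serre_F i j hij)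
    rwa [map_serreSum, map_zero] at this

variable {C R}

section Lift

variable {A : Type w} [Ring A] [Algebra k⟦X⟧ A] [IsAdicComplete (hIdeal k) A]
  {t : 𝔥 →ₗ[k⟦X⟧] A} {e f : Fin n → A}

variable (t e f) in
/-- The homomorphism from the completed free algebra with given values on the generators. -/
def liftFree : FreeComp k n 𝔥 →ₐ[k⟦X⟧] A :=
  extendAlg (FreeAlgebra.lift k⟦X⟧ (genVal t e f))

theorem liftFree_fgen (g : Gen n 𝔥) : liftFree t e f (fgen k g) = genVal t e f g := by
  rw [liftFree, fgen, extendAlg_of, FreeAlgebra.lift_ι_apply]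

theorem liftFree_rel (h : GenRel C R t e f) {x y : FreeComp k n 𝔥} (hxy : Rel C R x y) :
    liftFree t e f x = liftFree t e f y := by
  induction hxy with
  | T_add x y => simp [liftFree_fgen, genVal]
  | T_smul c x => simp [liftFree_fgen, genVal]
  | T_T x y => simpa [liftFree_fgen, genVal] using h.tt x y
  | T_E x j => simpa [liftFree_fgen, genVal] using h.te x j
  | T_F x j => simpa [liftFree_fgen, genVal] using h.tf x j
  | E_F i j =>
    rw [apply_ite (liftFree t e f), map_qQuot]
    simpa [liftFree_fgen, genVal] using h.ef i j
  | serre_E i j hij =>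
    rw [map_serreSum, map_zero]; simpa [liftFree_fgen, genVal] using h.se i j hij
  | serre_F i j hij =>
    rw [map_serreSum, map_zero]; simpa [liftFree_fgen, genVal] using h.sf i j hij

variable (h : GenRel C R t e f)

/-- The universal property of the FoMpQUEA. -/
def lift : FoMpQUEA C R →ₐ[k⟦X⟧] A :=
  extendAlg (B := RingQuot (Rel C R))
    (RingQuot.liftAlgHom k⟦X⟧ ⟨liftFree t e f, fun _ _ => liftFree_rel h⟩)

theorem lift_gen (g : Gen n 𝔥) : lift h (gen C R g) = genVal t e f g := by
  refine (extendAlg_of (B := RingQuot (Rel C R)) _ _).trans ?_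
  rw [RingQuot.liftAlgHom_mkAlgHom_apply, liftFree_fgen]

theorem lift_T (x : 𝔥) : lift h (T C R x) = t x := lift_gen h _

theorem lift_E (i : Fin n) : lift h (E C R i) = e i := lift_gen h _

theorem lift_F (i : Fin n) : lift h (F C R i) = f i := lift_gen h _

end Lift

/-- Linear maps to a Hausdorff module that agree on the subalgebra generated by the generators are
equal. -/
theorem linear_ext {N : Type w} [AddCommGroup N] [Module k⟦X⟧ N] [IsHausdorff (hIdeal k) N]
    {f g : FoMpQUEA C R →ₗ[k⟦X⟧] N}
    (h : ∀ x ∈ Algebra.adjoin k⟦X⟧ (Set.range (gen C R)), f x = g x) : f = g := by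
  refine hcomp_ext (M := RingQuot (Rel C R)) fun m => ?_
  obtain ⟨y, rfl⟩ := RingQuot.mkAlgHom_surjective k⟦X⟧ (Rel C R) m
  refine LinearMap.congr_fun (f := f ∘ₗ (ofFree C R).toLinearMap)
    (g := g ∘ₗ (ofFree C R).toLinearMap) ?_ y
  refine hcomp_ext fun z => h _ ?_
  induction z using FreeAlgebra.induction with
  | grade0 r =>
    have := (((ofFree C R).comp (ofAlg k _)).commutes r)
    exact this ▸ Subalgebra.algebraMap_mem _ r
  | grade1 g => exact Algebra.subset_adjoin ⟨g, rfl⟩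
  | mul a b ha hb =>
    rw [AlgHom.toLinearMap_apply] at *
    rw [completion_of_mul, map_mul]
    exact mul_mem ha hb
  | add a b ha hb =>
    rw [AlgHom.toLinearMap_apply] at *
    rw [map_add, map_add]
    exact add_mem ha hb

theorem algHom_ext {A : Type w} [Ring A] [Algebra k⟦X⟧ A] [IsHausdorff (hIdeal k) A]
    {f g : FoMpQUEA C R →ₐ[k⟦X⟧] A} (hT : ∀ x, f (T C R x) = g (T C R x))
    (hE : ∀ i, f (E C R i) = g (E C R i)) (hF : ∀ i, f (F C R i) = g (F C R i)) : f = g := by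
  apply AlgHom.toLinearMap_injective
  refine linear_ext fun x hx => ?_
  induction hx using Algebra.adjoin_induction with
  | mem x hx =>
    obtain ⟨g, rfl⟩ := hx
    cases g with
    | T x => exact hT x
    | E i => exact hE i
    | F i => exact hF i
  | algebraMap r => simp
  | add x y _ _ hx hy => rw [map_add, map_add, hx, hy]
  | mul x y _ _ hx hy =>
    rw [AlgHom.toLinearMap_apply] at *
    rw [map_mul, hx, hy, AlgHom.toLinearMap_apply, AlgHom.toLinearMap_apply,
      AlgHom.toLinearMap_apply, map_mul]

end FoMpQUEA

end UniversalProperty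

/-! ### Symmetric `q`-binomial coefficients -/

section QBinomial

variable {k : Type u} [Field k]

theorem constantCoeff_hsum (a : ℕ → k⟦X⟧) :
    PowerSeries.constantCoeff (hsum k a) = PowerSeries.constantCoeff (a 0) := by
  rw [hsum_succ]; simp

theorem constantCoeff_sexp (c : k⟦X⟧) : PowerSeries.constantCoeff (sexp c) = 1 := by
  simp [sexp, hexp, constantCoeff_hsum]

theorem constantCoeff_qNum (d : k⟦X⟧) (m : ℕ) : PowerSeries.constantCoeff (qNum d m) = m := by
  simp [qNum, constantCoeff_sexp]

theorem qFact_zero (d : k⟦X⟧) : qFact d 0 = 1 := by simp [qFact]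

theorem qFact_succ (d : k⟦X⟧) (m : ℕ) : qFact d (m + 1) = qFact d m * qNum d (m + 1) := by
  simp [qFact, Finset.prod_range_succ]

theorem qNum_neg (d : k⟦X⟧) (m : ℕ) : qNum (-d) m = qNum d m := by
  unfold qNum
  rw [← Finset.sum_range_reflect]
  refine Finset.sum_congr rfl fun s hs => ?_
  have hs' := Finset.mem_range.mp hs
  rw [smul_neg, ← neg_smul]
  congr 2
  omega

theorem qFact_neg (d : k⟦X⟧) (m : ℕ) : qFact (-d) m = qFact d m := by
  simp [qFact, qNum_neg]

theorem qBinom_neg (d : k⟦X⟧) (m s : ℕ) : qBinom (-d) m s = qBinom d m s := by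
  simp [qBinom, qFact_neg]

theorem qBinom_symm (d : k⟦X⟧) {m s : ℕ} (h : s ≤ m) : qBinom d m (m - s) = qBinom d m s := by
  rw [qBinom, qBinom, Nat.sub_sub_self h]; ring

variable [CharZero k]

theorem qNum_add (d : k⟦X⟧) (a b : ℕ) :
    qNum d (a + b) = sexp ((b : k⟦X⟧) * d) * qNum d a + sexp (-((a : k⟦X⟧) * d)) * qNum d b := by
  unfold qNum
  rw [Finset.sum_range_add, Finset.mul_sum, Finset.mul_sum]
  simp only [← sexp_add]
  congr 1
  · refine Finset.sum_congr rfl fun s _ => ?_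
    congr 1
    simp only [zsmul_eq_mul]; push_cast; ring
  · refine Finset.sum_congr rfl fun s _ => ?_
    congr 1
    simp only [zsmul_eq_mul]; push_cast; ring

theorem constantCoeff_qFact_ne (d : k⟦X⟧) (m : ℕ) :
    PowerSeries.constantCoeff (qFact d m) ≠ 0 := by
  rw [qFact, map_prod]
  refine Finset.prod_ne_zero_iff.mpr fun s _ => ?_
  rw [constantCoeff_qNum]
  exact_mod_cast s.succ_ne_zero

theorem qFact_mul_inv (d : k⟦X⟧) (m : ℕ) : qFact d m * (qFact d m)⁻¹ = 1 :=
  PowerSeries.mul_inv_cancel _ (constantCoeff_qFact_ne d m)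

theorem qBinom_zero (d : k⟦X⟧) (m : ℕ) : qBinom d m 0 = 1 := by
  rw [qBinom, qFact_zero, Nat.sub_zero, inv_one, mul_one, qFact_mul_inv]

theorem qBinom_self (d : k⟦X⟧) (m : ℕ) : qBinom d m m = 1 := by
  rw [qBinom, Nat.sub_self, qFact_zero, inv_one, mul_one, qFact_mul_inv]

theorem qFact_ne_zero (d : k⟦X⟧) (m : ℕ) : qFact d m ≠ 0 := fun h =>
  constantCoeff_qFact_ne d m (by rw [h, map_zero])

theorem qBinom_mul (d : k⟦X⟧) (s r : ℕ) :
    qBinom d (s + r) s * (qFact d s * qFact d r) = qFact d (s + r) := by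
  rw [qBinom, Nat.add_sub_cancel_left]
  linear_combination qFact d (s + r) * (qFact d r * (qFact d r)⁻¹) * qFact_mul_inv d s +
    qFact d (s + r) * qFact_mul_inv d r

/-- The Pascal identity for symmetric `q`-binomial coefficients. -/
theorem qBinom_pascal (d : k⟦X⟧) (s r : ℕ) :
    qBinom d (s + 1 + (r + 1)) (s + 1) =
      sexp (((s + 1 : ℕ) : k⟦X⟧) * d) * qBinom d (s + 1 + r) (s + 1) +
      sexp (-(((r + 1 : ℕ) : k⟦X⟧) * d)) * qBinom d (s + (r + 1)) s := by
  -- After multiplication by these nonzero factorials, Pascal's identity becomes the addition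
  -- formula `qNum_add` for `[r + 1 + (s + 1)]`.
  have h0 : qFact d (s + 1) * qFact d (r + 1) ≠ 0 :=
    mul_ne_zero (qFact_ne_zero d _) (qFact_ne_zero d _)
  refine mul_right_cancel₀ h0 ?_
  have h1 := qBinom_mul d (s + 1) (r + 1)
  have h2 := qBinom_mul d (s + 1) r
  have h3 := qBinom_mul d s (r + 1)
  have h4 := qFact_succ d (s + r + 1)
  have h5 := qNum_add d (r + 1) (s + 1)
  have e1 : s + 1 + (r + 1) = s + r + 1 + 1 := by ring
  have e2 : s + 1 + r = s + r + 1 := by ring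
  have e3 : s + (r + 1) = s + r + 1 := by ring
  have e4 : r + 1 + (s + 1) = s + r + 1 + 1 := by ring
  rw [e1] at h1 ⊢
  rw [e2] at h2 ⊢
  rw [e3] at h3 ⊢
  rw [e4] at h5
  rw [h1, h4, h5]
  rw [qFact_succ d r] at h1 h3 ⊢
  rw [qFact_succ d s] at h1 h2 ⊢
  linear_combination (-sexp (((s + 1 : ℕ) : k⟦X⟧) * d) * qNum d (r + 1)) * h2 -
    (sexp (-(((r + 1 : ℕ) : k⟦X⟧) * d)) * qNum d (s + 1)) * h3

end QBinomial

/-! ### Quantum Serre sums as iterated `q`-commutators -/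

section SerreSums

variable {k : Type u} [Field k] {A : Type v} [Ring A] [Algebra k⟦X⟧ A]

/-- The sum `∑ (-1) ^ s [m choose s] u ^ s x ^ (m - s) y x ^ s`. -/
def serreG (d : k⟦X⟧) (m : ℕ) (u : k⟦X⟧) (x y : A) : A :=
  ∑ s ∈ Finset.range (m + 1), ((-1) ^ s * qBinom d m s * u ^ s) • (x ^ (m - s) * y * x ^ s)

theorem serreG_neg_left (d : k⟦X⟧) (m : ℕ) (u : k⟦X⟧) (x y : A) :
    serreG (-d) m u x y = serreG d m u x y := by
  simp [serreG, qBinom_neg]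

/-- Reversing products is the reflection `s ↦ m - s` of the sum, under which the `q`-binomials are
invariant; it inverts the parameter `u` up to an overall factor. -/
theorem serreG_op (d : k⟦X⟧) (m : ℕ) (u v : k⟦X⟧) (huv : u * v = 1) (x y : A) :
    serreG d m u (MulOpposite.op x) (MulOpposite.op y) =
      ((-1) ^ m * u ^ m) • MulOpposite.op (serreG d m v x y) := by
  rw [serreG, serreG, ← Finset.sum_range_reflect, Finset.op_sum, Finset.smul_sum]
  refine Finset.sum_congr rfl fun s hs => ?_
  have hs' : s ≤ m := by have := Finset.mem_range.mp hs; omega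
  have e1 : m + 1 - 1 - s = m - s := by omega
  rw [e1, Nat.sub_sub_self hs', MulOpposite.op_smul, smul_smul, ← MulOpposite.op_pow,
    ← MulOpposite.op_pow, ← MulOpposite.op_mul, ← MulOpposite.op_mul, qBinom_symm d hs', ← mul_assoc (x ^ (m - s))]
  congr 1
  obtain ⟨r, rfl⟩ := Nat.exists_eq_add_of_le hs'
  rw [Nat.add_sub_cancel_left, pow_add, pow_add]
  have h2 : (u : k⟦X⟧) ^ s * v ^ s = 1 := by rw [← mul_pow, huv, one_pow]
  have h3 : ((-1 : k⟦X⟧)) ^ s * (-1) ^ s = 1 := by rw [← mul_pow]; simp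
  linear_combination (-(-1) ^ r * qBinom d (s + r) s * u ^ r * u ^ s * v ^ s) * h3 -
    ((-1) ^ r * qBinom d (s + r) s * u ^ r) * h2

variable [CharZero k]

theorem serreG_zero (d : k⟦X⟧) (u : k⟦X⟧) (x y : A) : serreG d 0 u x y = y := by
  simp [serreG, qBinom_zero]

/-- Pascal's identity says that the Serre polynomial splits into linear factors: the first
`q`-commutator of `x` with `y` has parameter `q ^ (-m) u`, and a Serre sum of length `m` with
parameter `q u` remains. Every later property of Serre sums is proved by induction along this
factorization. -/
theorem serreG_succ (d : k⟦X⟧) (m : ℕ) (u : k⟦X⟧) (x y : A) :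
    serreG d (m + 1) u x y =
      serreG d m (sexp d * u) x (x * y - (sexp (-((m : k⟦X⟧) * d)) * u) • (y * x)) := by
  have hR : serreG d m (sexp d * u) x (x * y - (sexp (-((m : k⟦X⟧) * d)) * u) • (y * x)) =
      (∑ s ∈ Finset.range (m + 1), ((-1) ^ s * qBinom d m s * (sexp d * u) ^ s) •
        (x ^ (m + 1 - s) * y * x ^ s)) -
      ∑ s ∈ Finset.range (m + 1), ((-1) ^ s * qBinom d m s * (sexp d * u) ^ s *
        (sexp (-((m : k⟦X⟧) * d)) * u)) • (x ^ (m - s) * y * x ^ (s + 1)) := by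
    rw [serreG, ← Finset.sum_sub_distrib]
    refine Finset.sum_congr rfl fun s hs => ?_
    have hs' : m + 1 - s = m - s + 1 := by have := Finset.mem_range.mp hs; omega
    rw [hs', mul_sub, sub_mul, smul_sub, mul_smul_comm, smul_mul_assoc, smul_smul, pow_succ x (m - s),
      pow_succ' x s]
    simp only [mul_assoc]
  rw [hR, serreG, Finset.sum_range_succ', Finset.sum_range_succ, Finset.sum_range_succ' _ m,
    Finset.sum_range_succ _ m]
  have hmid : ∀ s ∈ Finset.range m,
      ((-1) ^ (s + 1) * qBinom d (m + 1) (s + 1) * u ^ (s + 1)) •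
        (x ^ (m + 1 - (s + 1)) * y * x ^ (s + 1)) =
      ((-1) ^ (s + 1) * qBinom d m (s + 1) * (sexp d * u) ^ (s + 1)) •
        (x ^ (m + 1 - (s + 1)) * y * x ^ (s + 1)) -
      ((-1) ^ s * qBinom d m s * (sexp d * u) ^ s *
        (sexp (-((m : k⟦X⟧) * d)) * u)) • (x ^ (m - s) * y * x ^ (s + 1)) := by
    intro s hs
    obtain ⟨r, rfl⟩ : ∃ r, m = s + (r + 1) := ⟨m - s - 1, by have := Finset.mem_range.mp hs; omega⟩
    have e1 : s + (r + 1) + 1 - (s + 1) = r + 1 := by omega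
    have e2 : s + (r + 1) - s = r + 1 := by omega
    rw [e1, e2, ← sub_smul]
    congr 1
    have hp := qBinom_pascal d s r
    have e3 : s + 1 + (r + 1) = s + (r + 1) + 1 := by ring
    have e4 : s + 1 + r = s + (r + 1) := by ring
    rw [e3, e4] at hp
    rw [hp, mul_pow, mul_pow, sexp_pow, sexp_pow]
    have h1 : sexp (-(((r + 1 : ℕ) : k⟦X⟧) * d)) =
        sexp ((s : k⟦X⟧) * d) * sexp (-(((s + (r + 1) : ℕ) : k⟦X⟧) * d)) := by
      rw [← sexp_add]; congr 1; push_cast; ring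
    rw [h1]
    ring
  rw [Finset.sum_congr rfl hmid, Finset.sum_sub_distrib]
  have hlast : ((-1) ^ (m + 1) * qBinom d (m + 1) (m + 1) * u ^ (m + 1)) •
        (x ^ (m + 1 - (m + 1)) * y * x ^ (m + 1)) =
      -(((-1) ^ m * qBinom d m m * (sexp d * u) ^ m *
        (sexp (-((m : k⟦X⟧) * d)) * u)) • (x ^ (m - m) * y * x ^ (m + 1))) := by
    rw [← neg_smul, Nat.sub_self, Nat.sub_self, qBinom_self, qBinom_self, mul_pow, sexp_pow]
    congr 1
    linear_combination (-1) ^ m * u ^ (m + 1) * sexp_neg_mul ((m : k⟦X⟧) * d)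
  rw [hlast]
  simp only [qBinom_zero, pow_zero]
  abel

/-- The hypothesis on `z` is that the `q`-commutator of `y` with `z` vanishes, so `y` drops out of
the first factor. Passing `y` through `x` contributes `q ^ 2`, which is just what makes the new `z`
satisfy the hypothesis for `m` and `q u`. -/
theorem serreG_add_left {d : k⟦X⟧} (m : ℕ) (u : k⟦X⟧) {x y z : A}
    (hyx : y * x = sexp (2 * d) • (x * y))
    (hyz : sexp ((m : k⟦X⟧) * d) • (y * z) = (sexp d * u) • (z * y)) :
    serreG d m u (x + y) z = serreG d m u x z := by
  induction m generalizing u z with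
  | zero => simp [serreG_zero]
  | succ m ih =>
    have h0 : y * z = (sexp (-((m : k⟦X⟧) * d)) * u) • (z * y) := by
      have := congrArg (fun t => sexp (-(((m + 1 : ℕ) : k⟦X⟧) * d)) • t) hyz
      simp only [smul_smul, sexp_neg_mul, one_smul] at this
      rw [this]
      congr 1
      rw [← mul_assoc, ← sexp_add]
      congr 2
      push_cast; ring
    rw [serreG_succ, serreG_succ]
    have hz : (x + y) * z - (sexp (-((m : k⟦X⟧) * d)) * u) • (z * (x + y)) =
        x * z - (sexp (-((m : k⟦X⟧) * d)) * u) • (z * x) := by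
      rw [add_mul, mul_add, smul_add, h0]; abel
    rw [hz]
    refine ih _ ?_
    have e1 : y * (x * z) = (sexp (2 * d) * (sexp (-((m : k⟦X⟧) * d)) * u)) • (x * z * y) := by
      rw [← mul_assoc, hyx, smul_mul_assoc, mul_assoc x y z, h0, mul_smul_comm, smul_smul,
        mul_assoc]
    have e2 : y * (z * x) = (sexp (2 * d) * (sexp (-((m : k⟦X⟧) * d)) * u)) • (z * x * y) := by
      rw [← mul_assoc, h0, smul_mul_assoc, mul_assoc z y x, hyx, mul_smul_comm, smul_smul,
        ← mul_assoc z x y, mul_comm _ (sexp (2 * d))]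
    rw [mul_sub, mul_smul_comm, e1, e2, sub_mul, smul_mul_assoc, smul_sub, smul_sub, smul_smul,
      smul_smul, smul_smul, smul_smul]
    have e3 : sexp ((m : k⟦X⟧) * d) * (sexp (2 * d) * (sexp (-((m : k⟦X⟧) * d)) * u)) =
        sexp d * (sexp d * u) := by
      have a1 : sexp (2 * d) = sexp d * sexp d := by rw [← sexp_add, two_mul]
      rw [a1]
      linear_combination sexp d * sexp d * u * sexp_neg_mul ((m : k⟦X⟧) * d)
    congr 2
    linear_combination (sexp (-((m : k⟦X⟧) * d)) * u) * e3

/-- Serre sums of skew-commuting sums. -/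
theorem serreG_add_add {d : k⟦X⟧} {m : ℕ} {u : k⟦X⟧} {x y z w : A}
    (hyx : y * x = sexp (2 * d) • (x * y))
    (hyz : sexp ((m : k⟦X⟧) * d) • (y * z) = (sexp d * u) • (z * y))
    (hxw : sexp d • (x * w) = (sexp ((m : k⟦X⟧) * d) * u) • (w * x))
    (hxz : serreG d m u x z = 0) (hyw : serreG d m u y w = 0) :
    serreG d m u (x + y) (z + w) = 0 := by
  have h1 : serreG d m u (x + y) (z + w) = serreG d m u (x + y) z + serreG d m u (x + y) w := by
    simp only [serreG, mul_add, add_mul, smul_add, Finset.sum_add_distrib]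
  -- For `w` the roles of `x` and `y` are exchanged. This replaces `q` by `q⁻¹`, to which the
  -- symmetric `q`-binomials are insensitive.
  have h2 : serreG (-d) m u (y + x) w = serreG (-d) m u y w := by
    refine serreG_add_left m u ?_ ?_
    · rw [hyx, smul_smul, mul_neg, sexp_neg_mul, one_smul]
    · have := congrArg (fun t => (sexp (-((m : k⟦X⟧) * d)) * sexp (-d)) • t) hxw
      simp only [smul_smul] at this
      have a1 : sexp (-((m : k⟦X⟧) * d)) * sexp (-d) * sexp d = sexp (-((m : k⟦X⟧) * d)) := by
        rw [mul_assoc, sexp_neg_mul, mul_one]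
      have a2 : sexp (-((m : k⟦X⟧) * d)) * sexp (-d) * (sexp ((m : k⟦X⟧) * d) * u) =
          sexp (-d) * u := by
        linear_combination sexp (-d) * u * sexp_neg_mul ((m : k⟦X⟧) * d)
      rwa [a1, a2, ← mul_neg] at this
  rw [serreG_neg_left, serreG_neg_left, add_comm y x] at h2
  rw [h1, serreG_add_left m u hyx hyz, h2, hxz, hyw, add_zero]

/-- Serre sums of elements rescaled by commuting toral factors. -/
theorem exists_serreG_toral (d : k⟦X⟧) (m : ℕ) (u : k⟦X⟧) {r₀ r₁ r₂ ρ : k⟦X⟧} {κ₁ κ₂ a b : A}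
    (h0 : a * κ₁ = r₀ • (κ₁ * a)) (h1 : a * κ₂ = r₁ • (κ₂ * a)) (h2 : b * κ₁ = r₂ • (κ₁ * b))
    (hκ : κ₁ * κ₂ = κ₂ * κ₁) (hρ : r₂ = r₁ * ρ) :
    ∃ κ : A, serreG d m u (κ₁ * a) (κ₂ * b) = κ * serreG d m (u * ρ) a b := by
  induction m generalizing u r₁ r₂ κ₂ b with
  | zero => exact ⟨κ₂, by simp [serreG_zero]⟩
  | succ m ih =>
    have e : κ₁ * a * (κ₂ * b) - (sexp (-((m : k⟦X⟧) * d)) * u) • (κ₂ * b * (κ₁ * a)) =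
        (r₁ • (κ₁ * κ₂)) * (a * b - (sexp (-((m : k⟦X⟧) * d)) * (u * ρ)) • (b * a)) := by
      have e1 : κ₁ * a * (κ₂ * b) = r₁ • (κ₁ * κ₂ * (a * b)) := by
        rw [mul_assoc, ← mul_assoc a, h1, smul_mul_assoc, mul_smul_comm]
        simp only [mul_assoc]
      have e2 : κ₂ * b * (κ₁ * a) = r₂ • (κ₁ * κ₂ * (b * a)) := by
        rw [mul_assoc, ← mul_assoc b, h2, smul_mul_assoc, mul_smul_comm, hκ]
        simp only [mul_assoc]
      rw [e1, e2, mul_sub, smul_mul_assoc, smul_mul_assoc, mul_smul_comm, smul_smul, smul_smul, hρ]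
      congr 2
      ring
    have h1' : a * (r₁ • (κ₁ * κ₂)) = (r₁ * r₀) • (r₁ • (κ₁ * κ₂) * a) := by
      rw [mul_smul_comm, ← mul_assoc, h0, smul_mul_assoc, mul_assoc κ₁, h1, mul_smul_comm,
        smul_mul_assoc, smul_smul, smul_smul, smul_smul, mul_assoc κ₁ κ₂]
    have h2' : (a * b - (sexp (-((m : k⟦X⟧) * d)) * (u * ρ)) • (b * a)) * κ₁ =
        (r₂ * r₀) • (κ₁ * (a * b - (sexp (-((m : k⟦X⟧) * d)) * (u * ρ)) • (b * a))) := by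
      have e1 : a * b * κ₁ = (r₂ * r₀) • (κ₁ * (a * b)) := by
        rw [mul_assoc, h2, mul_smul_comm, ← mul_assoc, h0, smul_mul_assoc, smul_smul, mul_assoc]
      have e2 : b * a * κ₁ = (r₂ * r₀) • (κ₁ * (b * a)) := by
        rw [mul_assoc, h0, mul_smul_comm, ← mul_assoc, h2, smul_mul_assoc, smul_smul, mul_assoc,
          mul_comm r₀]
      rw [sub_mul, smul_mul_assoc, e1, e2, mul_sub, smul_sub, mul_smul_comm, smul_comm (r₂ * r₀)]
    -- The new toral factor is `r₁ κ₁ κ₂`, next to the commutator of `a` and `b`. Both `r₁` and `r₂`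
    -- are multiplied by `r₀`, so their ratio `ρ` persists.
    obtain ⟨κ, hκ'⟩ := ih (sexp d * u) h1' h2'
      (by rw [mul_smul_comm, smul_mul_assoc, mul_assoc κ₁ κ₂, ← hκ]) (by rw [hρ]; ring)
    refine ⟨κ, ?_⟩
    rw [serreG_succ, e, hκ', serreG_succ, mul_assoc]

theorem serreG_toral_eq_zero {d : k⟦X⟧} {m : ℕ} {u : k⟦X⟧} {r₀ r₁ r₂ ρ : k⟦X⟧} {κ₁ κ₂ a b : A}
    (h0 : a * κ₁ = r₀ • (κ₁ * a)) (h1 : a * κ₂ = r₁ • (κ₂ * a)) (h2 : b * κ₁ = r₂ • (κ₁ * b))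
    (hκ : κ₁ * κ₂ = κ₂ * κ₁) (hρ : r₂ = r₁ * ρ) (hG : serreG d m (u * ρ) a b = 0) :
    serreG d m u (κ₁ * a) (κ₂ * b) = 0 := by
  obtain ⟨κ, h⟩ := exists_serreG_toral d m u h0 h1 h2 hκ hρ
  rw [h, hG, mul_zero]

/-- The skew coefficient in the `s`-th term is the `s`-th power of the coefficient at `s = 1`. -/
theorem serreSum_eq_serreG {n : ℕ} (C : CartanDatum n) (P : Matrix (Fin n) (Fin n) k⟦X⟧) (σ : ℤ)
    (i j : Fin n) (x y : A) :
    serreSum C P σ i j x y =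
      serreG (C.d i : k⟦X⟧) (serreExp C i j) (qSkew P i j σ) x y := by
  rw [serreSum, serreG]
  refine Finset.sum_congr rfl fun s _ => ?_
  congr 2
  rw [qSkew, qSkew, sexp_pow]
  congr 1
  rw [← mul_assoc, ← map_natCast (PowerSeries.C (R := k)), ← map_mul]
  congr 2
  push_cast; ring

end SerreSums

/-! ### Criteria for adic completeness -/

section AdicCompleteness

variable {k : Type u} [Field k]

/-- The increments of a Cauchy sequence are multiples of `ħ ^ n`, so the sequence is the sequence of
partial sums of a series, up to its initial term. -/
theorem isAdicComplete_of_series {M : Type v} [AddCommGroup M] [Module k⟦X⟧ M]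
    [IsHausdorff (hIdeal k) M]
    (h : ∀ a : ℕ → M, ∃ x, ∀ n, x - ∑ j ∈ Finset.range n, (PowerSeries.X : k⟦X⟧) ^ j • a j ∈
      (hIdeal k ^ n • ⊤ : Submodule k⟦X⟧ M)) : IsAdicComplete (hIdeal k) M where
  prec' f hf := by
    have h1 : ∀ n, ∃ y, f (n + 1) - f n = (PowerSeries.X : k⟦X⟧) ^ n • y := fun n =>
      mem_hpow_iff.mp (SModEq.sub_mem.mp (hf (Nat.le_succ n)).symm)
    choose a ha using h1
    obtain ⟨x, hx⟩ := h a
    refine ⟨x + f 0, fun n => ?_⟩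
    have hs : ∑ j ∈ Finset.range n, (PowerSeries.X : k⟦X⟧) ^ j • a j = f n - f 0 := by
      rw [← Finset.sum_range_sub]
      exact Finset.sum_congr rfl fun j _ => (ha j).symm
    have := hx n
    rw [hs] at this
    refine (SModEq.sub_mem.mpr ?_).symm
    convert this using 1
    abel

theorem isAdicComplete_of_linearEquiv {M : Type v} [AddCommGroup M] [Module k⟦X⟧ M]
    [IsAdicComplete (hIdeal k) M] {N : Type w} [AddCommGroup N] [Module k⟦X⟧ N]
    (e : M ≃ₗ[k⟦X⟧] N) : IsAdicComplete (hIdeal k) N := by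
  have : IsHausdorff (hIdeal k) N := ⟨fun x hx => by
    refine e.symm.map_eq_zero_iff.mp (eq_zero_of_forall_mem (k := k) fun n => ?_)
    exact map_mem_hpow e.symm.toLinearMap (SModEq.zero.mp (hx n))⟩
  refine isAdicComplete_of_series fun a => ⟨e (hsum k fun n => e.symm (a n)), fun n => ?_⟩
  have := map_mem_hpow e.toLinearMap (hsum_spec k (fun n => e.symm (a n)) n)
  simpa using this

/-- Lets the universal property produce the antipode, as a homomorphism into the opposite algebra.
-/
instance isAdicComplete_mulOpposite {H : Type v} [Ring H] [Algebra k⟦X⟧ H]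
    [IsAdicComplete (hIdeal k) H] : IsAdicComplete (hIdeal k) Hᵐᵒᵖ :=
  isAdicComplete_of_linearEquiv (MulOpposite.opLinearEquiv k⟦X⟧)

end AdicCompleteness

/-! ### The structure maps of a topological Hopf algebra on tensor legs -/

section HopfMaps

variable {k : Type u} [Field k] {A : Type v} [Ring A] [Algebra k⟦X⟧ A] {B : Type w} [Ring B]
  [Algebra k⟦X⟧ B]

instance instIsScalarTowerCTensor :
    IsScalarTower k⟦X⟧ (CTensor k A B) (CTensor k A B) :=
  ⟨fun c x y => Algebra.smul_mul_assoc (R := k⟦X⟧) (A := HComp k (A ⊗[k⟦X⟧] B)) c x y⟩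

instance instSMulCommClassCTensor :
    SMulCommClass k⟦X⟧ (CTensor k A B) (CTensor k A B) :=
  ⟨fun c x y => (Algebra.mul_smul_comm (R := k⟦X⟧) (A := HComp k (A ⊗[k⟦X⟧] B)) c x y).symm⟩

variable (k A B) in
/-- The map `z ↦ z ⊗ 1` from a completion to the completed tensor product. -/
def jl : HComp k A →ₐ[k⟦X⟧] CTensor k A B := cmapAlg Algebra.TensorProduct.includeLeft

variable (k A B) in
/-- The map `z ↦ 1 ⊗ z` from a completion to the completed tensor product. -/
def jr : HComp k B →ₐ[k⟦X⟧] CTensor k A B := cmapAlg Algebra.TensorProduct.includeRight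

theorem jl_of (x : A) : jl k A B (AdicCompletion.of (hIdeal k) _ x) = tl k A B x :=
  cmapAlg_of _ _

theorem jr_of (y : B) : jr k A B (AdicCompletion.of (hIdeal k) _ y) = tr k A B y :=
  cmapAlg_of _ _

theorem cmap_flip_one (z : HComp k A) :
    cmap (hIdeal k) ((TensorProduct.mk k⟦X⟧ A B).flip 1) z = jl k A B z :=
  cmap_eq_cmapAlg _ (fun _ => rfl) z

theorem cmap_mk_one (z : HComp k B) :
    cmap (hIdeal k) (TensorProduct.mk k⟦X⟧ A B 1) z = jr k A B z :=
  cmap_eq_cmapAlg _ (fun _ => rfl) z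

theorem commute_jl_tr (z : HComp k A) (y : B) : Commute (jl k A B z) (tr k A B y) := by
  refine LinearMap.congr_fun
    (f := LinearMap.mulRight k⟦X⟧ (tr k A B y) ∘ₗ (jl k A B).toLinearMap)
    (g := LinearMap.mulLeft k⟦X⟧ (tr k A B y) ∘ₗ (jl k A B).toLinearMap) ?_ z
  refine hcomp_ext fun x => ?_
  simpa [jl_of] using (commute_tl_tr x y).eq

theorem commute_tl_jr (x : A) (z : HComp k B) : Commute (tl k A B x) (jr k A B z) := by
  refine LinearMap.congr_fun
    (f := LinearMap.mulLeft k⟦X⟧ (tl k A B x) ∘ₗ (jr k A B).toLinearMap)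
    (g := LinearMap.mulRight k⟦X⟧ (tl k A B x) ∘ₗ (jr k A B).toLinearMap) ?_ z
  refine hcomp_ext fun y => ?_
  simpa [jr_of] using (commute_tl_tr x y).eq

theorem completeLeft_tmul (z : HComp k A) (y : B) :
    completeLeft (k := k) A B (z ⊗ₜ y) = jl k A B z * tr k A B y := by
  refine LinearMap.congr_fun
    (f := completeLeft (k := k) A B ∘ₗ (TensorProduct.mk k⟦X⟧ (HComp k A) B).flip y)
    (g := LinearMap.mulRight k⟦X⟧ (tr k A B y) ∘ₗ (jl k A B).toLinearMap) ?_ z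
  refine hcomp_ext fun x => ?_
  simp only [LinearMap.comp_apply, LinearMap.flip_apply, TensorProduct.mk_apply, completeLeft,
    TensorProduct.lift.tmul, LinearMap.coe_mk, AddHom.coe_mk, AlgHom.toLinearMap_apply,
    LinearMap.mulRight_apply, jl_of, tl_mul_tr, cmap_of]

theorem completeRight_tmul (x : A) (z : HComp k B) :
    completeRight (k := k) A B (x ⊗ₜ z) = tl k A B x * jr k A B z := by
  refine LinearMap.congr_fun
    (f := completeRight (k := k) A B ∘ₗ (TensorProduct.mk k⟦X⟧ A (HComp k B) x))
    (g := LinearMap.mulLeft k⟦X⟧ (tl k A B x) ∘ₗ (jr k A B).toLinearMap) ?_ z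
  refine hcomp_ext fun y => ?_
  simp only [LinearMap.comp_apply, TensorProduct.mk_apply, completeRight,
    TensorProduct.lift.tmul, LinearMap.coe_mk, AddHom.coe_mk, AlgHom.toLinearMap_apply,
    LinearMap.mulLeft_apply, jr_of, tl_mul_tr, cmap_of]

variable {H : Type v} [Ring H] [Algebra k⟦X⟧ H] (𝓗 : HopfData k H)

namespace HopfData

/-- The map `Δ ⊗ id`, as a homomorphism of algebras. -/
def comulLeftAlg : CTensor k H H →ₐ[k⟦X⟧] CTensor k (H ⊗[k⟦X⟧] H) H :=
  ctLift ((jl k (H ⊗[k⟦X⟧] H) H).comp 𝓗.comul) (tr k _ _) fun x y => commute_jl_tr (𝓗.comul x) y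

/-- The map `id ⊗ Δ`, as a homomorphism of algebras. -/
def comulRightAlg : CTensor k H H →ₐ[k⟦X⟧] CTensor k H (H ⊗[k⟦X⟧] H) :=
  ctLift (tl k _ _) ((jr k H (H ⊗[k⟦X⟧] H)).comp 𝓗.comul) fun x y => commute_tl_jr x (𝓗.comul y)

variable (k H) in
/-- The associativity isomorphism, as a homomorphism of algebras. -/
def cassocAlg : CTensor k (H ⊗[k⟦X⟧] H) H →ₐ[k⟦X⟧] CTensor k H (H ⊗[k⟦X⟧] H) :=
  cmapAlg (Algebra.TensorProduct.assoc k⟦X⟧ k⟦X⟧ k⟦X⟧ H H H).toAlgHom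

theorem comulLeft_eq (z : CTensor k H H) : 𝓗.comulLeft z = 𝓗.comulLeftAlg z := by
  refine LinearMap.congr_fun (f := 𝓗.comulLeft) (g := 𝓗.comulLeftAlg.toLinearMap) ?_ z
  refine ctensor_ext fun x y => ?_
  refine (extend_of _ _ _).trans (Eq.trans ?_ (ctLift_of _ _ _ x y).symm)
  exact completeLeft_tmul _ _

theorem comulRight_eq (z : CTensor k H H) : 𝓗.comulRight z = 𝓗.comulRightAlg z := by
  refine LinearMap.congr_fun (f := 𝓗.comulRight) (g := 𝓗.comulRightAlg.toLinearMap) ?_ z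
  refine ctensor_ext fun x y => ?_
  refine (extend_of _ _ _).trans (Eq.trans ?_ (ctLift_of _ _ _ x y).symm)
  exact completeRight_tmul _ _

theorem cassoc_eq (z : CTensor k (H ⊗[k⟦X⟧] H) H) : cassoc k H z = cassocAlg k H z :=
  cmap_eq_cmapAlg _ (fun _ => rfl) z

theorem comulLeftAlg_tl (x : H) :
    𝓗.comulLeftAlg (tl k H H x) = jl k (H ⊗[k⟦X⟧] H) H (𝓗.comul x) := ctLift_tl _ _ _ x

theorem comulLeftAlg_tr (y : H) : 𝓗.comulLeftAlg (tr k H H y) = tr k (H ⊗[k⟦X⟧] H) H y :=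
  ctLift_tr _ _ _ y

theorem comulRightAlg_tl (x : H) : 𝓗.comulRightAlg (tl k H H x) = tl k H (H ⊗[k⟦X⟧] H) x :=
  ctLift_tl _ _ _ x

theorem comulRightAlg_tr (y : H) :
    𝓗.comulRightAlg (tr k H H y) = jr k H (H ⊗[k⟦X⟧] H) (𝓗.comul y) := ctLift_tr _ _ _ y

theorem cassocAlg_jl_tl (x : H) :
    cassocAlg k H (jl k (H ⊗[k⟦X⟧] H) H (tl k H H x)) = tl k H (H ⊗[k⟦X⟧] H) x := by
  rw [tl_apply, jl_of, tl_apply, cassocAlg, cmapAlg_of]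
  rfl

theorem cassocAlg_jl_tr (x : H) :
    cassocAlg k H (jl k (H ⊗[k⟦X⟧] H) H (tr k H H x)) =
      jr k H (H ⊗[k⟦X⟧] H) (tl k H H x) := by
  rw [tr_apply, jl_of, tl_apply, cassocAlg, cmapAlg_of, tl_apply, jr_of]
  rfl

theorem cassocAlg_tr (x : H) :
    cassocAlg k H (tr k (H ⊗[k⟦X⟧] H) H x) = jr k H (H ⊗[k⟦X⟧] H) (tr k H H x) := by
  rw [tr_apply, cassocAlg, cmapAlg_of, tr_apply, jr_of]
  rfl

variable [IsAdicComplete (hIdeal k) H]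

/-- The map `m (ε ⊗ id)`, as a homomorphism of algebras. -/
def counitLeftAlg : CTensor k H H →ₐ[k⟦X⟧] H :=
  ctLift ((Algebra.ofId k⟦X⟧ H).comp 𝓗.counit) (AlgHom.id k⟦X⟧ H) fun _ _ =>
    Algebra.commutes _ _

/-- The map `m (id ⊗ ε)`, as a homomorphism of algebras. -/
def counitRightAlg : CTensor k H H →ₐ[k⟦X⟧] H :=
  ctLift (AlgHom.id k⟦X⟧ H) ((Algebra.ofId k⟦X⟧ H).comp 𝓗.counit) fun _ _ =>
    (Algebra.commutes _ _).symm

theorem counitLeft_eq (z : CTensor k H H) : 𝓗.counitLeft z = 𝓗.counitLeftAlg z := by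
  refine LinearMap.congr_fun (f := 𝓗.counitLeft) (g := 𝓗.counitLeftAlg.toLinearMap) ?_ z
  refine ctensor_ext fun x y => ?_
  refine (extend_of _ _ _).trans (Eq.trans ?_ (ctLift_of _ _ _ x y).symm)
  exact Algebra.smul_def _ _

theorem counitRight_eq (z : CTensor k H H) : 𝓗.counitRight z = 𝓗.counitRightAlg z := by
  refine LinearMap.congr_fun (f := 𝓗.counitRight) (g := 𝓗.counitRightAlg.toLinearMap) ?_ z
  refine ctensor_ext fun x y => ?_
  refine (extend_of _ _ _).trans (Eq.trans ?_ (ctLift_of _ _ _ x y).symm)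
  exact (Algebra.smul_def _ _).trans (Algebra.commutes _ _)

theorem counitLeftAlg_tl (x : H) :
    𝓗.counitLeftAlg (tl k H H x) = algebraMap k⟦X⟧ H (𝓗.counit x) := ctLift_tl _ _ _ x

theorem counitLeftAlg_tr (x : H) : 𝓗.counitLeftAlg (tr k H H x) = x := ctLift_tr _ _ _ x

theorem counitRightAlg_tl (x : H) : 𝓗.counitRightAlg (tl k H H x) = x := ctLift_tl _ _ _ x

theorem counitRightAlg_tr (x : H) :
    𝓗.counitRightAlg (tr k H H x) = algebraMap k⟦X⟧ H (𝓗.counit x) := ctLift_tr _ _ _ x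

theorem antipodeLeft_of (x y : H) :
    𝓗.antipodeLeft (AdicCompletion.of (hIdeal k) _ (x ⊗ₜ y)) = 𝓗.antipode x * y :=
  extend_of _ _ _

theorem antipodeRight_of (x y : H) :
    𝓗.antipodeRight (AdicCompletion.of (hIdeal k) _ (x ⊗ₜ y)) = x * 𝓗.antipode y :=
  extend_of _ _ _

theorem antipodeLeft_tl_mul_tr (x y : H) :
    𝓗.antipodeLeft (tl k H H x * tr k H H y) = 𝓗.antipode x * y := by
  rw [tl_mul_tr, antipodeLeft_of]

theorem antipodeRight_tl_mul_tr (x y : H) :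
    𝓗.antipodeRight (tl k H H x * tr k H H y) = x * 𝓗.antipode y := by
  rw [tl_mul_tr, antipodeRight_of]

theorem antipodeLeft_tl (x : H) : 𝓗.antipodeLeft (tl k H H x) = 𝓗.antipode x := by
  rw [tl_apply, antipodeLeft_of, mul_one]

theorem antipodeRight_tr (x : H) : 𝓗.antipodeRight (tr k H H x) = 𝓗.antipode x := by
  rw [tr_apply, antipodeRight_of, one_mul]

theorem antipodeLeft_tr (h1 : 𝓗.antipode 1 = 1) (x : H) :
    𝓗.antipodeLeft (tr k H H x) = x := by
  rw [tr_apply, antipodeLeft_of, h1, one_mul]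

theorem antipodeRight_tl (h1 : 𝓗.antipode 1 = 1) (x : H) :
    𝓗.antipodeRight (tl k H H x) = x := by
  rw [tl_apply, antipodeRight_of, h1, mul_one]

theorem antipodeLeft_algebraMap (h1 : 𝓗.antipode 1 = 1) (c : k⟦X⟧) :
    𝓗.antipodeLeft (algebraMap k⟦X⟧ (CTensor k H H) c) = algebraMap k⟦X⟧ H c := by
  rw [← (tr k H H).commutes c, antipodeLeft_tr 𝓗 h1]

theorem antipodeRight_algebraMap (h1 : 𝓗.antipode 1 = 1) (c : k⟦X⟧) :
    𝓗.antipodeRight (algebraMap k⟦X⟧ (CTensor k H H) c) = algebraMap k⟦X⟧ H c := by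
  rw [← (tl k H H).commutes c, antipodeRight_tl 𝓗 h1]

/-- The map `m (S ⊗ id)` of a product depends on the first factor only through its image. -/
theorem antipodeLeft_mul_congr (hS : ∀ x y, 𝓗.antipode (x * y) = 𝓗.antipode y * 𝓗.antipode x)
    {z z' : CTensor k H H} (h : 𝓗.antipodeLeft z = 𝓗.antipodeLeft z') (w : CTensor k H H) :
    𝓗.antipodeLeft (z * w) = 𝓗.antipodeLeft (z' * w) := by
  have key : ∀ (c d : H) (z : CTensor k H H),
      𝓗.antipodeLeft (z * AdicCompletion.of (hIdeal k) _ (c ⊗ₜ d)) =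
        𝓗.antipode c * 𝓗.antipodeLeft z * d := fun c d z => by
    refine LinearMap.congr_fun
      (f := 𝓗.antipodeLeft ∘ₗ LinearMap.mulRight k⟦X⟧ (AdicCompletion.of (hIdeal k) _ (c ⊗ₜ d)))
      (g := LinearMap.mulRight k⟦X⟧ d ∘ₗ LinearMap.mulLeft k⟦X⟧ (𝓗.antipode c) ∘ₗ
        𝓗.antipodeLeft) ?_ z
    refine ctensor_ext fun x y => ?_
    simp only [LinearMap.comp_apply, LinearMap.mulRight_apply, LinearMap.mulLeft_apply,
      ← completion_of_mul, Algebra.TensorProduct.tmul_mul_tmul, antipodeLeft_of, hS, mul_assoc]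
  refine LinearMap.congr_fun (f := 𝓗.antipodeLeft ∘ₗ LinearMap.mulLeft k⟦X⟧ z)
    (g := 𝓗.antipodeLeft ∘ₗ LinearMap.mulLeft k⟦X⟧ z') ?_ w
  refine ctensor_ext fun c d => ?_
  simp only [LinearMap.comp_apply, LinearMap.mulLeft_apply, key, h]

/-- The map `m (id ⊗ S)` of a product depends on the second factor only through its image. -/
theorem antipodeRight_mul_congr (hS : ∀ x y, 𝓗.antipode (x * y) = 𝓗.antipode y * 𝓗.antipode x)
    {w w' : CTensor k H H} (h : 𝓗.antipodeRight w = 𝓗.antipodeRight w') (z : CTensor k H H) :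
    𝓗.antipodeRight (z * w) = 𝓗.antipodeRight (z * w') := by
  have key : ∀ (a b : H) (w : CTensor k H H),
      𝓗.antipodeRight (AdicCompletion.of (hIdeal k) _ (a ⊗ₜ b) * w) =
        a * 𝓗.antipodeRight w * 𝓗.antipode b := fun a b w => by
    refine LinearMap.congr_fun
      (f := 𝓗.antipodeRight ∘ₗ LinearMap.mulLeft k⟦X⟧ (AdicCompletion.of (hIdeal k) _ (a ⊗ₜ b)))
      (g := LinearMap.mulRight k⟦X⟧ (𝓗.antipode b) ∘ₗ LinearMap.mulLeft k⟦X⟧ a ∘ₗ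
        𝓗.antipodeRight) ?_ w
    refine ctensor_ext fun x y => ?_
    simp only [LinearMap.comp_apply, LinearMap.mulRight_apply, LinearMap.mulLeft_apply,
      ← completion_of_mul, Algebra.TensorProduct.tmul_mul_tmul, antipodeRight_of, hS, mul_assoc]
  refine LinearMap.congr_fun (f := 𝓗.antipodeRight ∘ₗ LinearMap.mulRight k⟦X⟧ w)
    (g := 𝓗.antipodeRight ∘ₗ LinearMap.mulRight k⟦X⟧ w') ?_ z
  refine ctensor_ext fun c d => ?_
  simp only [LinearMap.comp_apply, LinearMap.mulRight_apply, key, h]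

/-- The map `m (S ⊗ id)` is not multiplicative, but in a product the first factor `Δ x` may be
replaced by the scalar `ε x`, which has the same image. The antipode axiom thus passes from `x` and
`y` to `x * y`. -/
theorem antipodeLeft_comul_mul (hS : ∀ x y, 𝓗.antipode (x * y) = 𝓗.antipode y * 𝓗.antipode x)
    (h1 : 𝓗.antipode 1 = 1) {x y : H}
    (hx : 𝓗.antipodeLeft (𝓗.comul x) = algebraMap k⟦X⟧ H (𝓗.counit x))
    (hy : 𝓗.antipodeLeft (𝓗.comul y) = algebraMap k⟦X⟧ H (𝓗.counit y)) :
    𝓗.antipodeLeft (𝓗.comul (x * y)) = algebraMap k⟦X⟧ H (𝓗.counit (x * y)) := by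
  rw [← 𝓗.antipodeLeft_algebraMap h1] at hx
  rw [map_mul, 𝓗.antipodeLeft_mul_congr hS hx, ← Algebra.smul_def, map_smul, hy, map_mul, map_mul,
    Algebra.smul_def]

theorem antipodeRight_comul_mul (hS : ∀ x y, 𝓗.antipode (x * y) = 𝓗.antipode y * 𝓗.antipode x)
    (h1 : 𝓗.antipode 1 = 1) {x y : H}
    (hx : 𝓗.antipodeRight (𝓗.comul x) = algebraMap k⟦X⟧ H (𝓗.counit x))
    (hy : 𝓗.antipodeRight (𝓗.comul y) = algebraMap k⟦X⟧ H (𝓗.counit y)) :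
    𝓗.antipodeRight (𝓗.comul (x * y)) = algebraMap k⟦X⟧ H (𝓗.counit (x * y)) := by
  rw [← 𝓗.antipodeRight_algebraMap h1] at hy
  rw [map_mul, 𝓗.antipodeRight_mul_congr hS hy, ← Algebra.commutes, ← Algebra.smul_def, map_smul,
    hx, map_mul, map_mul, ← Algebra.commutes (𝓗.counit y), Algebra.smul_def,
    Algebra.commutes (𝓗.counit y)]

end HopfData

end HopfMaps

/-! ### Entries of a matrix of Cartan type -/

section CartanType

variable {k : Type u} [Field k] {n : ℕ} {C : CartanDatum n}
  {P : Matrix (Fin n) (Fin n) k⟦X⟧}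

theorem CartanDatum.IsCartanType.add_eq (hP : C.IsCartanType P) (i j : Fin n) :
    P i j + P j i = 2 * (((C.d i : ℤ) * C.A i j : ℤ) : k⟦X⟧) := by
  have := congrFun (congrFun hP i) j
  simpa [CartanDatum.DA] using this

/-- Half of the difference of transposed entries. -/
def skewHalf (P : Matrix (Fin n) (Fin n) k⟦X⟧) (i j : Fin n) : k⟦X⟧ :=
  PowerSeries.C (1 / 2 : k) * (P i j - P j i)

theorem qSkew_one (P : Matrix (Fin n) (Fin n) k⟦X⟧) (i j : Fin n) :
    qSkew P i j 1 = sexp (skewHalf P i j) := by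
  simp [qSkew, skewHalf]

theorem serreExp_cast (C : CartanDatum n) {i j : Fin n} (h : i ≠ j) :
    (serreExp C i j : ℤ) = 1 - C.A i j := by
  have := C.nonpos i j h
  rw [serreExp, Int.toNat_of_nonneg (by omega)]

theorem CartanDatum.IsCartanType.add_eq_serreExp (hP : C.IsCartanType P) {i j : Fin n}
    (h : i ≠ j) : P i j + P j i = 2 * ((C.d i : k⟦X⟧) * (1 - (serreExp C i j : k⟦X⟧))) := by
  have h1 : C.A i j = 1 - (serreExp C i j : ℤ) := by rw [serreExp_cast C h]; ring
  rw [hP.add_eq i j, h1]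
  push_cast
  ring

variable [CharZero k]

theorem two_ne_zero_powerSeries : (2 : k⟦X⟧) ≠ 0 := fun h => by
  have := congrArg PowerSeries.constantCoeff h
  rw [map_ofNat, map_zero] at this
  exact two_ne_zero this

theorem C_half_mul (c : k⟦X⟧) : PowerSeries.C (1 / 2 : k) * (2 * c) = c := by
  have h : (2 : k⟦X⟧) = PowerSeries.C (2 : k) := (map_ofNat _ 2).symm
  rw [← mul_assoc, h, ← map_mul]
  simp

theorem CartanDatum.IsCartanType.diag_eq (hP : C.IsCartanType P) (i : Fin n) :
    P i i = 2 * (C.d i : k⟦X⟧) := by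
  have h := hP.add_eq i i
  rw [← two_mul, C.diag] at h
  have h2 : (2 : k⟦X⟧) ≠ 0 := two_ne_zero_powerSeries
  refine mul_left_cancel₀ h2 ?_
  rw [h]; push_cast; ring

theorem two_mul_skewHalf (P : Matrix (Fin n) (Fin n) k⟦X⟧) (i j : Fin n) :
    2 * skewHalf P i j = P i j - P j i := by
  rw [skewHalf, mul_left_comm, C_half_mul]

theorem qSkew_neg_one (P : Matrix (Fin n) (Fin n) k⟦X⟧) (i j : Fin n) :
    qSkew P i j (-1) = sexp (-skewHalf P i j) := by
  have : ((-1 : ℤ) : k) / 2 = -(1 / 2) := by push_cast; ring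
  rw [qSkew, skewHalf, this, map_neg, neg_mul]

/-- This splits `P i j` into `d_i a_ij`, expressed by the length `1 - a_ij` of the Serre sum, and
the skew part that enters `qSkew`. In this form the scalars from commuting toral exponentials match
the hypotheses of `serreG_add_add`. -/
theorem CartanDatum.IsCartanType.eq_add (hP : C.IsCartanType P) {i j : Fin n} (h : i ≠ j) :
    P i j = (C.d i : k⟦X⟧) * (1 - (serreExp C i j : k⟦X⟧)) + skewHalf P i j := by
  have h1 := hP.add_eq_serreExp h
  have h2 := two_mul_skewHalf P i j
  have h3 : (2 : k⟦X⟧) ≠ 0 := two_ne_zero_powerSeries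
  refine mul_left_cancel₀ h3 ?_
  linear_combination h1 - h2

theorem CartanDatum.IsCartanType.eq_sub (hP : C.IsCartanType P) {i j : Fin n} (h : i ≠ j) :
    P j i = (C.d i : k⟦X⟧) * (1 - (serreExp C i j : k⟦X⟧)) - skewHalf P i j := by
  have h1 := hP.add_eq_serreExp h
  have h2 := hP.eq_add h
  linear_combination h1 - h2

end CartanType

/-! ### The defining relations under coproduct and antipode -/

section Relations

variable {k : Type u} [Field k] {n : ℕ} {P : Matrix (Fin n) (Fin n) k⟦X⟧}
  {𝔥 : Type v} [AddCommGroup 𝔥] [Module k⟦X⟧ 𝔥] {C : CartanDatum n} {R : Realization P 𝔥}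
  {A : Type w} [Ring A] [Algebra k⟦X⟧ A] [IsAdicComplete (hIdeal k) A]

namespace GenRel

variable {t : 𝔥 →ₗ[k⟦X⟧] A} {e f : Fin n → A}

theorem commute_t (h : GenRel C R t e f) (x y : 𝔥) : Commute (t x) (t y) := h.tt x y

theorem t_mul_e (h : GenRel C R t e f) (x : 𝔥) (j : Fin n) :
    t x * e j = e j * t x + R.α j x • e j := by
  rw [← h.te]; abel

theorem t_mul_f (h : GenRel C R t e f) (x : 𝔥) (j : Fin n) :
    t x * f j = f j * t x + -(R.α j x) • f j := by
  rw [← h.tf]; abel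

variable [CharZero k]

theorem hexp_mul_e (h : GenRel C R t e f) (x : 𝔥) (j : Fin n) :
    hexp k (t x) * e j = sexp (R.α j x) • (e j * hexp k (t x)) :=
  hexp_weight (h.t_mul_e x j)

theorem hexp_mul_f (h : GenRel C R t e f) (x : 𝔥) (j : Fin n) :
    hexp k (t x) * f j = sexp (-R.α j x) • (f j * hexp k (t x)) :=
  hexp_weight (h.t_mul_f x j)

theorem e_mul_hexp (h : GenRel C R t e f) (x : 𝔥) (j : Fin n) :
    e j * hexp k (t x) = sexp (-R.α j x) • (hexp k (t x) * e j) := by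
  rw [h.hexp_mul_e, smul_smul, sexp_neg_mul, one_smul]

theorem f_mul_hexp (h : GenRel C R t e f) (x : 𝔥) (j : Fin n) :
    f j * hexp k (t x) = sexp (R.α j x) • (hexp k (t x) * f j) := by
  rw [h.hexp_mul_f, smul_smul, mul_comm, sexp_neg_mul, one_smul]

theorem serreG_e (h : GenRel C R t e f) {i j : Fin n} (hij : i ≠ j) :
    serreG (C.d i : k⟦X⟧) (serreExp C i j) (sexp (skewHalf P i j)) (e i) (e j) = 0 := by
  rw [← qSkew_one, ← serreSum_eq_serreG, h.se i j hij]

theorem serreG_f (h : GenRel C R t e f) {i j : Fin n} (hij : i ≠ j) :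
    serreG (C.d i : k⟦X⟧) (serreExp C i j) (sexp (-skewHalf P i j)) (f i) (f j) = 0 := by
  rw [← qSkew_neg_one, ← serreSum_eq_serreG, h.sf i j hij]

/-- Two commuting families that satisfy the defining relations combine as the coproduct does. -/
theorem coproduct (hP : C.IsCartanType P) {t₁ t₂ : 𝔥 →ₗ[k⟦X⟧] A} {e₁ e₂ f₁ f₂ : Fin n → A}
    (h₁ : GenRel C R t₁ e₁ f₁) (h₂ : GenRel C R t₂ e₂ f₂)
    (hc : ∀ g g' : Gen n 𝔥, Commute (genVal t₁ e₁ f₁ g) (genVal t₂ e₂ f₂ g')) :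
    GenRel C R (t₁ + t₂) (fun i => e₁ i + hexp k (t₁ (R.Tp i)) * e₂ i)
      (fun i => f₁ i * hexp k (-t₂ (R.Tm i)) + f₂ i) := by
  have ctt : ∀ x y, Commute (t₁ x) (t₂ y) := fun x y => hc (.T x) (.T y)
  have cte : ∀ x j, Commute (t₁ x) (e₂ j) := fun x y => hc (.T x) (.E y)
  have ctf : ∀ x j, Commute (t₁ x) (f₂ j) := fun x y => hc (.T x) (.F y)
  have cet : ∀ i x, Commute (e₁ i) (t₂ x) := fun x y => hc (.E x) (.T y)
  have cee : ∀ i j, Commute (e₁ i) (e₂ j) := fun x y => hc (.E x) (.E y)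
  have cef : ∀ i j, Commute (e₁ i) (f₂ j) := fun x y => hc (.E x) (.F y)
  have cft : ∀ i x, Commute (f₁ i) (t₂ x) := fun x y => hc (.F x) (.T y)
  have cfe : ∀ i j, Commute (f₁ i) (e₂ j) := fun x y => hc (.F x) (.E y)
  have cff : ∀ i j, Commute (f₁ i) (f₂ j) := fun x y => hc (.F x) (.F y)
  have hneg : ∀ x, -t₂ x = t₂ (-x) := fun x => (map_neg t₂ x).symm
  refine ⟨fun x y => ?_, fun x j => ?_, fun x j => ?_, fun i j => ?_, fun i j hij => ?_,
    fun i j hij => ?_⟩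
  · have c : Commute (t₁ x + t₂ x) (t₁ y + t₂ y) :=
      ((h₁.commute_t x y).add_right (ctt x y)).add_left
        ((ctt y x).symm.add_right (h₂.commute_t x y))
    exact c
  · have c1 : Commute (t₁ x) (hexp k (t₁ (R.Tp j))) := (commute_hexp_left (h₁.commute_t _ _)).symm
    have c2 : Commute (t₂ x) (hexp k (t₁ (R.Tp j))) := (commute_hexp_left (ctt _ _)).symm
    have e1 : t₁ x * (hexp k (t₁ (R.Tp j)) * e₂ j) = hexp k (t₁ (R.Tp j)) * e₂ j * t₁ x :=
      (c1.mul_right (cte x j))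
    have e2 : t₂ x * (hexp k (t₁ (R.Tp j)) * e₂ j) =
        hexp k (t₁ (R.Tp j)) * e₂ j * t₂ x + R.α j x • (hexp k (t₁ (R.Tp j)) * e₂ j) := by
      rw [← mul_assoc, c2.eq, mul_assoc, h₂.t_mul_e, mul_add, mul_smul_comm, mul_assoc]
    simp only [LinearMap.add_apply, add_mul, mul_add, e1, e2, h₁.t_mul_e, (cet j x).eq, smul_add]
    abel
  · have c1 : Commute (t₁ x) (hexp k (-t₂ (R.Tm j))) :=
      (commute_hexp_left (ctt _ _).symm.neg_left).symm
    have c2 : Commute (t₂ x) (hexp k (-t₂ (R.Tm j))) :=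
      (commute_hexp_left (h₂.commute_t _ _).neg_left).symm
    have e1 : t₂ x * (f₁ j * hexp k (-t₂ (R.Tm j))) = f₁ j * hexp k (-t₂ (R.Tm j)) * t₂ x :=
      ((cft j x).symm.mul_right c2)
    have e2 : t₁ x * (f₁ j * hexp k (-t₂ (R.Tm j))) =
        f₁ j * hexp k (-t₂ (R.Tm j)) * t₁ x + -(R.α j x) • (f₁ j * hexp k (-t₂ (R.Tm j))) := by
      rw [← mul_assoc, h₁.t_mul_f, add_mul, mul_assoc, c1.eq, smul_mul_assoc, mul_assoc]
    simp only [LinearMap.add_apply, add_mul, mul_add, e1, e2, h₂.t_mul_f, (ctf x j).eq, smul_add]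
    abel
  · set K := hexp k (t₁ (R.Tp i)) with hK
    set L := hexp k (-t₂ (R.Tm j)) with hL
    have cKe : Commute K (e₂ i) := commute_hexp_left (cte _ _)
    have cKf : Commute K (f₂ j) := commute_hexp_left (ctf _ _)
    have cLe : Commute L (e₁ i) := commute_hexp_left (cet _ _).symm.neg_left
    have cLf : Commute L (f₁ j) := commute_hexp_left (cft _ _).symm.neg_left
    have cKL : Commute K L := commute_hexp_hexp (ctt _ _).neg_right
    have eK : K * f₁ j = sexp (-P i j) • (f₁ j * K) := by rw [hK, h₁.hexp_mul_f, R.α_Tp]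
    have eL : L * e₂ i = sexp (-P i j) • (e₂ i * L) := by
      rw [hL, hneg, h₂.hexp_mul_e, map_neg, R.α_Tm]
    -- Both `K` past `f₁ j` and `L` past `e₂ i` cost the same scalar `exp (-ħ P i j)`, because `α j
    -- (T⁺ i) = P i j = α i (T⁻ j)`. Hence the mixed terms commute.
    have cross : K * e₂ i * (f₁ j * L) = f₁ j * L * (K * e₂ i) := by
      calc K * e₂ i * (f₁ j * L) = K * (e₂ i * f₁ j) * L := by simp only [mul_assoc]
        _ = (K * f₁ j) * (e₂ i * L) := by rw [← (cfe j i).eq]; simp only [mul_assoc]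
        _ = f₁ j * K * (sexp (-P i j) • (e₂ i * L)) := by
          rw [eK, smul_mul_assoc, mul_smul_comm]
        _ = f₁ j * (K * L) * e₂ i := by rw [← eL]; simp only [mul_assoc]
        _ = f₁ j * L * (K * e₂ i) := by rw [cKL.eq]; simp only [mul_assoc]
    have s1 : e₁ i * (f₁ j * L) - f₁ j * L * e₁ i = (e₁ i * f₁ j - f₁ j * e₁ i) * L := by
      rw [mul_assoc, cLe.eq, sub_mul]; simp only [mul_assoc]
    have s2 : K * e₂ i * f₂ j - f₂ j * (K * e₂ i) = K * (e₂ i * f₂ j - f₂ j * e₂ i) := by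
      rw [← mul_assoc (f₂ j), ← cKf.eq, mul_sub]; simp only [mul_assoc]
    have hsum : (e₁ i + K * e₂ i) * (f₁ j * L + f₂ j) - (f₁ j * L + f₂ j) * (e₁ i + K * e₂ i) =
        (e₁ i * f₁ j - f₁ j * e₁ i) * L + K * (e₂ i * f₂ j - f₂ j * e₂ i) := by
      rw [← s1, ← s2]
      simp only [add_mul, mul_add, cross, (cef i j).eq]
      abel
    rw [hsum, h₁.ef, h₂.ef]
    by_cases hij : i = j
    · subst hij
      simp only [if_true, LinearMap.add_apply]
      rw [qQuot_add C i (ctt _ _) (ctt _ _) (ctt _ _)]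
    · simp only [if_neg hij, zero_mul, mul_zero, add_zero]
  · rw [serreSum_eq_serreG, qSkew_one]
    have cK : ∀ i x, Commute (hexp k (t₁ (R.Tp i))) (e₂ x) := fun i x => commute_hexp_left (cte _ _)
    have cKK := commute_hexp_hexp (k := k) (h₁.commute_t (R.Tp i) (R.Tp j))
    -- Moving `exp (ħ T⁺ i)` past `e₁ i`, past `e₁ j`, and `exp (ħ T⁺ j)` past `e₁ i` gives the
    -- exponents `P i i`, `P i j`, `P j i`. The last goal is the Serre relation of the second
    -- family, whose toral factors come from the first family and commute with it.
    refine serreG_add_add (x := e₁ i) (y := hexp k (t₁ (R.Tp i)) * e₂ i) (z := e₁ j)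
      (w := hexp k (t₁ (R.Tp j)) * e₂ j) ?_ ?_ ?_ (h₁.serreG_e hij) ?_
    · rw [mul_assoc, ← (cee i i).eq, ← mul_assoc, h₁.hexp_mul_e, R.α_Tp, smul_mul_assoc,
        hP.diag_eq, mul_assoc]
    · rw [mul_assoc, ← (cee j i).eq, ← mul_assoc, h₁.hexp_mul_e, R.α_Tp, smul_mul_assoc,
        smul_smul, mul_assoc, ← sexp_add, ← sexp_add, hP.eq_add hij]
      congr 2; ring
    · rw [mul_assoc (hexp k (t₁ (R.Tp j))), ← (cee i j).eq, ← mul_assoc (hexp k (t₁ (R.Tp j))),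
        h₁.hexp_mul_e, R.α_Tp, smul_mul_assoc, smul_smul, mul_assoc (e₁ i), ← sexp_add, ← sexp_add,
        hP.eq_sub hij]
      congr 2; ring
    · refine serreG_toral_eq_zero (r₀ := 1) (r₁ := 1) (r₂ := 1) (ρ := 1) ?_ ?_ ?_ cKK.eq
        (by rw [mul_one]) ?_
      · rw [one_smul]; exact (cK _ _).symm
      · rw [one_smul]; exact (cK _ _).symm
      · rw [one_smul]; exact (cK _ _).symm
      · rw [mul_one]; exact h₂.serreG_e hij
  · rw [serreSum_eq_serreG, qSkew_neg_one]
    have cL : ∀ i x, Commute (f₁ x) (hexp k (-t₂ (R.Tm i))) := fun i x =>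
      (commute_hexp_left (cft _ _).symm.neg_left).symm
    have cLL : Commute (hexp k (-t₂ (R.Tm i))) (hexp k (-t₂ (R.Tm j))) :=
      commute_hexp_hexp (k := k) ((h₂.commute_t (R.Tm i) (R.Tm j)).neg_left.neg_right)
    -- Here the toral factors lie on the second leg, so the second summand takes the place of `x`
    -- and the first that of `y`.
    rw [add_comm, add_comm (f₁ j * _)]
    refine serreG_add_add (x := f₂ i) (y := f₁ i * hexp k (-t₂ (R.Tm i))) (z := f₂ j)
      (w := f₁ j * hexp k (-t₂ (R.Tm j))) ?_ ?_ ?_ (h₂.serreG_f hij) ?_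
    · rw [mul_assoc, hneg, h₂.hexp_mul_f, map_neg (R.α i), R.α_Tm, neg_neg, mul_smul_comm,
        hP.diag_eq, ← mul_assoc, (cff i i).eq, mul_assoc]
    · rw [mul_assoc, hneg, h₂.hexp_mul_f, map_neg (R.α j), R.α_Tm, neg_neg, mul_smul_comm, smul_smul,
        ← mul_assoc, (cff i j).eq, mul_assoc, ← sexp_add, ← sexp_add, hP.eq_sub hij]
      congr 2; ring
    · rw [mul_assoc (f₁ j), hneg, h₂.hexp_mul_f, map_neg (R.α i), R.α_Tm, neg_neg, mul_smul_comm, smul_smul,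
        ← mul_assoc, ← (cff j i).eq, mul_assoc, ← sexp_add, ← sexp_add, hP.eq_add hij]
      congr 2; ring
    · rw [(cL i i).eq, (cL j j).eq]
      refine serreG_toral_eq_zero (r₀ := 1) (r₁ := 1) (r₂ := 1) (ρ := 1) ?_ ?_ ?_ cLL.eq
        (by rw [mul_one]) ?_
      · rw [one_smul]; exact (cL _ _)
      · rw [one_smul]; exact (cL _ _)
      · rw [one_smul]; exact (cL _ _)
      · rw [mul_one]; exact h₁.serreG_f hij

/-- The images of the generators under the antipode satisfy the opposite relations. -/
theorem antipode (h : GenRel C R t e f) :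
    GenRel C R ((MulOpposite.opLinearEquiv k⟦X⟧ : A ≃ₗ[k⟦X⟧] Aᵐᵒᵖ).toLinearMap ∘ₗ (-t))
      (fun i => MulOpposite.op (-(hexp k (-t (R.Tp i)) * e i)))
      (fun i => MulOpposite.op (-(f i * hexp k (t (R.Tm i))))) := by
  have hneg : ∀ x, -t x = t (-x) := fun x => (map_neg t x).symm
  have happ : ∀ x, ((MulOpposite.opLinearEquiv k⟦X⟧ : A ≃ₗ[k⟦X⟧] Aᵐᵒᵖ).toLinearMap ∘ₗ (-t)) x =
    MulOpposite.op (-t x) := fun x => rfl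
  refine ⟨fun x y => ?_, fun x j => ?_, fun x j => ?_, fun i j => ?_, fun i j hij => ?_,
    fun i j hij => ?_⟩
  · simp only [happ, ← MulOpposite.op_mul, neg_mul_neg, h.tt x y]
  · have c : Commute (t x) (hexp k (-t (R.Tp j))) :=
      (commute_hexp_left (h.commute_t _ _).neg_left).symm
    simp only [happ, ← MulOpposite.op_mul, neg_mul_neg, ← MulOpposite.op_sub, ← MulOpposite.op_smul]
    congr 1
    rw [← mul_assoc, c.eq, mul_assoc, mul_assoc, h.t_mul_e, mul_add, mul_smul_comm, smul_neg]
    abel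
  · have c : Commute (t x) (hexp k (t (R.Tm j))) :=
      (commute_hexp_left (h.commute_t _ _)).symm
    simp only [happ, ← MulOpposite.op_mul, neg_mul_neg, ← MulOpposite.op_sub, ← MulOpposite.op_smul]
    congr 1
    rw [← mul_assoc (t x), h.t_mul_f, mul_assoc, ← c.eq, add_mul, smul_mul_assoc, smul_neg,
      mul_assoc]
    abel
  · simp only [happ, ← MulOpposite.op_mul, neg_mul_neg, ← MulOpposite.op_sub]
    set K := hexp k (-t (R.Tp i)) with hK
    set L := hexp k (t (R.Tm j)) with hL
    have cKL : Commute K L := commute_hexp_hexp (h.commute_t _ _).neg_left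
    -- Both orders of the product acquire the scalar `exp (ħ (P j j - P i j))`. It is `1` when `i =
    -- j`, and multiplies zero otherwise.
    have e1 : f j * L * (K * e i) = sexp (P j j - P i j) • (K * L * (f j * e i)) := by
      calc f j * L * (K * e i) = f j * L * K * e i := by simp only [mul_assoc]
        _ = _ := by
          rw [hL, h.f_mul_hexp, smul_mul_assoc, mul_assoc _ (f j) K, hK, hneg, h.f_mul_hexp,
            mul_smul_comm, smul_smul, ← sexp_add, ← hneg, ← hK, ← hL, smul_mul_assoc, ← mul_assoc L,
            ← cKL.eq, map_neg, R.α_Tp, R.α_Tm, mul_assoc _ (f j), sub_eq_add_neg]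
    have e2 : K * e i * (f j * L) = sexp (P j j - P i j) • (K * L * (e i * f j)) := by
      rw [hL, h.f_mul_hexp, mul_smul_comm, ← mul_assoc, mul_assoc K (e i), h.e_mul_hexp,
        mul_smul_comm, smul_mul_assoc, smul_smul, ← sexp_add, R.α_Tm, R.α_Tm, sub_eq_add_neg]
      simp only [mul_assoc]
    rw [e1, e2, ← smul_sub, ← mul_sub]
    by_cases hij : i = j
    · subst hij
      have h0 := h.ef i i
      rw [if_pos rfl] at h0 ⊢
      have h1 : f i * e i - e i * f i = -(e i * f i - f i * e i) := by abel
      rw [sub_self, sexp_zero, one_smul, ← op_qQuot, qQuot_neg C i (h.commute_t _ _), h1, h0,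
        mul_neg]
    · have h0 := h.ef i j
      rw [if_neg hij] at h0 ⊢
      have h1 : f j * e i - e i * f j = -(e i * f j - f j * e i) := by abel
      rw [h1, h0, neg_zero, mul_zero, smul_zero, MulOpposite.op_zero]
  · rw [serreSum_eq_serreG, qSkew_one, serreG_op _ _ _ (sexp (-skewHalf P i j))
      (by rw [mul_comm, sexp_neg_mul])]
    rw [← neg_mul, ← neg_mul, hneg, hneg]
    -- Reversal has inverted the Serre parameter. Removing the toral factors multiplies it by `exp
    -- (ħ (P i j - P j i))`, the square of the original parameter, which restores it.
    rw [serreG_toral_eq_zero (r₀ := sexp (P i i)) (r₁ := sexp (P j i)) (r₂ := sexp (P i j))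
      (ρ := sexp (P i j - P j i)) ?_ ?_ ?_ ?_ ?_ ?_, MulOpposite.op_zero, smul_zero]
    · rw [mul_neg, h.e_mul_hexp, map_neg, R.α_Tp, neg_neg, neg_mul, smul_neg]
    · rw [mul_neg, h.e_mul_hexp, map_neg, R.α_Tp, neg_neg, neg_mul, smul_neg]
    · rw [mul_neg, h.e_mul_hexp, map_neg, R.α_Tp, neg_neg, neg_mul, smul_neg]
    · rw [neg_mul_neg, neg_mul_neg, (commute_hexp_hexp (h.commute_t _ _)).eq]
    · rw [← sexp_add]; congr 1; ring
    · rw [← sexp_add, ← two_mul_skewHalf]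
      have e1 : -skewHalf P i j + 2 * skewHalf P i j = skewHalf P i j := by ring
      rw [e1, h.serreG_e hij]
  · rw [serreSum_eq_serreG, qSkew_neg_one, serreG_op _ _ _ (sexp (skewHalf P i j))
      (by rw [sexp_neg_mul])]
    rw [h.f_mul_hexp, h.f_mul_hexp, ← smul_neg, ← smul_neg, ← neg_mul, ← neg_mul,
      ← smul_mul_assoc, ← smul_mul_assoc]
    rw [serreG_toral_eq_zero (r₀ := sexp (P i i)) (r₁ := sexp (P i j)) (r₂ := sexp (P j i))
      (ρ := sexp (P j i - P i j)) ?_ ?_ ?_ ?_ ?_ ?_, MulOpposite.op_zero, smul_zero]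
    · simp only [mul_smul_comm, mul_neg, h.f_mul_hexp, R.α_Tm, smul_mul_assoc, neg_mul, smul_neg]
    · simp only [mul_smul_comm, mul_neg, h.f_mul_hexp, R.α_Tm, smul_mul_assoc, neg_mul, smul_neg]
      rw [smul_comm]
    · simp only [mul_smul_comm, mul_neg, h.f_mul_hexp, R.α_Tm, smul_mul_assoc, neg_mul, smul_neg]
      rw [smul_comm]
    · rw [smul_mul_smul_comm, smul_mul_smul_comm, neg_mul_neg, neg_mul_neg,
        (commute_hexp_hexp (h.commute_t _ _)).eq, mul_comm]
    · rw [← sexp_add]; congr 1; ring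
    · rw [← sexp_add, ← neg_sub (P i j), ← two_mul_skewHalf]
      have e1 : skewHalf P i j + -(2 * skewHalf P i j) = -skewHalf P i j := by ring
      rw [e1, h.serreG_f hij]

end GenRel

/-- The map `x ↦ t x ⊗ 1 + 1 ⊗ t x`. -/
def primLin (t : 𝔥 →ₗ[k⟦X⟧] A) : 𝔥 →ₗ[k⟦X⟧] CTensor k A A :=
  ((tl k A A).toLinearMap + (tr k A A).toLinearMap) ∘ₗ t

theorem GenRel.coproduct_ctensor [CharZero k] (hP : C.IsCartanType P) {t : 𝔥 →ₗ[k⟦X⟧] A}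
    {e f : Fin n → A} (h : GenRel C R t e f) :
    GenRel C R (primLin t)
      (fun i => tl k A A (e i) + tl k A A (hexp k (t (R.Tp i))) * tr k A A (e i))
      (fun i => tl k A A (f i) * tr k A A (hexp k (-t (R.Tm i))) + tr k A A (f i)) := by
  have := GenRel.coproduct hP (h.map (tl k A A)) (h.map (tr k A A)) (by
    rintro (x | i | i) (y | j | j) <;> exact commute_tl_tr _ _)
  simp only [map_hexp, map_neg]
  exact this

end Relations

/-! ### The topological Hopf structure of the FoMpQUEA -/

namespace FoMpQUEA

variable {k : Type u} [Field k] {n : ℕ} {P : Matrix (Fin n) (Fin n) k⟦X⟧}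
  {𝔥 : Type v} [AddCommGroup 𝔥] [Module k⟦X⟧ 𝔥] (C : CartanDatum n) (R : Realization P 𝔥)

/-- The images of the generators under the counit satisfy the defining relations. -/
theorem genRel_counit : GenRel C R (0 : 𝔥 →ₗ[k⟦X⟧] k⟦X⟧) 0 0 where
  tt _ _ := by simp
  te _ _ := by simp
  tf _ _ := by simp
  ef i j := by simp [qQuot_zero]
  se i j _ := by simp [serreSum]
  sf i j _ := by simp [serreSum]

variable {C R} in
theorem T_neg (x : 𝔥) : -T C R x = T C R (-x) := ((tLin C R).map_neg x).symm

variable [CharZero k]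

/-- The antipode, as a homomorphism to the opposite algebra. -/
def antipodeAlg : FoMpQUEA C R →ₐ[k⟦X⟧] (FoMpQUEA C R)ᵐᵒᵖ := lift (genRel C R).antipode

variable {C R} in
/-- The topological Hopf algebra structure of the FoMpQUEA. -/
def hopf (hP : C.IsCartanType P) : HopfData k (FoMpQUEA C R) where
  comul := lift ((genRel C R).coproduct_ctensor hP)
  counit := lift (genRel_counit C R)
  antipode := (MulOpposite.opLinearEquiv k⟦X⟧).symm.toLinearMap ∘ₗ (antipodeAlg C R).toLinearMap

variable {C R} (hP : C.IsCartanType P)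

theorem comul_T (x : 𝔥) : (hopf (R := R) hP).comul (T C R x) =
    tl k _ _ (T C R x) + tr k _ _ (T C R x) :=
  lift_T ((genRel C R).coproduct_ctensor hP) x

theorem comul_E (i : Fin n) : (hopf (R := R) hP).comul (E C R i) =
    tl k _ _ (E C R i) + tl k _ _ (hexp k (T C R (R.Tp i))) * tr k _ _ (E C R i) :=
  lift_E ((genRel C R).coproduct_ctensor hP) i

theorem comul_F (i : Fin n) : (hopf (R := R) hP).comul (F C R i) =
    tl k _ _ (F C R i) * tr k _ _ (hexp k (-T C R (R.Tm i))) + tr k _ _ (F C R i) :=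
  lift_F ((genRel C R).coproduct_ctensor hP) i

theorem counit_T (x : 𝔥) : (hopf (R := R) hP).counit (T C R x) = 0 :=
  lift_T (genRel_counit C R) x

theorem counit_E (i : Fin n) : (hopf (R := R) hP).counit (E C R i) = 0 :=
  lift_E (genRel_counit C R) i

theorem counit_F (i : Fin n) : (hopf (R := R) hP).counit (F C R i) = 0 :=
  lift_F (genRel_counit C R) i

theorem antipode_eq (x : FoMpQUEA C R) :
    (hopf hP).antipode x = MulOpposite.unop (antipodeAlg C R x) := rfl

theorem antipode_T (x : 𝔥) : (hopf (R := R) hP).antipode (T C R x) = -T C R x :=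
  congrArg MulOpposite.unop (lift_T (genRel C R).antipode x)

theorem antipode_E (i : Fin n) : (hopf (R := R) hP).antipode (E C R i) =
    -(hexp k (-T C R (R.Tp i)) * E C R i) :=
  congrArg MulOpposite.unop (lift_E (genRel C R).antipode i)

theorem antipode_F (i : Fin n) : (hopf (R := R) hP).antipode (F C R i) =
    -(F C R i * hexp k (T C R (R.Tm i))) :=
  congrArg MulOpposite.unop (lift_F (genRel C R).antipode i)

theorem antipode_one : (hopf (R := R) hP).antipode 1 = 1 := by
  rw [antipode_eq, map_one, MulOpposite.unop_one]

theorem antipode_mul (x y : FoMpQUEA C R) :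
    (hopf hP).antipode (x * y) = (hopf hP).antipode y * (hopf hP).antipode x := by
  simp only [antipode_eq, map_mul, MulOpposite.unop_mul]

theorem antipode_hexp (x : FoMpQUEA C R) :
    (hopf hP).antipode (hexp k x) = hexp k ((hopf hP).antipode x) := by
  apply MulOpposite.op_injective
  rw [op_hexp, antipode_eq, antipode_eq, MulOpposite.op_unop, MulOpposite.op_unop, map_hexp]

theorem comul_hexp_T (x : 𝔥) : (hopf (R := R) hP).comul (hexp k (T C R x)) =
    tl k _ _ (hexp k (T C R x)) * tr k _ _ (hexp k (T C R x)) := by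
  rw [map_hexp, comul_T, hexp_add (commute_tl_tr _ _), map_hexp, map_hexp]

theorem comul_hexp_neg_T (x : 𝔥) : (hopf (R := R) hP).comul (hexp k (-T C R x)) =
    tl k _ _ (hexp k (-T C R x)) * tr k _ _ (hexp k (-T C R x)) := by
  rw [T_neg, comul_hexp_T]

/-- Both sides are homomorphisms of algebras into a complete algebra, so generators suffice. On `E
i` and `F i` the identity says that `exp (ħ T⁺ i)` and `exp (-ħ T⁻ i)` are grouplike. -/
theorem coassoc (x : FoMpQUEA C R) :
    HopfData.cassoc k _ ((hopf hP).comulLeft ((hopf hP).comul x)) =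
      (hopf hP).comulRight ((hopf hP).comul x) := by
  rw [HopfData.cassoc_eq, HopfData.comulLeft_eq, HopfData.comulRight_eq]
  refine DFunLike.congr_fun (F := FoMpQUEA C R →ₐ[k⟦X⟧] _)
    (f := (HopfData.cassocAlg k _).comp ((hopf hP).comulLeftAlg.comp (hopf hP).comul))
    (g := (hopf hP).comulRightAlg.comp (hopf hP).comul) ?_ x
  refine algHom_ext (fun x => ?_) (fun i => ?_) fun i => ?_
  · simp only [AlgHom.comp_apply, comul_T, map_add, HopfData.comulLeftAlg_tl,
      HopfData.comulLeftAlg_tr, HopfData.comulRightAlg_tl, HopfData.comulRightAlg_tr,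
      HopfData.cassocAlg_jl_tl, HopfData.cassocAlg_jl_tr, HopfData.cassocAlg_tr, add_assoc]
  · simp only [AlgHom.comp_apply, comul_E, map_add, map_mul, HopfData.comulLeftAlg_tl,
      HopfData.comulLeftAlg_tr, HopfData.comulRightAlg_tl, HopfData.comulRightAlg_tr,
      HopfData.cassocAlg_jl_tl, HopfData.cassocAlg_jl_tr, HopfData.cassocAlg_tr, add_assoc,
      comul_hexp_T, mul_add, mul_assoc]
  · simp only [AlgHom.comp_apply, comul_F, map_add, map_mul, HopfData.comulLeftAlg_tl,
      HopfData.comulLeftAlg_tr, HopfData.comulRightAlg_tl, HopfData.comulRightAlg_tr,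
      HopfData.cassocAlg_jl_tl, HopfData.cassocAlg_jl_tr, HopfData.cassocAlg_tr, add_assoc,
      comul_hexp_neg_T, add_mul, mul_assoc]

theorem counit_left (x : FoMpQUEA C R) : (hopf hP).counitLeft ((hopf hP).comul x) = x := by
  rw [HopfData.counitLeft_eq]
  refine DFunLike.congr_fun (F := FoMpQUEA C R →ₐ[k⟦X⟧] _)
    (f := (hopf hP).counitLeftAlg.comp (hopf hP).comul) (g := AlgHom.id k⟦X⟧ _) ?_ x
  refine algHom_ext (fun x => ?_) (fun i => ?_) fun i => ?_
  · simp only [AlgHom.comp_apply, comul_T, map_add, HopfData.counitLeftAlg_tl,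
      HopfData.counitLeftAlg_tr, counit_T, map_zero, zero_add, AlgHom.id_apply]
  · simp only [AlgHom.comp_apply, comul_E, map_add, map_mul, HopfData.counitLeftAlg_tl,
      HopfData.counitLeftAlg_tr, counit_E, counit_T, map_hexp, hexp_zero, map_zero,
      zero_add, one_mul, AlgHom.id_apply]
  · simp only [AlgHom.comp_apply, comul_F, map_add, map_mul, HopfData.counitLeftAlg_tl,
      HopfData.counitLeftAlg_tr, counit_F, map_zero, zero_add, zero_mul, AlgHom.id_apply]

theorem counit_right (x : FoMpQUEA C R) : (hopf hP).counitRight ((hopf hP).comul x) = x := by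
  rw [HopfData.counitRight_eq]
  refine DFunLike.congr_fun (F := FoMpQUEA C R →ₐ[k⟦X⟧] _)
    (f := (hopf hP).counitRightAlg.comp (hopf hP).comul) (g := AlgHom.id k⟦X⟧ _) ?_ x
  refine algHom_ext (fun x => ?_) (fun i => ?_) fun i => ?_
  · simp only [AlgHom.comp_apply, comul_T, map_add, HopfData.counitRightAlg_tl,
      HopfData.counitRightAlg_tr, counit_T, map_zero, add_zero, AlgHom.id_apply]
  · simp only [AlgHom.comp_apply, comul_E, map_add, map_mul, HopfData.counitRightAlg_tl,
      HopfData.counitRightAlg_tr, counit_E, map_zero, add_zero, mul_zero, AlgHom.id_apply]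
  · simp only [AlgHom.comp_apply, comul_F, map_add, map_mul, HopfData.counitRightAlg_tl,
      HopfData.counitRightAlg_tr, counit_F, counit_T, map_hexp, map_neg, neg_zero, hexp_zero,
      map_zero, add_zero, mul_one, AlgHom.id_apply]

/-- The two sides are only linear, so generators do not suffice directly: the identity is proved by
induction over the subalgebra they generate, with `antipodeLeft_comul_mul` for products, and
extended by density. -/
theorem antipode_left (x : FoMpQUEA C R) : (hopf hP).antipodeLeft ((hopf hP).comul x) =
    algebraMap k⟦X⟧ _ ((hopf hP).counit x) := by
  refine LinearMap.congr_fun (f := (hopf hP).antipodeLeft ∘ₗ (hopf hP).comul.toLinearMap)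
    (g := Algebra.linearMap k⟦X⟧ (FoMpQUEA C R) ∘ₗ (hopf hP).counit.toLinearMap) ?_ x
  refine linear_ext fun x hx => ?_
  simp only [LinearMap.comp_apply, AlgHom.toLinearMap_apply, Algebra.linearMap_apply]
  induction hx using Algebra.adjoin_induction with
  | mem x hx =>
    obtain ⟨g, rfl⟩ := hx
    cases g with
    | T x =>
      rw [comul_T, map_add, HopfData.antipodeLeft_tl, HopfData.antipodeLeft_tr _ (antipode_one hP), antipode_T, counit_T, map_zero,
        neg_add_cancel]
    | E i =>
      rw [comul_E, map_add, HopfData.antipodeLeft_tl, HopfData.antipodeLeft_tl_mul_tr, antipode_E, antipode_hexp,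
        antipode_T, counit_E, map_zero, neg_add_cancel]
    | F i =>
      rw [comul_F, map_add, HopfData.antipodeLeft_tr _ (antipode_one hP), HopfData.antipodeLeft_tl_mul_tr, antipode_F, counit_F,
        map_zero, neg_mul, mul_assoc, hexp_mul_neg_self, mul_one, neg_add_cancel]
  | algebraMap r => rw [AlgHom.commutes, AlgHom.commutes,
      HopfData.antipodeLeft_algebraMap _ (antipode_one hP)]; rfl
  | add x y _ _ hx hy => simp only [map_add, hx, hy]
  | mul x y _ _ hx hy =>
    exact HopfData.antipodeLeft_comul_mul _ (antipode_mul hP) (antipode_one hP) hx hy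

theorem antipode_right (x : FoMpQUEA C R) : (hopf hP).antipodeRight ((hopf hP).comul x) =
    algebraMap k⟦X⟧ _ ((hopf hP).counit x) := by
  refine LinearMap.congr_fun (f := (hopf hP).antipodeRight ∘ₗ (hopf hP).comul.toLinearMap)
    (g := Algebra.linearMap k⟦X⟧ (FoMpQUEA C R) ∘ₗ (hopf hP).counit.toLinearMap) ?_ x
  refine linear_ext fun x hx => ?_
  simp only [LinearMap.comp_apply, AlgHom.toLinearMap_apply, Algebra.linearMap_apply]
  induction hx using Algebra.adjoin_induction with
  | mem x hx =>
    obtain ⟨g, rfl⟩ := hx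
    cases g with
    | T x =>
      rw [comul_T, map_add, HopfData.antipodeRight_tl _ (antipode_one hP), HopfData.antipodeRight_tr, antipode_T, counit_T, map_zero,
        add_neg_cancel]
    | E i =>
      rw [comul_E, map_add, HopfData.antipodeRight_tl _ (antipode_one hP), HopfData.antipodeRight_tl_mul_tr, antipode_E, counit_E,
        map_zero, mul_neg, ← mul_assoc, hexp_mul_neg_self, one_mul, add_neg_cancel]
    | F i =>
      rw [comul_F, map_add, HopfData.antipodeRight_tr, HopfData.antipodeRight_tl_mul_tr, antipode_F, antipode_hexp,
        map_neg, antipode_T, neg_neg, counit_F, map_zero, add_neg_cancel]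
  | algebraMap r => rw [AlgHom.commutes, AlgHom.commutes,
      HopfData.antipodeRight_algebraMap _ (antipode_one hP)]; rfl
  | add x y _ _ hx hy => simp only [map_add, hx, hy]
  | mul x y _ _ hx hy =>
    exact HopfData.antipodeRight_comul_mul _ (antipode_mul hP) (antipode_one hP) hx hy

theorem isFoMpHopf : IsFoMpHopf C R (hopf hP) where
  isHopf :=
    { coassoc := coassoc hP
      counit_left := counit_left hP
      counit_right := counit_right hP
      antipode_left := antipode_left hP
      antipode_right := antipode_right hP }
  comul_T x := by rw [comul_T, map_add]; rfl
  comul_E i := by rw [comul_E, map_add, tl_mul_tr]; rfl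
  comul_F i := by rw [comul_F, map_add, tl_mul_tr]; rfl
  counit_T := counit_T hP
  counit_E := counit_E hP
  counit_F := counit_F hP
  antipode_T := antipode_T hP
  antipode_E := antipode_E hP
  antipode_F := antipode_F hP

end FoMpQUEA

/-! ### Shifts of realizations and the isomorphisms they induce -/

section Shift

variable {k : Type u} [Field k] {n : ℕ} {P P' : Matrix (Fin n) (Fin n) k⟦X⟧}
  {𝔥 : Type v} [AddCommGroup 𝔥] [Module k⟦X⟧ 𝔥] {𝔥' : Type w} [AddCommGroup 𝔥'] [Module k⟦X⟧ 𝔥']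

/-- An isomorphism of the underlying modules of two realizations that respects the roots and
shifts the coroots by `∓ 2 L i`. -/
structure ToralShift (R' : Realization P' 𝔥') (R : Realization P 𝔥) where
  g : 𝔥' ≃ₗ[k⟦X⟧] 𝔥
  L : Fin n → 𝔥
  α_g : ∀ j x, R.α j (g x) = R'.α j x
  g_Tp : ∀ i, g (R'.Tp i) = R.Tp i - (L i + L i)
  g_Tm : ∀ i, g (R'.Tm i) = R.Tm i + (L i + L i)
  skew : ∀ i j, R.α i (L j) = -R.α j (L i)

namespace ToralShift

variable {R' : Realization P' 𝔥'} {R : Realization P 𝔥} (s : ToralShift R' R)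

/-- The inverse shift. -/
def symm : ToralShift R R' where
  g := s.g.symm
  L i := -s.g.symm (s.L i)
  α_g j x := by rw [← s.α_g, LinearEquiv.apply_symm_apply]
  g_Tp i := by
    apply s.g.injective
    simp only [LinearEquiv.apply_symm_apply, map_sub, map_add, map_neg, s.g_Tp]
    abel
  g_Tm i := by
    apply s.g.injective
    simp only [LinearEquiv.apply_symm_apply, map_add, map_neg, s.g_Tm]
    abel
  skew i j := by
    rw [map_neg, map_neg, ← s.α_g, ← s.α_g, LinearEquiv.apply_symm_apply,
      LinearEquiv.apply_symm_apply, s.skew i j]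

theorem entry_eq (i j : Fin n) : P' i j = P i j + 2 * R.α i (s.L j) := by
  rw [← R'.α_Tp, ← s.α_g, s.g_Tp, map_sub, map_add, R.α_Tp, s.skew j i]
  ring

/-- Since `2` is a unit of `k⟦ħ⟧`, this holds in every module, including ones with `ħ`-torsion. -/
theorem eq_zero_of_eq_neg [CharZero k] {M : Type v'} [AddCommGroup M] [Module k⟦X⟧ M] {x : M}
    (h : x = -x) : x = 0 := by
  have h2 : (2 : k⟦X⟧) • x = 0 := by
    rw [two_smul]; nth_rewrite 1 [h]; exact neg_add_cancel x
  have h3 : (2 : k⟦X⟧) = PowerSeries.C (2 : k) := (map_ofNat _ 2).symm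
  have h4 := congrArg (fun y => PowerSeries.C (1 / 2 : k) • y) h2
  rw [h3] at h4
  simpa [smul_smul, ← map_mul] using h4

variable [CharZero k]

theorem α_L_self (i : Fin n) : R.α i (s.L i) = 0 :=
  eq_zero_of_eq_neg (k := k) (s.skew i i)

/-- The logarithm of the Serre parameter changes by twice `α i (L j)`; the toral factors on the
shifted generators must compensate exactly this. -/
theorem skewHalf_eq (i j : Fin n) :
    skewHalf P' i j = skewHalf P i j + 2 * R.α i (s.L j) := by
  refine mul_left_cancel₀ (two_ne_zero_powerSeries (k := k)) ?_
  rw [two_mul_skewHalf, mul_add, two_mul_skewHalf, s.entry_eq i j, s.entry_eq j i, s.skew j i]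
  ring

variable {C : CartanDatum n} {A : Type w'} [Ring A] [Algebra k⟦X⟧ A] [IsAdicComplete (hIdeal k) A]
  {t : 𝔥 →ₗ[k⟦X⟧] A} {e f : Fin n → A}

/-- Shifted generators satisfy the defining relations of the shifted realization. -/
theorem genRel (h : GenRel C R t e f) :
    GenRel C R' (t ∘ₗ s.g.toLinearMap) (fun i => hexp k (t (-s.L i)) * e i)
      (fun i => hexp k (t (-s.L i)) * f i) := by
  have ct : ∀ x y, Commute (t x) (hexp k (t y)) := fun x y =>
    (commute_hexp_left (h.commute_t _ _)).symm
  refine ⟨fun x y => h.tt _ _, fun x j => ?_, fun x j => ?_, fun i j => ?_, fun i j hij => ?_,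
    fun i j hij => ?_⟩
  · change t (s.g x) * _ - _ * t (s.g x) = _
    rw [← mul_assoc, (ct _ _).eq, mul_assoc, mul_assoc, ← mul_sub, h.te, s.α_g, mul_smul_comm]
  · change t (s.g x) * _ - _ * t (s.g x) = _
    rw [← mul_assoc, (ct _ _).eq, mul_assoc, mul_assoc, ← mul_sub, h.tf, s.α_g, mul_smul_comm]
  · have e1 : hexp k (t (-s.L i)) * e i * (hexp k (t (-s.L j)) * f j) =
        sexp (R.α i (s.L j)) • (hexp k (t (-s.L i)) * hexp k (t (-s.L j)) * (e i * f j)) := by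
      rw [mul_assoc, ← mul_assoc (e i), h.e_mul_hexp, smul_mul_assoc, mul_smul_comm, map_neg,
        neg_neg]
      simp only [mul_assoc]
    have e2 : hexp k (t (-s.L j)) * f j * (hexp k (t (-s.L i)) * e i) =
        sexp (R.α i (s.L j)) • (hexp k (t (-s.L i)) * hexp k (t (-s.L j)) * (f j * e i)) := by
      rw [mul_assoc, ← mul_assoc (f j), h.f_mul_hexp, smul_mul_assoc, mul_smul_comm, map_neg,
        s.skew i j, (commute_hexp_hexp (h.commute_t (-s.L i) (-s.L j))).eq]
      simp only [mul_assoc]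
    rw [e1, e2, ← smul_sub, ← mul_sub, h.ef]
    by_cases hij : i = j
    · subst hij
      simp only [if_true, s.α_L_self, sexp_zero, one_smul, LinearMap.comp_apply,
        LinearEquiv.coe_coe, s.g_Tp, s.g_Tm]
      -- The two factors combine to `exp (-2 ħ L i)`, which lowers the first exponent by `2 L i` and
      -- raises the second by the same: the shifted coroots.
      rw [← hexp_add (h.commute_t _ _), ← map_add, hexp_mul_qQuot C i (h.commute_t _ _)
        (h.commute_t _ _), ← map_add, ← map_sub]
      congr 2 <;> abel
    · simp only [if_neg hij, mul_zero, smul_zero]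
  · rw [serreSum_eq_serreG, qSkew_one]
    -- By skewness the ratio of `r₂` to `r₁` is `exp (-2 ħ α i (L j))`, which carries the parameter
    -- of `P'` back to that of `P`. For `F` all signs are reversed.
    refine serreG_toral_eq_zero (r₀ := sexp (R.α i (s.L i))) (r₁ := sexp (R.α i (s.L j)))
      (r₂ := sexp (R.α j (s.L i))) (ρ := sexp (-(2 * R.α i (s.L j)))) ?_ ?_ ?_
      (commute_hexp_hexp (h.commute_t _ _)).eq ?_ ?_
    · rw [h.e_mul_hexp, map_neg, neg_neg]
    · rw [h.e_mul_hexp, map_neg, neg_neg]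
    · rw [h.e_mul_hexp, map_neg, neg_neg]
    · rw [← sexp_add, s.skew j i]; congr 1; ring
    · rw [← sexp_add, s.skewHalf_eq, add_neg_cancel_right, h.serreG_e hij]
  · rw [serreSum_eq_serreG, qSkew_neg_one]
    refine serreG_toral_eq_zero (r₀ := sexp (-R.α i (s.L i))) (r₁ := sexp (-R.α i (s.L j)))
      (r₂ := sexp (-R.α j (s.L i))) (ρ := sexp (2 * R.α i (s.L j))) ?_ ?_ ?_
      (commute_hexp_hexp (h.commute_t _ _)).eq ?_ ?_
    · rw [h.f_mul_hexp, map_neg]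
    · rw [h.f_mul_hexp, map_neg]
    · rw [h.f_mul_hexp, map_neg]
    · rw [← sexp_add, s.skew j i]; congr 1; ring
    · rw [← sexp_add, s.skewHalf_eq, neg_add, neg_add_cancel_right, h.serreG_f hij]

variable (C)

/-- The homomorphism of FoMpQUEAs given by a shift. -/
def hom : FoMpQUEA C R' →ₐ[k⟦X⟧] FoMpQUEA C R := FoMpQUEA.lift (s.genRel (FoMpQUEA.genRel C R))

theorem hom_T (x : 𝔥') : s.hom C (FoMpQUEA.T C R' x) = FoMpQUEA.T C R (s.g x) :=
  FoMpQUEA.lift_T (s.genRel (FoMpQUEA.genRel C R)) x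

theorem hom_E (i : Fin n) : s.hom C (FoMpQUEA.E C R' i) =
    hexp k (FoMpQUEA.T C R (-s.L i)) * FoMpQUEA.E C R i :=
  FoMpQUEA.lift_E (s.genRel (FoMpQUEA.genRel C R)) i

theorem hom_F (i : Fin n) : s.hom C (FoMpQUEA.F C R' i) =
    hexp k (FoMpQUEA.T C R (-s.L i)) * FoMpQUEA.F C R i :=
  FoMpQUEA.lift_F (s.genRel (FoMpQUEA.genRel C R)) i

theorem hom_hexp_T_symm (x : 𝔥) :
    s.hom C (hexp k (FoMpQUEA.T C R' (s.symm.g x))) = hexp k (FoMpQUEA.T C R x) := by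
  rw [map_hexp, hom_T, symm, LinearEquiv.apply_symm_apply]

/-- The inverse shift has defect `-g⁻¹ (L i)`, so the composite rescales each generator by `exp (ħ L
i) exp (-ħ L i) = 1`. -/
theorem hom_comp_symm : (s.hom C).comp (s.symm.hom C) = AlgHom.id k⟦X⟧ (FoMpQUEA C R) := by
  have key : ∀ i, s.hom C (hexp k (FoMpQUEA.T C R' (-s.symm.L i))) =
      hexp k (FoMpQUEA.T C R (s.L i)) := fun i => by
    have : -s.symm.L i = s.symm.g (s.L i) := neg_neg _
    rw [this, hom_hexp_T_symm]
  have key2 : ∀ i, hexp k (FoMpQUEA.T C R (s.L i)) * hexp k (FoMpQUEA.T C R (-s.L i)) = 1 :=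
    fun i => by rw [← FoMpQUEA.T_neg, hexp_mul_neg_self]
  refine FoMpQUEA.algHom_ext (fun x => ?_) (fun i => ?_) fun i => ?_
  · rw [AlgHom.comp_apply, hom_T, hom_T, symm, LinearEquiv.apply_symm_apply, AlgHom.id_apply]
  · rw [AlgHom.comp_apply, hom_E, map_mul, key, hom_E, ← mul_assoc, key2, one_mul, AlgHom.id_apply]
  · rw [AlgHom.comp_apply, hom_F, map_mul, key, hom_F, ← mul_assoc, key2, one_mul, AlgHom.id_apply]

theorem symm_symm_hom : s.symm.symm.hom C = s.hom C := by
  refine FoMpQUEA.algHom_ext (fun x => ?_) (fun i => ?_) fun i => ?_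
  · rw [hom_T, hom_T]; rfl
  · rw [hom_E, hom_E]
    have : s.symm.symm.L i = s.L i := by simp [symm]
    rw [this]
  · rw [hom_F, hom_F]
    have : s.symm.symm.L i = s.L i := by simp [symm]
    rw [this]

/-- The isomorphism of FoMpQUEAs given by a shift. -/
def equiv : FoMpQUEA C R' ≃ₐ[k⟦X⟧] FoMpQUEA C R :=
  AlgEquiv.ofAlgHom (s.hom C) (s.symm.hom C) (s.hom_comp_symm C) (by
    have := s.symm.hom_comp_symm C
    rwa [s.symm_symm_hom] at this)

end ToralShift

end Shift

/-! ### Toral tensors and their contractions with roots -/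

section ToralExponent

variable {k : Type u} [Field k] {𝔥 : Type v} {τ : ℕ}

/-- The sum `∑ c g h • f₁ (b g) * f₂ (b h)`. -/
def torSum (c : Matrix (Fin τ) (Fin τ) k⟦X⟧) (b : Fin τ → 𝔥) {A : Type w} [Ring A]
    [Algebra k⟦X⟧ A] (f₁ f₂ : 𝔥 → A) : A :=
  ∑ g, ∑ h, c g h • (f₁ (b g) * f₂ (b h))

section

variable {c : Matrix (Fin τ) (Fin τ) k⟦X⟧} {b : Fin τ → 𝔥} {A : Type w} [Ring A] [Algebra k⟦X⟧ A]

theorem map_torSum {B : Type w'} [Ring B] [Algebra k⟦X⟧ B] (φ : A →ₐ[k⟦X⟧] B) (f₁ f₂ : 𝔥 → A) :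
    φ (torSum c b f₁ f₂) = torSum c b (fun x => φ (f₁ x)) (fun x => φ (f₂ x)) := by
  simp only [torSum, map_sum, map_smul, map_mul]

theorem commute_torSum {f₁ f₂ : 𝔥 → A} {y : A} (h1 : ∀ x, Commute (f₁ x) y)
    (h2 : ∀ x, Commute (f₂ x) y) : Commute (torSum c b f₁ f₂) y :=
  Commute.sum_left _ _ _ fun _ _ => Commute.sum_left _ _ _ fun _ _ =>
    Commute.smul_left ((h1 _).mul_left (h2 _)) _

theorem torSum_add_left (f₁ f₁' f₂ : 𝔥 → A) : torSum c b (fun x => f₁ x + f₁' x) f₂ =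
    torSum c b f₁ f₂ + torSum c b f₁' f₂ := by
  simp only [torSum, add_mul, smul_add, Finset.sum_add_distrib]

theorem torSum_add_right (f₁ f₂ f₂' : 𝔥 → A) : torSum c b f₁ (fun x => f₂ x + f₂' x) =
    torSum c b f₁ f₂ + torSum c b f₁ f₂' := by
  simp only [torSum, mul_add, smul_add, Finset.sum_add_distrib]

/-- Multiplying the two legs of a skew tensor of commuting elements gives `x = -x`. This is why the
element `v` of a toral twist is trivial. -/
theorem torSum_eq_zero [CharZero k] (hc : c.transpose = -c) {f : 𝔥 → A}
    (h : ∀ x y, Commute (f x) (f y)) : torSum c b f f = 0 := by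
  refine ToralShift.eq_zero_of_eq_neg (k := k) ?_
  nth_rewrite 1 [torSum]
  rw [Finset.sum_comm, torSum, ← Finset.sum_neg_distrib]
  refine Finset.sum_congr rfl fun g _ => ?_
  rw [← Finset.sum_neg_distrib]
  refine Finset.sum_congr rfl fun h' _ => ?_
  have : c h' g = -c g h' := congrFun (congrFun hc g) h'
  rw [this, neg_smul, (h _ _).eq]

end

variable [AddCommGroup 𝔥] [Module k⟦X⟧ 𝔥]

/-- The contraction `∑ c g h (l (b g)) b h`. -/
def contract (c : Matrix (Fin τ) (Fin τ) k⟦X⟧) (b : Fin τ → 𝔥) (l : Module.Dual k⟦X⟧ 𝔥) : 𝔥 :=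
  ∑ g, ∑ h, (c g h * l (b g)) • b h

variable {c : Matrix (Fin τ) (Fin τ) k⟦X⟧} {b : Fin τ → 𝔥}

/-- Contracting the other leg of a skew tensor changes the sign, hence the opposite signs in
`conj_tl` and `conj_tr`. -/
theorem contract_transpose (hc : c.transpose = -c) (l : Module.Dual k⟦X⟧ 𝔥) :
    ∑ g, ∑ h, (c g h * l (b h)) • b g = -contract c b l := by
  rw [Finset.sum_comm, contract, ← Finset.sum_neg_distrib]
  refine Finset.sum_congr rfl fun g _ => ?_
  rw [← Finset.sum_neg_distrib]
  refine Finset.sum_congr rfl fun h _ => ?_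
  have : c h g = -c g h := congrFun (congrFun hc g) h
  rw [this, neg_mul, neg_smul]

section

variable {A : Type w} [Ring A] [Algebra k⟦X⟧ A]

/-- Commuting a toral exponent past a weight vector for the first leg. -/
theorem torSum_mul_left {f₁ f₂ : 𝔥 →ₗ[k⟦X⟧] A} {y : A} {l : Module.Dual k⟦X⟧ 𝔥}
    (h1 : ∀ x, f₁ x * y = y * f₁ x + l x • y) (h2 : ∀ x, Commute (f₂ x) y) :
    torSum c b f₁ f₂ * y = y * (torSum c b f₁ f₂ + f₂ (contract c b l)) := by
  simp only [torSum, contract, map_sum, map_smul, Finset.sum_mul, Finset.mul_sum, mul_add,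
    ← Finset.sum_add_distrib]
  refine Finset.sum_congr rfl fun g _ => Finset.sum_congr rfl fun h _ => ?_
  rw [smul_mul_assoc, mul_assoc, (h2 _).eq, ← mul_assoc, h1, add_mul, smul_add, mul_smul_comm,
    mul_smul_comm, smul_mul_assoc, smul_smul, mul_assoc]

/-- Commuting a toral exponent past a weight vector for the second leg. -/
theorem torSum_mul_right (hc : c.transpose = -c) {f₁ f₂ : 𝔥 →ₗ[k⟦X⟧] A} {y : A}
    {l : Module.Dual k⟦X⟧ 𝔥}
    (h1 : ∀ x, Commute (f₁ x) y) (h2 : ∀ x, f₂ x * y = y * f₂ x + l x • y) :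
    torSum c b f₁ f₂ * y = y * (torSum c b f₁ f₂ + -f₁ (contract c b l)) := by
  rw [← map_neg, ← contract_transpose hc]
  simp only [torSum, map_sum, map_smul, Finset.sum_mul, Finset.mul_sum, mul_add,
    ← Finset.sum_add_distrib]
  refine Finset.sum_congr rfl fun g _ => Finset.sum_congr rfl fun h _ => ?_
  rw [smul_mul_assoc, mul_assoc, h2, mul_add, ← mul_assoc, (h1 _).eq, smul_add, mul_smul_comm,
    mul_smul_comm, mul_smul_comm, smul_smul, mul_assoc, (h1 _).eq]

end

end ToralExponent

/-! ### Twists by the exponential of a toral tensor -/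

section GenericTwist

variable {k : Type u} [Field k] {H : Type v} [Ring H] [Algebra k⟦X⟧ H]
  [IsAdicComplete (hIdeal k) H] (𝓗 : HopfData k H)

/-- As `m (id ⊗ S)` sees the last factor only through its image, it kills every positive power of
`z`; the constant term of the exponential is all that survives. -/
theorem HopfData.antipodeRight_hexp
    (hS : ∀ x y, 𝓗.antipode (x * y) = 𝓗.antipode y * 𝓗.antipode x) (h1 : 𝓗.antipode 1 = 1)
    {z : CTensor k H H} (hz : 𝓗.antipodeRight z = 0) : 𝓗.antipodeRight (hexp k z) = 1 := by
  have hn : ∀ n : ℕ, 𝓗.antipodeRight (z ^ (n + 1)) = 0 := fun n => by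
    rw [pow_succ, 𝓗.antipodeRight_mul_congr hS (w' := 0) (by rw [hz, map_zero]), mul_zero, map_zero]
  rw [hexp, map_hsum, hsum_succ]
  simp only [map_smul, hn, smul_zero, hsum_zero, add_zero]
  rw [pow_zero, Nat.factorial_zero, Nat.cast_one, inv_one, map_one, one_smul,
    ← map_one (tl k H H), 𝓗.antipodeRight_tl h1]

theorem HopfData.antipodeLeft_hexp
    (hS : ∀ x y, 𝓗.antipode (x * y) = 𝓗.antipode y * 𝓗.antipode x) (h1 : 𝓗.antipode 1 = 1)
    {z : CTensor k H H} (hz : 𝓗.antipodeLeft z = 0) : 𝓗.antipodeLeft (hexp k z) = 1 := by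
  have hn : ∀ n : ℕ, 𝓗.antipodeLeft (z ^ (n + 1)) = 0 := fun n => by
    rw [pow_succ', 𝓗.antipodeLeft_mul_congr hS (z' := 0) (by rw [hz, map_zero]), zero_mul, map_zero]
  rw [hexp, map_hsum, hsum_succ]
  simp only [map_smul, hn, smul_zero, hsum_zero, add_zero]
  rw [pow_zero, Nat.factorial_zero, Nat.cast_one, inv_one, map_one, one_smul,
    ← map_one (tr k H H), 𝓗.antipodeLeft_tr h1]

variable [CharZero k]

variable (k) in
/-- The exponential `exp (ħ z)` as a unit. -/
def hexpUnit {A : Type w} [Ring A] [Algebra k⟦X⟧ A] [IsAdicComplete (hIdeal k) A] (z : A) : Aˣ where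
  val := hexp k z
  inv := hexp k (-z)
  val_inv := hexp_mul_neg_self z
  inv_val := hexp_neg_mul_self z

theorem val_hexpUnit {A : Type w} [Ring A] [Algebra k⟦X⟧ A] [IsAdicComplete (hIdeal k) A]
    (z : A) : (hexpUnit k z).val = hexp k z := rfl

variable {𝔥 : Type w} {τ : ℕ} {c : Matrix (Fin τ) (Fin τ) k⟦X⟧} {b : Fin τ → 𝔥}

/-- With `f₁`, `f₂`, `f₃` the three legs, everything commutes, and both sides are the exponential of
`c₁₂ + c₁₃ + c₂₃`. -/
theorem hexp_torSum_cocycle {D : Type w'} [Ring D] [Algebra k⟦X⟧ D] [IsAdicComplete (hIdeal k) D]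
    {f₁ f₂ f₃ : 𝔥 → D} (h11 : ∀ x y, Commute (f₁ x) (f₁ y)) (h22 : ∀ x y, Commute (f₂ x) (f₂ y))
    (h12 : ∀ x y, Commute (f₁ x) (f₂ y)) (h13 : ∀ x y, Commute (f₁ x) (f₃ y))
    (h23 : ∀ x y, Commute (f₂ x) (f₃ y)) (h33 : ∀ x y, Commute (f₃ x) (f₃ y)) :
    hexp k (torSum c b f₁ f₂) * hexp k (torSum c b (fun x => f₁ x + f₂ x) f₃) =
      hexp k (torSum c b f₂ f₃) * hexp k (torSum c b f₁ (fun x => f₂ x + f₃ x)) := by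
  have h1 : ∀ y, Commute (torSum c b f₁ f₂) (f₁ y) := fun y =>
    commute_torSum (fun x => h11 x y) fun x => (h12 y x).symm
  have h2 : ∀ y, Commute (torSum c b f₁ f₂) (f₂ y) := fun y =>
    commute_torSum (fun x => h12 x y) fun x => h22 x y
  have h3 : ∀ y, Commute (torSum c b f₁ f₂) (f₃ y) := fun y =>
    commute_torSum (fun x => h13 x y) fun x => h23 x y
  have h4 : Commute (torSum c b f₁ f₂) (torSum c b f₁ f₃) :=
    (commute_torSum (fun x => (h1 x).symm) fun x => (h3 x).symm).symm
  have h5 : Commute (torSum c b f₁ f₂) (torSum c b f₂ f₃) :=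
    (commute_torSum (fun x => (h2 x).symm) fun x => (h3 x).symm).symm
  have h6 : ∀ y, Commute (torSum c b f₁ f₃) (f₂ y) := fun y =>
    commute_torSum (fun x => h12 x y) fun x => (h23 y x).symm
  have h7 : ∀ y, Commute (torSum c b f₁ f₃) (f₃ y) := fun y =>
    commute_torSum (fun x => h13 x y) fun x => h33 x y
  have h8 : Commute (torSum c b f₁ f₃) (torSum c b f₂ f₃) :=
    (commute_torSum (fun x => (h6 x).symm) fun x => (h7 x).symm).symm
  rw [torSum_add_left, torSum_add_right, ← hexp_add (h4.add_right h5),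
    ← hexp_add (h5.symm.add_right h8.symm)]
  congr 1
  abel

variable [AddCommGroup 𝔥] [Module k⟦X⟧ 𝔥] {t : 𝔥 →ₗ[k⟦X⟧] H}

/-- The exponent `∑ c g h • t (b g) ⊗ t (b h)` of a toral twist. -/
def torExp (c : Matrix (Fin τ) (Fin τ) k⟦X⟧) (b : Fin τ → 𝔥) (t : 𝔥 →ₗ[k⟦X⟧] H) : CTensor k H H :=
  torSum c b (fun x => tl k H H (t x)) (fun x => tr k H H (t x))

theorem isTwist_torExp (ht : ∀ x y, Commute (t x) (t y))
    (hcomul : ∀ x, 𝓗.comul (t x) = tl k H H (t x) + tr k H H (t x))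
    (hcounit : ∀ x, 𝓗.counit (t x) = 0) : 𝓗.IsTwist (hexpUnit k (torExp c b t)) := by
  refine ⟨?_, ?_, ?_⟩
  · rw [val_hexpUnit]
    rw [cmap_flip_one, cmap_mk_one, HopfData.cassoc_eq, HopfData.comulLeft_eq,
      HopfData.comulRight_eq, map_mul]
    simp only [map_hexp, torExp, map_torSum, HopfData.comulLeftAlg_tl,
      HopfData.comulLeftAlg_tr, HopfData.comulRightAlg_tl, HopfData.comulRightAlg_tr, hcomul,
      map_add, HopfData.cassocAlg_jl_tl, HopfData.cassocAlg_jl_tr, HopfData.cassocAlg_tr]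
    exact hexp_torSum_cocycle (fun x y => (ht x y).map _)
      (fun x y => ((ht x y).map (tl k H H)).map _) (fun x y => commute_tl_jr _ _)
      (fun x y => commute_tl_jr _ _) (fun x y => (commute_tl_tr _ _).map _)
      fun x y => ((ht x y).map (tr k H H)).map _
  · rw [val_hexpUnit, HopfData.counitLeft_eq, map_hexp, torExp, map_torSum]
    simp only [HopfData.counitLeftAlg_tl, hcounit, map_zero, torSum, zero_mul, smul_zero,
      Finset.sum_const_zero, hexp_zero]
  · rw [val_hexpUnit, HopfData.counitRight_eq, map_hexp, torExp, map_torSum]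
    simp only [HopfData.counitRightAlg_tr, hcounit, map_zero, torSum, mul_zero, smul_zero,
      Finset.sum_const_zero, hexp_zero]

theorem antipodeRight_torExp (hc : c.transpose = -c) (ht : ∀ x y, Commute (t x) (t y))
    (hS : ∀ x, 𝓗.antipode (t x) = -t x) : 𝓗.antipodeRight (torExp c b t) = 0 := by
  have h0 : torSum c b t t = 0 := torSum_eq_zero hc ht
  rw [torExp, torSum]
  simp only [map_sum, map_smul, HopfData.antipodeRight_tl_mul_tr, hS, mul_neg, smul_neg,
    Finset.sum_neg_distrib]
  rw [torSum] at h0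
  rw [h0, neg_zero]

theorem antipodeLeft_torExp (hc : c.transpose = -c) (ht : ∀ x y, Commute (t x) (t y))
    (hS : ∀ x, 𝓗.antipode (t x) = -t x) : 𝓗.antipodeLeft (torExp c b t) = 0 := by
  have h0 : torSum c b t t = 0 := torSum_eq_zero hc ht
  rw [torExp, torSum]
  simp only [map_sum, map_smul, HopfData.antipodeLeft_tl_mul_tr, hS, neg_mul, smul_neg,
    Finset.sum_neg_distrib]
  rw [torSum] at h0
  rw [h0, neg_zero]

/-- Conjugation of `y ⊗ 1` by a toral twist, for a weight vector `y`. -/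
theorem conj_tl {y : H} {l : Module.Dual k⟦X⟧ 𝔥} (ht : ∀ x y, Commute (t x) (t y))
    (hy : ∀ x, t x * y = y * t x + l x • y) :
    hexp k (torExp c b t) * tl k H H y * hexp k (-torExp c b t) =
      tl k H H y * tr k H H (hexp k (t (contract c b l))) := by
  have h1 := torSum_mul_left (c := c) (b := b) (f₁ := (tl k H H).toLinearMap ∘ₗ t)
    (f₂ := (tr k H H).toLinearMap ∘ₗ t) (y := tl k H H y) (l := l)
    (fun x => by
      have := congrArg (tl k H H) (hy x)
      simpa using this)
    fun x => (commute_tl_tr _ _).symm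
  have h2 : Commute (torExp c b t) (tr k H H (t (contract c b l))) :=
    commute_torSum (fun x => commute_tl_tr _ _) fun x => (ht _ _).map _
  have h3 : torExp c b t * tl k H H y =
      tl k H H y * (torExp c b t + tr k H H (t (contract c b l))) := h1
  rw [hexp_intertwine h3, add_comm, hexp_add h2.symm, mul_assoc, mul_assoc, hexp_mul_neg_self,
    mul_one, map_hexp]

/-- Conjugation of `1 ⊗ y` by a toral twist, for a weight vector `y`. -/
theorem conj_tr (hc : c.transpose = -c) {y : H} {l : Module.Dual k⟦X⟧ 𝔥}
    (ht : ∀ x y, Commute (t x) (t y)) (hy : ∀ x, t x * y = y * t x + l x • y) :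
    hexp k (torExp c b t) * tr k H H y * hexp k (-torExp c b t) =
      tr k H H y * tl k H H (hexp k (t (-contract c b l))) := by
  have h1 := torSum_mul_right (c := c) (b := b) hc (f₁ := (tl k H H).toLinearMap ∘ₗ t)
    (f₂ := (tr k H H).toLinearMap ∘ₗ t) (y := tr k H H y) (l := l)
    (fun x => commute_tl_tr _ _)
    (fun x => by
      have := congrArg (tr k H H) (hy x)
      simpa using this)
  have h2 : Commute (torExp c b t) (tl k H H (t (-contract c b l))) :=
    commute_torSum (fun x => (ht _ _).map _) fun x => (commute_tl_tr _ _).symm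
  have h3 : torExp c b t * tr k H H y =
      tr k H H y * (torExp c b t + tl k H H (t (-contract c b l))) := by
    rw [map_neg, map_neg]; exact h1
  rw [hexp_intertwine h3, add_comm, hexp_add h2.symm, mul_assoc, mul_assoc, hexp_mul_neg_self,
    mul_one, map_hexp]

end GenericTwist

/-! ### The toral twist of a FoMpQUEA on generators -/

section ToralTwist

variable {k : Type u} [Field k] {n : ℕ} {P P' : Matrix (Fin n) (Fin n) k⟦X⟧}
  {𝔥 : Type v} [AddCommGroup 𝔥] [Module k⟦X⟧ 𝔥] {𝔥' : Type w} [AddCommGroup 𝔥'] [Module k⟦X⟧ 𝔥']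
  {C : CartanDatum n} {R' : Realization P' 𝔥'} {R : Realization P 𝔥} {τ : ℕ}

open FoMpQUEA

variable {c : Matrix (Fin τ) (Fin τ) k⟦X⟧} (b : Fin τ → 𝔥)

theorem commute_torExp_tl (x : 𝔥) : Commute (torExp c b (tLin C R)) (tl k _ _ (T C R x)) :=
  commute_torSum (fun y => ((genRel C R).commute_t y x).map _) fun _ => (commute_tl_tr _ _).symm

theorem commute_torExp_tr (x : 𝔥) : Commute (torExp c b (tLin C R)) (tr k _ _ (T C R x)) :=
  commute_torSum (fun _ => commute_tl_tr _ _) fun y => ((genRel C R).commute_t y x).map _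

variable [CharZero k]

variable (C R) in
/-- The twist given by the exponent `∑ c g h • T (b g) ⊗ T (b h)`. -/
def torUnit (c : Matrix (Fin τ) (Fin τ) k⟦X⟧) (b : Fin τ → 𝔥) :
    (CTensor k (FoMpQUEA C R) (FoMpQUEA C R))ˣ :=
  hexpUnit k (torExp c b (tLin C R))

theorem val_torUnit (c : Matrix (Fin τ) (Fin τ) k⟦X⟧) (b : Fin τ → 𝔥) :
    (torUnit C R c b).val = hexp k (torExp c b (tLin C R)) := rfl

theorem toralTwist_eq (b : Module.Basis (Fin τ) k⟦X⟧ 𝔥) (Φ : Matrix (Fin τ) (Fin τ) k⟦X⟧) :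
    (torUnit C R (PowerSeries.C (2⁻¹ : k) • Φ) b).val = toralTwist C R b Φ := by
  rw [val_torUnit, toralTwist]
  congr 1
  simp only [torExp, torSum, tl_mul_tr, map_smul, map_sum, Matrix.smul_apply, Finset.smul_sum,
    smul_smul, smul_eq_mul, tLin_apply]

variable (hP : C.IsCartanType P)

theorem isTwist_torUnit : (hopf (R := R) hP).IsTwist (torUnit C R c b) :=
  isTwist_torExp _ (genRel C R).commute_t (comul_T hP) (counit_T hP)

theorem antipodeRight_torUnit (hc : c.transpose = -c) :
    (hopf (R := R) hP).antipodeRight (torUnit C R c b).val = 1 :=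
  HopfData.antipodeRight_hexp _ (antipode_mul hP) (antipode_one hP)
    (antipodeRight_torExp _ hc (genRel C R).commute_t (antipode_T hP))

theorem antipodeLeft_torUnit (hc : c.transpose = -c) :
    (hopf (R := R) hP).antipodeLeft (torUnit C R c b).inv = 1 :=
  HopfData.antipodeLeft_hexp _ (antipode_mul hP) (antipode_one hP) (by
    rw [map_neg, antipodeLeft_torExp _ hc (genRel C R).commute_t (antipode_T hP), neg_zero])

/-- For a skew exponent both `v` and its inverse are `1`. -/
theorem twist_antipode (hc : c.transpose = -c) (x : FoMpQUEA C R) :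
    ((hopf hP).twist (torUnit C R c b)).antipode x = (hopf hP).antipode x := by
  change (hopf hP).antipodeRight _ * ((hopf hP).antipode x * (hopf hP).antipodeLeft _) = _
  rw [antipodeRight_torUnit b hP hc, antipodeLeft_torUnit b hP hc, one_mul, mul_one]

theorem twist_comul (x : FoMpQUEA C R) :
    ((hopf hP).twist (torUnit C R c b)).comul x = hexp k (torExp c b (tLin C R)) *
      (hopf hP).comul x * hexp k (-torExp c b (tLin C R)) := rfl

theorem conj_of_commute {A : Type v'} [Ring A] [Algebra k⟦X⟧ A] [IsAdicComplete (hIdeal k) A]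
    {z y : A} (h : Commute z y) : hexp k z * y * hexp k (-z) = y := by
  rw [(commute_hexp_left h).eq, mul_assoc, hexp_mul_neg_self, mul_one]

theorem conj_mul {A : Type v'} [Ring A] [Algebra k⟦X⟧ A] [IsAdicComplete (hIdeal k) A]
    (z x y : A) : hexp k z * (x * y) * hexp k (-z) =
      (hexp k z * x * hexp k (-z)) * (hexp k z * y * hexp k (-z)) := by
  have : hexp k (-z) * (hexp k z * (y * hexp k (-z))) = y * hexp k (-z) := by
    rw [← mul_assoc, hexp_neg_mul_self, one_mul]
  simp only [mul_assoc, this]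

theorem twist_comul_T (x : 𝔥) : ((hopf (R := R) hP).twist (torUnit C R c b)).comul (T C R x) =
    tl k _ _ (T C R x) + tr k _ _ (T C R x) := by
  rw [twist_comul, comul_T]
  exact conj_of_commute ((commute_torExp_tl b x).add_right (commute_torExp_tr b x))

theorem twist_comul_hexp_T (x : 𝔥) :
    ((hopf (R := R) hP).twist (torUnit C R c b)).comul (hexp k (T C R x)) =
      tl k _ _ (hexp k (T C R x)) * tr k _ _ (hexp k (T C R x)) := by
  rw [map_hexp, twist_comul_T, hexp_add (commute_tl_tr _ _), map_hexp, map_hexp]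

/-- Write `L` for the contraction of `c` with `α i`. The exponential `exp (ħ T⁺ i) ⊗ 1` commutes
with the twist, so the result is `E i ⊗ exp (ħ L) + exp (ħ (T⁺ i - L)) ⊗ E i`. Multiplication by the
grouplike `exp (-ħ L)` then removes the factor from the first term. -/
theorem twist_comul_E (hc : c.transpose = -c) (i : Fin n) :
    ((hopf (R := R) hP).twist (torUnit C R c b)).comul (E C R i) =
      tl k _ _ (E C R i) * tr k _ _ (hexp k (T C R (contract c b (R.α i)))) +
      tl k _ _ (hexp k (T C R (R.Tp i))) *
        (tr k _ _ (E C R i) * tl k _ _ (hexp k (T C R (-contract c b (R.α i))))) := by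
  rw [twist_comul, comul_E, mul_add, add_mul, conj_mul]
  rw [conj_tl (genRel C R).commute_t ((genRel C R).t_mul_e · i),
    conj_tr hc (genRel C R).commute_t ((genRel C R).t_mul_e · i),
    map_hexp _ (T C R (R.Tp i)),
    conj_of_commute (commute_hexp_left (commute_torExp_tl b _).symm).symm]
  rfl

/-- The weight of `F i` is `-α i`, so both factors are inverted: `F i ⊗ exp (-ħ (L + T⁻ i)) + exp (ħ
L) ⊗ F i`. Multiplication by the same `exp (-ħ L)` now clears the second term. -/
theorem twist_comul_F (hc : c.transpose = -c) (i : Fin n) :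
    ((hopf (R := R) hP).twist (torUnit C R c b)).comul (F C R i) =
      tl k _ _ (F C R i) * tr k _ _ (hexp k (T C R (-contract c b (R.α i)))) *
        tr k _ _ (hexp k (T C R (-R.Tm i))) +
      tr k _ _ (F C R i) * tl k _ _ (hexp k (T C R (contract c b (R.α i)))) := by
  have hl : contract c b (-R.α i) = -contract c b (R.α i) := by
    simp only [contract, LinearMap.neg_apply, mul_neg, neg_smul, Finset.sum_neg_distrib]
  rw [twist_comul, comul_F, mul_add, add_mul, conj_mul, T_neg]
  rw [conj_tl (l := -R.α i) (genRel C R).commute_t ((genRel C R).t_mul_f · i),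
    conj_tr (l := -R.α i) hc (genRel C R).commute_t ((genRel C R).t_mul_f · i), map_hexp _ (T C R (-R.Tm i)),
    conj_of_commute (commute_hexp_left (commute_torExp_tr b _).symm).symm, hl, neg_neg]
  rfl

end ToralTwist

/-! ### Cancelling a grouplike factor on one leg -/

section Cancel

variable {k : Type u} [Field k] {H : Type v} [Ring H] [Algebra k⟦X⟧ H] {x x' : H}

theorem tl_mul_tr_mul_cancel (h : x * x' = 1) (y : H) :
    tl k H H x * tr k H H x * (tl k H H y * tr k H H x') = tl k H H x * tl k H H y := by
  rw [tl_mul_tr, tl_mul_tr, tl_apply, tl_apply, ← completion_of_mul, ← completion_of_mul,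
    Algebra.TensorProduct.tmul_mul_tmul, h, Algebra.TensorProduct.tmul_mul_tmul, mul_one]

theorem tl_mul_tr_mul_cancel' (h : x * x' = 1) (y : H) :
    tl k H H x * tr k H H x * (tr k H H y * tl k H H x') = tr k H H x * tr k H H y := by
  rw [tr_mul_tl, tl_mul_tr, tl_mul_tr, tr_apply, tr_apply, ← completion_of_mul,
    ← completion_of_mul, Algebra.TensorProduct.tmul_mul_tmul, h,
    Algebra.TensorProduct.tmul_mul_tmul, mul_one]

end Cancel

/-! ### The shift isomorphism as an isomorphism onto the twist deformation -/

section TwistIso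

variable {k : Type u} [Field k] [CharZero k] {n : ℕ} {P P' : Matrix (Fin n) (Fin n) k⟦X⟧}
  {𝔥 : Type v} [AddCommGroup 𝔥] [Module k⟦X⟧ 𝔥] {𝔥' : Type w} [AddCommGroup 𝔥'] [Module k⟦X⟧ 𝔥']
  {C : CartanDatum n} {R' : Realization P' 𝔥'} {R : Realization P 𝔥} {τ : ℕ}
  {c : Matrix (Fin τ) (Fin τ) k⟦X⟧} {b : Fin τ → 𝔥} (s : ToralShift R' R)

open FoMpQUEA

namespace ToralShift

theorem hexp_T_add (x y : 𝔥) :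
    hexp k (T C R x) * hexp k (T C R y) = hexp k (T C R (x + y)) := by
  rw [← tLin_apply, ← tLin_apply, ← tLin_apply, map_add,
    hexp_add ((FoMpQUEA.genRel C R).commute_t x y)]

theorem comul_E_aux (hP : C.IsCartanType P) (hP' : C.IsCartanType P') (hc : c.transpose = -c)
    (hL : ∀ i, s.L i = contract c b (R.α i)) (i : Fin n) :
    ctMap (s.hom C) (s.hom C) ((hopf (R := R') hP').comul (E C R' i)) =
      ((hopf hP).twist (torUnit C R c b)).comul (s.hom C (E C R' i)) := by
  rw [comul_E, hom_E, map_add, map_mul, ctMap_tl, ctMap_tl, ctMap_tr, hom_E, map_hexp, hom_T,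
    s.g_Tp, map_mul ((hopf hP).twist (torUnit C R c b)).comul, twist_comul_hexp_T, twist_comul_E b hP hc, ← hL, mul_add]
  have h1 : R.Tp i - (s.L i + s.L i) = -s.L i + (R.Tp i + -s.L i) := by abel
  rw [h1, ← hexp_T_add, ← hexp_T_add]
  simp only [map_mul]
  congr 1
  · exact (tl_mul_tr_mul_cancel (by rw [← T_neg, hexp_neg_mul_self]) _).symm
  · rw [tr_mul_tl (hexp k (T C R (-s.L i))) (E C R i)]
    simp only [mul_assoc]
    rw [← mul_assoc (tr k _ _ (hexp k (T C R (-s.L i)))) (tl k _ _ (hexp k (T C R (R.Tp i)))),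
      tr_mul_tl]
    simp only [mul_assoc]
    rw [← mul_assoc (tr k _ _ (hexp k (T C R (-s.L i)))) (tl k _ _ (hexp k (T C R (-s.L i)))),
      tr_mul_tl]
    simp only [mul_assoc]

theorem comul_F_aux (hP : C.IsCartanType P) (hP' : C.IsCartanType P') (hc : c.transpose = -c)
    (hL : ∀ i, s.L i = contract c b (R.α i)) (i : Fin n) :
    ctMap (s.hom C) (s.hom C) ((hopf (R := R') hP').comul (F C R' i)) =
      ((hopf hP).twist (torUnit C R c b)).comul (s.hom C (F C R' i)) := by
  rw [comul_F, hom_F, map_add, map_mul, ctMap_tl, ctMap_tr, ctMap_tr, hom_F, map_hexp, map_neg,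
    hom_T, s.g_Tm, map_mul ((hopf hP).twist (torUnit C R c b)).comul, twist_comul_hexp_T, twist_comul_F b hP hc, ← hL, mul_add, T_neg]
  have h1 : -(R.Tm i + (s.L i + s.L i)) = -s.L i + (-s.L i + -R.Tm i) := by abel
  rw [h1, ← hexp_T_add, ← hexp_T_add]
  simp only [map_mul]
  congr 1
  · simp only [mul_assoc]
    rw [← mul_assoc (tr k _ _ (hexp k (T C R (-s.L i)))) (tl k _ _ (F C R i)), tr_mul_tl]
    simp only [mul_assoc]
  · exact (tl_mul_tr_mul_cancel' (by rw [← T_neg, hexp_neg_mul_self]) _).symm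

theorem comul_hom (hP : C.IsCartanType P) (hP' : C.IsCartanType P') (hc : c.transpose = -c)
    (hL : ∀ i, s.L i = contract c b (R.α i)) (x : FoMpQUEA C R') :
    ctMap (s.hom C) (s.hom C) ((hopf hP').comul x) =
      ((hopf hP).twist (torUnit C R c b)).comul (s.hom C x) := by
  refine DFunLike.congr_fun (F := FoMpQUEA C R' →ₐ[k⟦X⟧] _)
    (f := (ctMap (s.hom C) (s.hom C)).comp (hopf hP').comul)
    (g := ((hopf hP).twist (torUnit C R c b)).comul.comp (s.hom C)) ?_ x
  refine algHom_ext (fun x => ?_) (fun i => s.comul_E_aux hP hP' hc hL i)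
    fun i => s.comul_F_aux hP hP' hc hL i
  rw [AlgHom.comp_apply, AlgHom.comp_apply, comul_T, hom_T, map_add, ctMap_tl, ctMap_tr, hom_T,
    twist_comul_T]

theorem counit_hom (hP : C.IsCartanType P) (hP' : C.IsCartanType P') (x : FoMpQUEA C R') :
    (hopf hP').counit x = (hopf hP).counit (s.hom C x) := by
  refine DFunLike.congr_fun (F := FoMpQUEA C R' →ₐ[k⟦X⟧] _)
    (f := (hopf hP').counit) (g := (hopf hP).counit.comp (s.hom C)) ?_ x
  refine algHom_ext (fun x => ?_) (fun i => ?_) fun i => ?_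
  · rw [AlgHom.comp_apply, hom_T, counit_T, counit_T]
  · rw [AlgHom.comp_apply, hom_E, map_mul, counit_E, counit_E, mul_zero]
  · rw [AlgHom.comp_apply, hom_F, map_mul, counit_F, counit_F, mul_zero]

/-- Composing with the passage to the opposite algebra makes both sides homomorphisms. On generators
the match rests on `α i (L i) = 0`: the exponential of `L i` commutes with `E i` and `F i`. -/
theorem antipode_hom (hP : C.IsCartanType P) (hP' : C.IsCartanType P') (x : FoMpQUEA C R') :
    s.hom C ((hopf hP').antipode x) = (hopf hP).antipode (s.hom C x) := by
  apply MulOpposite.op_injective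
  refine DFunLike.congr_fun (F := FoMpQUEA C R' →ₐ[k⟦X⟧] _)
    (f := (AlgHom.op (s.hom C)).comp (antipodeAlg C R'))
    (g := (antipodeAlg C R).comp (s.hom C)) ?_ x
  refine algHom_ext (fun x => ?_) (fun i => ?_) fun i => ?_
  · change MulOpposite.op (s.hom C ((hopf hP').antipode (T C R' x))) =
      MulOpposite.op ((hopf hP).antipode (s.hom C (T C R' x)))
    rw [antipode_T, map_neg, hom_T, antipode_T]
  · change MulOpposite.op (s.hom C ((hopf hP').antipode (E C R' i))) =
      MulOpposite.op ((hopf hP).antipode (s.hom C (E C R' i)))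
    have h := (FoMpQUEA.genRel C R).e_mul_hexp (s.L i) i
    rw [s.α_L_self, neg_zero, sexp_zero, one_smul] at h
    have h' : E C R i * hexp k (T C R (s.L i)) = hexp k (T C R (s.L i)) * E C R i := h
    rw [antipode_E, map_neg, map_mul, map_hexp, map_neg, hom_T, hom_E, antipode_mul, antipode_E,
      antipode_hexp, antipode_T, T_neg, T_neg, T_neg, neg_neg, neg_mul, mul_assoc _ (E C R i), h',
      ← mul_assoc, ← mul_assoc, hexp_T_add, hexp_T_add, s.g_Tp]
    have : -(R.Tp i - (s.L i + s.L i)) + -s.L i = -R.Tp i + s.L i := by abel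
    rw [this]
  · change MulOpposite.op (s.hom C ((hopf hP').antipode (F C R' i))) =
      MulOpposite.op ((hopf hP).antipode (s.hom C (F C R' i)))
    have h := (FoMpQUEA.genRel C R).f_mul_hexp (-s.L i) i
    rw [map_neg (R.α i), s.α_L_self, neg_zero, sexp_zero, one_smul] at h
    have h' : F C R i * hexp k (T C R (-s.L i)) = hexp k (T C R (-s.L i)) * F C R i := h
    rw [antipode_F, map_neg, map_mul, map_hexp, hom_T, hom_F, antipode_mul, antipode_F,
      antipode_hexp, antipode_T, T_neg, neg_neg, neg_mul, mul_assoc _ (hexp k _) (hexp k _), ← h',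
      mul_assoc, hexp_T_add, hexp_T_add, s.g_Tm]
    have : -s.L i + (R.Tm i + (s.L i + s.L i)) = R.Tm i + s.L i := by abel
    rw [this]

theorem isHopfIso (hP : C.IsCartanType P) (hP' : C.IsCartanType P') (hc : c.transpose = -c)
    (hL : ∀ i, s.L i = contract c b (R.α i)) :
    IsHopfIso (hopf hP') ((hopf hP).twist (torUnit C R c b)) (s.equiv C) where
  comul x := (cmapSq_eq_ctMap (s.hom C) _).trans (s.comul_hom hP hP' hc hL x)
  counit x := s.counit_hom hP hP' x
  antipode x := by
    rw [twist_antipode b hP hc]; exact s.antipode_hom hP hP' x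

theorem isToralTwist (hP : C.IsCartanType P) (hP' : C.IsCartanType P')
    {b : Module.Basis (Fin τ) k⟦X⟧ 𝔥} {Φ : Matrix (Fin τ) (Fin τ) k⟦X⟧} (hΦ : Φ.transpose = -Φ)
    (hL : ∀ i, s.L i = contract (PowerSeries.C (2⁻¹ : k) • Φ) b (R.α i)) :
    IsToralTwist C R' R b Φ :=
  ⟨hopf hP', hopf hP, torUnit C R (PowerSeries.C (2⁻¹ : k) • Φ) b, s.equiv C, isFoMpHopf hP',
    isFoMpHopf hP, toralTwist_eq b Φ, isTwist_torUnit b hP,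
    s.isHopfIso hP hP' (by rw [Matrix.transpose_smul, hΦ, smul_neg]) hL⟩

end ToralShift

end TwistIso

/-! ### Complete subalgebras as subalgebras closed under series -/

section ClosedSubalgebras

variable {k : Type u} [Field k] {H : Type v} [Ring H] [Algebra k⟦X⟧ H]
  [IsAdicComplete (hIdeal k) H]

/-- A subalgebra is closed under sums of series `∑ ħ ^ n a n`. -/
def HsumClosed (B : Subalgebra k⟦X⟧ H) : Prop :=
  ∀ a : ℕ → H, (∀ n, a n ∈ B) → hsum k a ∈ B

theorem hsum_eq_sum_add {M : Type v} [AddCommGroup M] [Module k⟦X⟧ M]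
    [IsAdicComplete (hIdeal k) M] (a : ℕ → M) (n : ℕ) :
    hsum k a = ∑ j ∈ Finset.range n, (PowerSeries.X : k⟦X⟧) ^ j • a j +
      (PowerSeries.X : k⟦X⟧) ^ n • hsum k fun j => a (j + n) := by
  induction n with
  | zero => simp
  | succ n ih =>
    rw [ih, hsum_succ (k := k) (fun j => a (j + n)), Finset.sum_range_succ, smul_add, smul_smul,
      ← pow_succ, zero_add, add_assoc]
    simp only [add_assoc, add_comm 1]

/-- The remainder of a series is `ħ ^ n` times another series with terms in `B`. It thus lies in `ħ
^ n B`, not merely in the intersection of `B` with `ħ ^ n H`. -/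
theorem HsumClosed.isAdicComplete {B : Subalgebra k⟦X⟧ H} (hB : HsumClosed B) :
    IsAdicComplete (hIdeal k) B := by
  have : IsHausdorff (hIdeal k) B := ⟨fun x hx => by
    refine Subtype.ext (eq_zero_of_forall_mem (k := k) fun n => ?_)
    have := hx n
    rw [SModEq.zero] at this
    exact map_mem_hpow B.val.toLinearMap this⟩
  refine isAdicComplete_of_series fun a => ⟨⟨hsum k fun n => (a n : H), hB _ fun n => (a n).2⟩,
    fun n => mem_hpow_iff.mpr ⟨⟨hsum k fun j => (a (j + n) : H), hB _ fun j => (a _).2⟩, ?_⟩⟩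
  apply Subtype.ext
  simp [hsum_eq_sum_add (k := k) (fun n => (a n : H)) n]

/-- The sum formed inside `B` is carried by the inclusion to the sum formed in `H`. -/
theorem hsumClosed_of_isAdicComplete {B : Subalgebra k⟦X⟧ H} (hB : IsAdicComplete (hIdeal k) B) :
    HsumClosed B := fun a ha => by
  have := map_hsum B.val.toLinearMap fun n => (⟨a n, ha n⟩ : B)
  change _ = hsum k a at this
  rw [← this]
  exact Subtype.property _

theorem HsumClosed.hexp_mem {B : Subalgebra k⟦X⟧ H} (hB : HsumClosed B) {x : H} (hx : x ∈ B) :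
    hexp k x ∈ B :=
  hB _ fun n => B.smul_mem (B.pow_mem hx n) _

theorem HsumClosed.comap {A : Type w} [Ring A] [Algebra k⟦X⟧ A] [IsAdicComplete (hIdeal k) A]
    {B : Subalgebra k⟦X⟧ H} (hB : HsumClosed B) (f : A →ₐ[k⟦X⟧] H) : HsumClosed (B.comap f) :=
  fun a ha => by
    change f.toLinearMap (hsum k a) ∈ B
    rw [map_hsum]
    exact hB _ ha

end ClosedSubalgebras

/-! ### The completed tensor square of a subalgebra -/

section TensorSquare

variable {k : Type u} [Field k] {H : Type v} [Ring H] [Algebra k⟦X⟧ H]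

section

variable {A : Type w} [Ring A] [Algebra k⟦X⟧ A]

/-- The image of the completed tensor square of a homomorphism. -/
def imgSq (f : A →ₐ[k⟦X⟧] H) : Subalgebra k⟦X⟧ (CTensor k H H) := (ctMap f f).range

variable (f : A →ₐ[k⟦X⟧] H)

theorem mem_imgSq_iff {z : CTensor k H H} :
    z ∈ imgSq f ↔ ∃ δ : CTensor k A A, cmapSq f.toLinearMap δ = z := by
  simp only [cmapSq_eq_ctMap, imgSq, AlgHom.mem_range]

/-- Preimages of the terms are chosen one by one and summed in the complete source; no injectivity
is needed. -/
theorem hsumClosed_imgSq : HsumClosed (imgSq f) := fun a ha => by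
  choose δ hδ using ha
  refine ⟨hsum k δ, ?_⟩
  have := map_hsum (ctMap f f).toLinearMap δ
  exact this.trans (congrArg (hsum k) (funext hδ))

theorem tl_mem_imgSq (x : A) : tl k H H (f x) ∈ imgSq f := ⟨tl k A A x, ctMap_tl _ _ _⟩

theorem tr_mem_imgSq (x : A) : tr k H H (f x) ∈ imgSq f := ⟨tr k A A x, ctMap_tr _ _ _⟩

end

/-- The image of the completed tensor square of a subalgebra. -/
def sqRange (B : Subalgebra k⟦X⟧ H) : Subalgebra k⟦X⟧ (CTensor k H H) := imgSq B.val

variable {B : Subalgebra k⟦X⟧ H}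

theorem memSq_iff {z : CTensor k H H} : MemSq B z ↔ z ∈ sqRange B := (mem_imgSq_iff B.val).symm

variable (B) in
theorem hsumClosed_sqRange : HsumClosed (sqRange B) := hsumClosed_imgSq B.val

theorem tl_mem_sqRange {x : H} (hx : x ∈ B) : tl k H H x ∈ sqRange B :=
  tl_mem_imgSq B.val ⟨x, hx⟩

theorem tr_mem_sqRange {x : H} (hx : x ∈ B) : tr k H H x ∈ sqRange B :=
  tr_mem_imgSq B.val ⟨x, hx⟩

theorem memSq_primitive {x : H} (hx : x ∈ B) : MemSq B (tl k H H x + tr k H H x) :=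
  memSq_iff.mpr (add_mem (tl_mem_sqRange hx) (tr_mem_sqRange hx))

theorem memSq_skewPrimitive_left {x g : H} (hx : x ∈ B) (hg : g ∈ B) :
    MemSq B (tl k H H x + tl k H H g * tr k H H x) :=
  memSq_iff.mpr (add_mem (tl_mem_sqRange hx) (mul_mem (tl_mem_sqRange hg) (tr_mem_sqRange hx)))

theorem memSq_skewPrimitive_right {x g : H} (hx : x ∈ B) (hg : g ∈ B) :
    MemSq B (tl k H H x * tr k H H g + tr k H H x) :=
  memSq_iff.mpr (add_mem (mul_mem (tl_mem_sqRange hx) (tr_mem_sqRange hg)) (tr_mem_sqRange hx))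

theorem MemSq.mul {x y : CTensor k H H} (hx : MemSq B x) (hy : MemSq B y) : MemSq B (x * y) :=
  memSq_iff.mpr (mul_mem (memSq_iff.mp hx) (memSq_iff.mp hy))

theorem MemSq.hexp {x : CTensor k H H} (hx : MemSq B x) : MemSq B (FoMp.hexp k x) :=
  memSq_iff.mpr ((hsumClosed_sqRange B).hexp_mem (memSq_iff.mp hx))

theorem MemSq.neg {x : CTensor k H H} (hx : MemSq B x) : MemSq B (-x) :=
  memSq_iff.mpr (neg_mem (memSq_iff.mp hx))

theorem memSq_torExp {𝔥 : Type w} [AddCommGroup 𝔥] [Module k⟦X⟧ 𝔥] {τ : ℕ}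
    {t : 𝔥 →ₗ[k⟦X⟧] H} (ht : ∀ x, t x ∈ B) (c : Matrix (Fin τ) (Fin τ) k⟦X⟧) (b : Fin τ → 𝔥) :
    MemSq B (torExp c b t) := by
  rw [torExp, torSum]
  exact memSq_iff.mpr (sum_mem fun g _ => sum_mem fun h _ => Subalgebra.smul_mem _
    (mul_mem (tl_mem_sqRange (ht (b g))) (tr_mem_sqRange (ht (b h)))) _)

theorem mem_comap_comul {𝓗 : HopfData k H} {x : H} (h : MemSq B (𝓗.comul x)) :
    x ∈ (sqRange B).comap 𝓗.comul := memSq_iff.mp h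

/-- If the coproducts of generators of a subalgebra lie in its completed tensor square, so do all
coproducts. -/
theorem comul_mem_of_le {𝓗 : HopfData k H} {D : Subalgebra k⟦X⟧ H}
    (h : D ≤ (sqRange B).comap 𝓗.comul) {x : H} (hx : x ∈ D) : MemSq B (𝓗.comul x) :=
  memSq_iff.mpr (h hx)

/-- Two homomorphisms out of a completed tensor product that agree on both legs agree everywhere.
The coproduct condition for a restricted isomorphism is thereby checked for every preimage `δ` at
once. -/
theorem cmapSq_cmapSq_of_comp_eq {A : Type v} [Ring A] [Algebra k⟦X⟧ A] {A' : Type w'} [Ring A']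
    [Algebra k⟦X⟧ A'] {H' : Type w'} [Ring H'] [Algebra k⟦X⟧ H'] {f : A →ₐ[k⟦X⟧] H}
    {f' : A' →ₐ[k⟦X⟧] H'} {e : A' →ₐ[k⟦X⟧] A} {g : H' →ₐ[k⟦X⟧] H} (h : ∀ x, f (e x) = g (f' x))
    (δ : CTensor k A' A') :
    cmapSq f.toLinearMap (cmapSq e.toLinearMap δ) = ctMap g g (cmapSq f'.toLinearMap δ) := by
  rw [cmapSq_eq_ctMap, cmapSq_eq_ctMap, cmapSq_eq_ctMap]
  refine AlgHom.congr_fun (φ₁ := (ctMap f f).comp (ctMap e e))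
    (φ₂ := (ctMap g g).comp (ctMap f' f')) ?_ δ
  refine ct_algHom_ext (fun x => ?_) fun y => ?_
  · simp only [AlgHom.comp_apply, ctMap_tl, h]
  · simp only [AlgHom.comp_apply, ctMap_tr, h]

end TensorSquare

/-! ### The Borel subalgebras -/

section Borel

variable {k : Type u} [Field k] {n : ℕ} {P P' : Matrix (Fin n) (Fin n) k⟦X⟧}
  {𝔥 : Type v} [AddCommGroup 𝔥] [Module k⟦X⟧ 𝔥] {𝔥' : Type w} [AddCommGroup 𝔥'] [Module k⟦X⟧ 𝔥']
  {C : CartanDatum n} {R' : Realization P' 𝔥'} {R : Realization P 𝔥} {τ : ℕ}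

open FoMpQUEA

theorem hsumClosed_borel (σ : BorelSign) : HsumClosed (borel C R σ) := fun a ha => by
  rw [borel, Algebra.mem_sInf]
  exact fun B hB => hsumClosed_of_isAdicComplete hB.2 a fun n => Algebra.mem_sInf.mp (ha n) B hB

/-- The induction principle for the Borel subalgebra: a property is checked on generators, provided
it defines a subalgebra closed under series. -/
theorem borel_le {σ : BorelSign} {B : Subalgebra k⟦X⟧ (FoMpQUEA C R)} (hB : HsumClosed B)
    (h : borelGen C R σ ⊆ B) : borel C R σ ≤ B :=
  sInf_le ⟨h, hB.isAdicComplete⟩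

theorem borelGen_subset (σ : BorelSign) : borelGen C R σ ⊆ borel C R σ := fun x hx => by
  exact Algebra.mem_sInf.mpr fun B hB => hB.1 hx

theorem T_mem_borel (σ : BorelSign) (x : 𝔥) : T C R x ∈ borel C R σ := by
  apply borelGen_subset
  cases σ <;> exact Or.inl ⟨x, rfl⟩

theorem hexp_T_mem_borel (σ : BorelSign) (x : 𝔥) : hexp k (T C R x) ∈ borel C R σ :=
  (hsumClosed_borel σ).hexp_mem (T_mem_borel σ x)

theorem E_mem_borel (i : Fin n) : E C R i ∈ borel C R .plus :=
  borelGen_subset _ (Or.inr ⟨i, rfl⟩)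

theorem F_mem_borel (i : Fin n) : F C R i ∈ borel C R .minus :=
  borelGen_subset _ (Or.inr ⟨i, rfl⟩)

theorem borel_le_of_gen {σ : BorelSign} {B : Subalgebra k⟦X⟧ (FoMpQUEA C R)} (hB : HsumClosed B)
    (hT : ∀ x, T C R x ∈ B) (hE : σ = .plus → ∀ i, E C R i ∈ B)
    (hF : σ = .minus → ∀ i, F C R i ∈ B) : borel C R σ ≤ B := by
  refine borel_le hB ?_
  cases σ
  · rintro _ (⟨x, rfl⟩ | ⟨i, rfl⟩)
    · exact hT x
    · exact hE rfl i
  · rintro _ (⟨x, rfl⟩ | ⟨i, rfl⟩)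
    · exact hT x
    · exact hF rfl i

variable [CharZero k]

theorem isHopfSubalgebra_borel (hP : C.IsCartanType P) (σ : BorelSign) :
    IsHopfSubalgebra (hopf hP) (borel C R σ) where
  comul x hx := by
    have hcl : HsumClosed ((sqRange (borel C R σ)).comap (hopf hP).comul) :=
      (hsumClosed_sqRange (borel C R σ)).comap (hopf hP).comul
    refine comul_mem_of_le (borel_le_of_gen (B := (sqRange (borel C R σ)).comap (hopf hP).comul)
      hcl (fun x => ?_) ?_ ?_) hx
    · refine mem_comap_comul ?_
      rw [comul_T]
      exact memSq_primitive (T_mem_borel σ x)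
    · rintro rfl i
      refine mem_comap_comul ?_
      rw [comul_E]
      exact memSq_skewPrimitive_left (E_mem_borel i) (hexp_T_mem_borel _ _)
    · rintro rfl i
      refine mem_comap_comul ?_
      rw [comul_F, T_neg]
      exact memSq_skewPrimitive_right (F_mem_borel i) (hexp_T_mem_borel _ _)
  antipode x hx := by
    -- The antipode reverses products, so the elements sent into the Borel subalgebra are obtained
    -- as a subalgebra by pulling back its opposite.
    refine borel_le_of_gen (B := (borel C R σ).op.comap (antipodeAlg C R)) (fun a ha => ?_)
      (fun x => ?_) ?_ ?_ hx
    · change (hopf hP).antipode (hsum k a) ∈ borel C R σ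
      rw [map_hsum]
      exact hsumClosed_borel σ _ ha
    · change (hopf hP).antipode (T C R x) ∈ borel C R σ
      rw [antipode_T]
      exact neg_mem (T_mem_borel σ x)
    · rintro rfl i
      change (hopf hP).antipode (E C R i) ∈ borel C R .plus
      rw [antipode_E, T_neg]
      exact neg_mem (mul_mem (hexp_T_mem_borel _ _) (E_mem_borel i))
    · rintro rfl i
      change (hopf hP).antipode (F C R i) ∈ borel C R .minus
      rw [antipode_F]
      exact neg_mem (mul_mem (F_mem_borel i) (hexp_T_mem_borel _ _))

theorem memSq_val_torUnit (c : Matrix (Fin τ) (Fin τ) k⟦X⟧) (b : Fin τ → 𝔥) (σ : BorelSign) :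
    MemSq (borel C R σ) (torUnit C R c b).val :=
  (memSq_torExp (t := tLin C R) (T_mem_borel σ) c b).hexp

theorem memSq_inv_torUnit (c : Matrix (Fin τ) (Fin τ) k⟦X⟧) (b : Fin τ → 𝔥) (σ : BorelSign) :
    MemSq (borel C R σ) (torUnit C R c b).inv :=
  (memSq_torExp (t := tLin C R) (T_mem_borel σ) c b).neg.hexp

theorem isHopfSubalgebra_twist (hP : C.IsCartanType P) {c : Matrix (Fin τ) (Fin τ) k⟦X⟧}
    (hc : c.transpose = -c) (b : Fin τ → 𝔥) (σ : BorelSign) :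
    IsHopfSubalgebra ((hopf hP).twist (torUnit C R c b)) (borel C R σ) where
  comul x hx := ((memSq_val_torUnit c b σ).mul
    ((isHopfSubalgebra_borel hP σ).comul x hx)).mul (memSq_inv_torUnit c b σ)
  antipode x hx := by
    rw [twist_antipode b hP hc]
    exact (isHopfSubalgebra_borel hP σ).antipode x hx

namespace ToralShift

variable (s : ToralShift R' R)

theorem hom_mem_borel (σ : BorelSign) {x : FoMpQUEA C R'} (hx : x ∈ borel C R' σ) :
    s.hom C x ∈ borel C R σ := by
  refine borel_le_of_gen (B := (borel C R σ).comap (s.hom C)) ((hsumClosed_borel σ).comap _)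
    (fun x => ?_) ?_ ?_ hx
  · rw [Subalgebra.mem_comap, hom_T]
    exact T_mem_borel σ _
  · rintro rfl i
    rw [Subalgebra.mem_comap, hom_E]
    exact mul_mem (hexp_T_mem_borel _ _) (E_mem_borel i)
  · rintro rfl i
    rw [Subalgebra.mem_comap, hom_F]
    exact mul_mem (hexp_T_mem_borel _ _) (F_mem_borel i)

variable (C) in
/-- The restriction of the isomorphism given by a shift to the Borel subalgebras. -/
def borelEquiv (σ : BorelSign) : borel C R' σ ≃ₐ[k⟦X⟧] borel C R σ :=
  AlgEquiv.ofAlgHom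
    (((s.hom C).comp (borel C R' σ).val).codRestrict _ fun x => s.hom_mem_borel σ x.2)
    (((s.symm.hom C).comp (borel C R σ).val).codRestrict _ fun x => s.symm.hom_mem_borel σ x.2)
    (AlgHom.ext fun x => Subtype.ext ((s.equiv C).apply_symm_apply (x : FoMpQUEA C R)))
    (AlgHom.ext fun x => Subtype.ext ((s.equiv C).symm_apply_apply (x : FoMpQUEA C R')))

theorem coe_borelEquiv (σ : BorelSign) (x : borel C R' σ) :
    (s.borelEquiv C σ x : FoMpQUEA C R) = s.hom C x := rfl

theorem isBorelToralTwist (hP : C.IsCartanType P) (hP' : C.IsCartanType P')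
    {b : Module.Basis (Fin τ) k⟦X⟧ 𝔥} {Φ : Matrix (Fin τ) (Fin τ) k⟦X⟧} (hΦ : Φ.transpose = -Φ)
    (hL : ∀ i, s.L i = contract (PowerSeries.C (2⁻¹ : k) • Φ) b (R.α i)) (σ : BorelSign) :
    IsBorelToralTwist C σ R' R b Φ := by
  have hc : (PowerSeries.C (2⁻¹ : k) • Φ).transpose = -(PowerSeries.C (2⁻¹ : k) • Φ) := by
    rw [Matrix.transpose_smul, hΦ, smul_neg]
  refine ⟨hopf hP', hopf hP, torUnit C R (PowerSeries.C (2⁻¹ : k) • Φ) b, s.borelEquiv C σ,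
    isFoMpHopf hP', isFoMpHopf hP, toralTwist_eq b Φ, isTwist_torUnit b hP,
    memSq_val_torUnit _ _ σ, memSq_inv_torUnit _ _ σ,
    isHopfSubalgebra_borel hP σ, isHopfSubalgebra_borel hP' σ, isHopfSubalgebra_twist hP hc b σ,
    fun x δ hδ => ?_, fun x => s.counit_hom hP hP' x, fun x y hxy => ?_⟩
  · refine (cmapSq_cmapSq_of_comp_eq (f := (borel C R σ).val) (f' := (borel C R' σ).val)
      (e := (s.borelEquiv C σ).toAlgHom) (g := s.hom C) (fun x => s.coe_borelEquiv σ x) δ).trans ?_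
    rw [hδ, s.comul_hom hP hP' hc hL, coe_borelEquiv]
  · rw [coe_borelEquiv, ← hxy, s.antipode_hom hP hP', twist_antipode _ hP hc, coe_borelEquiv]

end ToralShift

end Borel

/-! ### Linear algebra over `k⟦ħ⟧` from linear algebra modulo `ħ` -/

section LinearAlgebra

variable {k : Type u} [Field k]

theorem mem_hIdeal_iff {x : k⟦X⟧} : x ∈ hIdeal k ↔ PowerSeries.constantCoeff x = 0 := by
  rw [hIdeal, Ideal.mem_span_singleton, PowerSeries.X_dvd_iff]

/-- A family that is linearly independent modulo `ħ` in a free module of finite rank spans a direct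
summand. -/
theorem LinIndepModH.exists_leftInverse {ι : Type w} [Fintype ι] [DecidableEq ι] {M : Type v}
    [AddCommGroup M] [Module k⟦X⟧ M] [Module.Free k⟦X⟧ M] [Module.Finite k⟦X⟧ M] {x : ι → M}
    (hx : LinIndepModH k x) : ∃ l : M →ₗ[k⟦X⟧] ι → k⟦X⟧, ∀ i, l (x i) = Pi.single i 1 := by
  let b := Module.Free.chooseBasis k⟦X⟧ M
  let κ := Module.Free.ChooseBasisIndex k⟦X⟧ M
  let xb : ι → κ → k := fun i g => PowerSeries.constantCoeff (b.repr (x i) g)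
  -- Independence modulo `ħ` becomes independence over `k` of the constant terms of the coordinates,
  -- by lifting coefficients to constant power series.
  have hli : LinearIndependent k xb := by
    rw [Fintype.linearIndependent_iff]
    intro c hc i
    have h1 : ∑ i, PowerSeries.C (c i) • x i ∈ (hIdeal k • ⊤ : Submodule k⟦X⟧ M) := by
      rw [← b.sum_repr (∑ i, PowerSeries.C (c i) • x i)]
      refine sum_mem fun g _ => Submodule.smul_mem_smul (mem_hIdeal_iff.mpr ?_) trivial
      simpa [xb] using congrFun hc g
    have h2 := Fintype.linearIndependent_iff.mp hx
      (fun i => Ideal.Quotient.mk (hIdeal k) (PowerSeries.C (c i))) (by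
        have h3 := (Submodule.Quotient.mk_eq_zero _).mpr h1
        rw [← Submodule.mkQ_apply, map_sum] at h3
        exact h3) i
    rw [Ideal.Quotient.eq_zero_iff_mem, mem_hIdeal_iff] at h2
    simpa using h2
  obtain ⟨lb, hlb⟩ := (Fintype.linearCombination k xb).exists_leftInverse_of_injective
    (LinearMap.ker_eq_bot.mpr (LinearIndependent.fintypeLinearCombination_injective hli))
  have hlb' : ∀ i, lb (xb i) = Pi.single i 1 := fun i => by
    have := LinearMap.congr_fun hlb (Pi.single i 1)
    rwa [LinearMap.comp_apply, Fintype.linearCombination_apply_single, one_smul] at this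
  -- A left inverse over `k`, lifted with constant entries, inverts `x` only modulo `ħ`. The matrix
  -- `N` of the composite has constant term `1`, so it is invertible, and multiplying by its inverse
  -- corrects `l₀`.
  let l₀ : M →ₗ[k⟦X⟧] ι → k⟦X⟧ := b.constr k⟦X⟧ fun g i => PowerSeries.C (lb (Pi.single g 1) i)
  let N : Matrix ι ι k⟦X⟧ := Matrix.of fun i j => l₀ (x j) i
  have hN : (PowerSeries.constantCoeff (R := k)).mapMatrix N = 1 := by
    ext i j
    have h1 : PowerSeries.constantCoeff (l₀ (x j) i) = lb (xb j) i := by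
      conv_rhs => rw [← Finset.univ_sum_single (xb j), map_sum]
      simp only [l₀, Module.Basis.constr_apply_fintype, Finset.sum_apply, Pi.smul_apply,
        smul_eq_mul, map_sum, map_mul, PowerSeries.constantCoeff_C]
      refine Finset.sum_congr rfl fun g _ => ?_
      have : (Pi.single g (xb j g) : κ → k) = xb j g • Pi.single g 1 := by
        rw [← Pi.single_smul, smul_eq_mul, mul_one]
      rw [this, map_smul, Pi.smul_apply, smul_eq_mul]
      rfl
    rw [RingHom.mapMatrix_apply, Matrix.map_apply]
    change PowerSeries.constantCoeff (l₀ (x j) i) = _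
    rw [h1, hlb', Matrix.one_apply, Pi.single_apply]
  have hdet : IsUnit N.det := by
    rw [PowerSeries.isUnit_iff_constantCoeff, RingHom.map_det, hN, Matrix.det_one]
    exact isUnit_one
  refine ⟨N⁻¹.mulVecLin ∘ₗ l₀, fun i => ?_⟩
  have h1 : l₀ (x i) = N.mulVec (Pi.single i 1) := by
    ext j; simp [N]
  rw [LinearMap.comp_apply, h1, Matrix.mulVecLin_apply, Matrix.mulVec_mulVec,
    Matrix.nonsing_inv_mul _ hdet, Matrix.one_mulVec]

/-- Functionals that are linearly independent modulo `ħ` have a dual family. -/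
theorem LinIndepModH.exists_dual {ι : Type w} [Fintype ι] [DecidableEq ι] {M : Type v}
    [AddCommGroup M] [Module k⟦X⟧ M] [Module.Free k⟦X⟧ M] [Module.Finite k⟦X⟧ M]
    {α : ι → Module.Dual k⟦X⟧ M} (hα : LinIndepModH k α) :
    ∃ θ : ι → M, ∀ i j, α j (θ i) = if i = j then 1 else 0 := by
  obtain ⟨l, hl⟩ := hα.exists_leftInverse
  -- A left inverse for functionals lives in the bidual; reflexivity turns its coordinates into
  -- vectors.
  refine ⟨fun i => (Module.evalEquiv k⟦X⟧ M).symm (LinearMap.proj i ∘ₗ l), fun i j => ?_⟩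
  rw [Module.apply_evalEquiv_symm_apply, LinearMap.comp_apply, hl, LinearMap.proj_apply,
    Pi.single_apply]

/-- The decomposition given by a split injection. -/
def splitEquiv {R : Type u} [Ring R] {V : Type v} [AddCommGroup V] [Module R V] {M : Type w}
    [AddCommGroup M] [Module R M] (ψ : V →ₗ[R] M) (ρ : M →ₗ[R] V) (h : ∀ v, ρ (ψ v) = v) :
    (LinearMap.ker ρ × V) ≃ₗ[R] M where
  toFun p := p.1 + ψ p.2
  invFun x := (⟨x - ψ (ρ x), by rw [LinearMap.mem_ker, map_sub, h, sub_self]⟩, ρ x)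
  map_add' p q := by simp only [Prod.fst_add, Prod.snd_add, Submodule.coe_add, map_add]; abel
  map_smul' c p := by simp
  left_inv p := by
    have : ρ p.1 = 0 := p.1.2
    ext <;> simp [this, h]
  right_inv x := by simp

/-- The kernels of the two retractions are free, as submodules of free modules over a principal
ideal domain, and of equal rank. Any isomorphism between them is extended by the identity of `V`. -/
theorem exists_equiv_of_split {V : Type v'} [AddCommGroup V] [Module k⟦X⟧ V] [Module.Free k⟦X⟧ V]
    [Module.Finite k⟦X⟧ V] {M : Type v} [AddCommGroup M] [Module k⟦X⟧ M] [Module.Free k⟦X⟧ M]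
    [Module.Finite k⟦X⟧ M] {M' : Type w} [AddCommGroup M'] [Module k⟦X⟧ M'] [Module.Free k⟦X⟧ M']
    [Module.Finite k⟦X⟧ M'] (hM : Module.finrank k⟦X⟧ M = Module.finrank k⟦X⟧ M')
    {ψ : V →ₗ[k⟦X⟧] M} {ρ : M →ₗ[k⟦X⟧] V} (h : ∀ v, ρ (ψ v) = v)
    {ψ' : V →ₗ[k⟦X⟧] M'} {ρ' : M' →ₗ[k⟦X⟧] V} (h' : ∀ v, ρ' (ψ' v) = v) :
    ∃ g : M' ≃ₗ[k⟦X⟧] M, (∀ v, g (ψ' v) = ψ v) ∧ ∀ x, ρ (g x) = ρ' x := by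
  have e1 := (splitEquiv ψ ρ h).finrank_eq
  have e2 := (splitEquiv ψ' ρ' h').finrank_eq
  rw [Module.finrank_prod] at e1 e2
  have e3 : Module.finrank k⟦X⟧ (LinearMap.ker ρ') = Module.finrank k⟦X⟧ (LinearMap.ker ρ) := by
    omega
  let f := LinearEquiv.ofFinrankEq (LinearMap.ker ρ') (LinearMap.ker ρ) e3
  refine ⟨(splitEquiv ψ' ρ' h').symm.trans ((f.prodCongr (LinearEquiv.refl _ V)).trans
    (splitEquiv ψ ρ h)), fun v => ?_, fun x => ?_⟩
  · have : (splitEquiv ψ' ρ' h').symm (ψ' v) = (0, v) := by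
      rw [LinearEquiv.symm_apply_eq]; simp [splitEquiv]
    simp only [LinearEquiv.trans_apply, this]
    simp [splitEquiv]
  · obtain ⟨⟨z, v⟩, rfl⟩ := (splitEquiv ψ' ρ' h').surjective x
    simp only [LinearEquiv.trans_apply, LinearEquiv.symm_apply_apply]
    have h1 : ρ (f z) = 0 := (f z).2
    have h2 : ρ' z = 0 := z.2
    simp [splitEquiv, h, h', h1, h2]

/-- The retraction of `S + θ`, restricted to the range of `1 - G G'` in the second variable, through
which `α` factors. -/
theorem exists_adapted_retraction {R : Type u} [Ring R] {W : Type v'} [AddCommGroup W] [Module R W]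
    {M : Type v} [AddCommGroup M] [Module R M]
    {G G' ε : W →ₗ[R] W} (hG : ∀ w, G (G' (G w)) = G w) (hε : ∀ w, ε w = w - G (G' w))
    {S θ : W →ₗ[R] M} {α l : M →ₗ[R] W} (hS : ∀ w, α (S w) = G w) (hθ : ∀ w, α (θ w) = w)
    (hl : ∀ w, l (S w) = w) :
    ∃ ρ : M →ₗ[R] W × LinearMap.range ε,
      (∀ v : W × LinearMap.range ε, ρ (S v.1 + θ v.2) = v) ∧ ∀ x, α x = G (ρ x).1 + (ρ x).2 := by
  have εε : ∀ v : LinearMap.range ε, ε.rangeRestrict v = v := by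
    rintro ⟨_, w, rfl⟩
    ext
    simp [hε, hG]
  have εG : ∀ w, ε.rangeRestrict (G w) = 0 := fun w => by
    ext
    simp [hε, hG]
  -- The map `ε` is idempotent and kills the image of `G`. So `ε ∘ α` reads off the second component
  -- of `S v.1 + θ v.2`, and once that is removed `l` reads off the first.
  let ρ₀ : M →ₗ[R] W × LinearMap.range ε := LinearMap.prod
    (l ∘ₗ (LinearMap.id - θ ∘ₗ (LinearMap.range ε).subtype ∘ₗ ε.rangeRestrict ∘ₗ α))
    (ε.rangeRestrict ∘ₗ α)
  let β : W × LinearMap.range ε →ₗ[R] W := LinearMap.coprod G (LinearMap.range ε).subtype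
  let σ : W →ₗ[R] W × LinearMap.range ε := LinearMap.prod G' ε.rangeRestrict
  have hβσ : ∀ w, β (σ w) = w := fun w => by simp [β, σ, hε]
  have hρ₀ : ∀ v : W × LinearMap.range ε, ρ₀ (S v.1 + θ v.2) = v := fun v => by
    have : ε.rangeRestrict (α (S v.1 + θ v.2)) = v.2 := by
      rw [map_add, map_add, hS, hθ, εG, εε, zero_add]
    refine Prod.ext ?_ this
    change l ((S v.1 + θ v.2) - θ (ε.rangeRestrict (α (S v.1 + θ v.2)) : W)) = v.1
    rw [this, add_sub_cancel_right, hl]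
  have hβ : ∀ v : W × LinearMap.range ε, α (S v.1 + θ v.2) = β v := fun v => by
    rw [map_add, hS, hθ]; rfl
  -- The correction vanishes on the range of `S + θ`, where `α = β ∘ ρ₀` already, and forces `α = β
  -- ∘ ρ` elsewhere because `σ` is a section of `β`.
  refine ⟨ρ₀ + σ ∘ₗ (α - β ∘ₗ ρ₀), fun v => ?_, fun x => ?_⟩
  · simp only [LinearMap.add_apply, LinearMap.comp_apply, LinearMap.sub_apply, hρ₀, hβ, sub_self,
      map_zero, add_zero]
  · change α x = β ((ρ₀ + σ ∘ₗ (α - β ∘ₗ ρ₀)) x)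
    simp only [LinearMap.add_apply, LinearMap.comp_apply, LinearMap.sub_apply, map_add, hβσ,
      add_sub_cancel]

/-- Two modules of the same rank with compatible systems of vectors and functionals, given by maps
`S` and `α`, are isomorphic. -/
theorem exists_equiv_of_system {W : Type v'} [AddCommGroup W] [Module k⟦X⟧ W] [Module.Free k⟦X⟧ W]
    [Module.Finite k⟦X⟧ W] {M : Type v} [AddCommGroup M] [Module k⟦X⟧ M] [Module.Free k⟦X⟧ M]
    [Module.Finite k⟦X⟧ M] {M' : Type w} [AddCommGroup M'] [Module k⟦X⟧ M'] [Module.Free k⟦X⟧ M']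
    [Module.Finite k⟦X⟧ M'] (hM : Module.finrank k⟦X⟧ M = Module.finrank k⟦X⟧ M')
    {G G' : W →ₗ[k⟦X⟧] W} (hG : ∀ w, G (G' (G w)) = G w)
    {S θ : W →ₗ[k⟦X⟧] M} {α l : M →ₗ[k⟦X⟧] W} (hS : ∀ w, α (S w) = G w) (hθ : ∀ w, α (θ w) = w)
    (hl : ∀ w, l (S w) = w)
    {S' θ' : W →ₗ[k⟦X⟧] M'} {α' l' : M' →ₗ[k⟦X⟧] W} (hS' : ∀ w, α' (S' w) = G w)
    (hθ' : ∀ w, α' (θ' w) = w) (hl' : ∀ w, l' (S' w) = w) :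
    ∃ g : M' ≃ₗ[k⟦X⟧] M, (∀ w, g (S' w) = S w) ∧ ∀ x, α (g x) = α' x := by
  -- This projection supplies the directions missed by `G`. Once `α` factors through the retraction
  -- in the same way on both sides, any isomorphism compatible with the splittings respects `α` too.
  let ε : W →ₗ[k⟦X⟧] W := LinearMap.id - G ∘ₗ G'
  have hε : ∀ w, ε w = w - G (G' w) := fun w => rfl
  obtain ⟨ρ, h1, h2⟩ := exists_adapted_retraction hG hε hS hθ hl
  obtain ⟨ρ', h1', h2'⟩ := exists_adapted_retraction hG hε hS' hθ' hl'
  obtain ⟨g, hg1, hg2⟩ := exists_equiv_of_split hM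
    (ψ := LinearMap.coprod S (θ ∘ₗ (LinearMap.range ε).subtype)) (ρ := ρ) h1
    (ψ' := LinearMap.coprod S' (θ' ∘ₗ (LinearMap.range ε).subtype)) (ρ' := ρ') h1'
  refine ⟨g, fun w => ?_, fun x => by rw [h2, h2', hg2]⟩
  simpa using hg1 (w, 0)

/-- A matrix over a field has a generalized inverse. -/
theorem exists_generalized_inverse {ι : Type w} [Fintype ι] [DecidableEq ι] (N : Matrix ι ι k) :
    ∃ N' : Matrix ι ι k, N * N' * N = N := by
  obtain ⟨h, hh⟩ := N.toLin'.rangeRestrict.exists_rightInverse_of_surjective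
    N.toLin'.range_rangeRestrict
  obtain ⟨f, hf⟩ := LinearMap.exists_extend h
  refine ⟨LinearMap.toMatrix' f, Matrix.toLin'.injective (LinearMap.ext fun v => ?_)⟩
  rw [Matrix.toLin'_mul, Matrix.toLin'_mul, Matrix.toLin'_toMatrix']
  have h1 : f (N.toLin' v) = h (N.toLin'.rangeRestrict v) :=
    LinearMap.congr_fun hf (N.toLin'.rangeRestrict v)
  have h2 := LinearMap.congr_fun hh (N.toLin'.rangeRestrict v)
  change N.toLin' (f (N.toLin' v)) = _
  rw [h1]
  exact congrArg Subtype.val h2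

end LinearAlgebra

/-! ### Solving for the skew tensor -/

section Contraction

variable {k : Type u} [Field k] {𝔥 : Type v} [AddCommGroup 𝔥] [Module k⟦X⟧ 𝔥] {τ : ℕ}
  (b : Module.Basis (Fin τ) k⟦X⟧ 𝔥)

/-- The matrix of the tensor `x ⊗ y` with respect to a basis. -/
def tensorMatrix (x y : 𝔥) : Matrix (Fin τ) (Fin τ) k⟦X⟧ :=
  Matrix.of fun g h => b.repr x g * b.repr y h

theorem transpose_tensorMatrix (x y : 𝔥) :
    (tensorMatrix b x y).transpose = tensorMatrix b y x := by
  ext g h : 1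
  exact mul_comm (b.repr x h) (b.repr y g)

theorem contract_tensorMatrix (x y : 𝔥) (l : Module.Dual k⟦X⟧ 𝔥) :
    contract (tensorMatrix b x y) b l = l x • y := by
  have h1 : ∑ g, b.repr x g * l (b g) = l x := by
    conv_rhs => rw [← b.sum_repr x, map_sum]
    simp only [map_smul, smul_eq_mul]
  have h2 : ∀ g, ∑ h, (b.repr x g * b.repr y h * l (b g)) • b h =
      (b.repr x g * l (b g)) • y := fun g => by
    conv_rhs => rw [← b.sum_repr y, Finset.smul_sum]
    refine Finset.sum_congr rfl fun h _ => ?_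
    rw [smul_smul]
    congr 1
    ring
  rw [← h1, Finset.sum_smul]
  exact Finset.sum_congr rfl fun g _ => h2 g

variable (c d : Matrix (Fin τ) (Fin τ) k⟦X⟧) (l : Module.Dual k⟦X⟧ 𝔥)

theorem contract_sub (b : Fin τ → 𝔥) : contract (c - d) b l = contract c b l - contract d b l := by
  simp only [contract, Matrix.sub_apply, sub_mul, sub_smul, Finset.sum_sub_distrib]

theorem contract_add (b : Fin τ → 𝔥) : contract (c + d) b l = contract c b l + contract d b l := by
  simp only [contract, Matrix.add_apply, add_mul, add_smul, Finset.sum_add_distrib]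

theorem contract_smul (r : k⟦X⟧) (b : Fin τ → 𝔥) : contract (r • c) b l = r • contract c b l := by
  simp only [contract, Matrix.smul_apply, smul_eq_mul, Finset.smul_sum, smul_smul, mul_assoc]

theorem contract_sum {ι : Type w} (s : Finset ι) (c : ι → Matrix (Fin τ) (Fin τ) k⟦X⟧)
    (b : Fin τ → 𝔥) : contract (∑ i ∈ s, c i) b l = ∑ i ∈ s, contract (c i) b l := by
  classical
  induction s using Finset.induction_on with
  | empty => simp [contract]
  | insert i s hi ih => rw [Finset.sum_insert hi, Finset.sum_insert hi, contract_add, ih]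

/-- Vectors on which functionals with a dual family take skew-symmetric values are contractions of a
skew-symmetric tensor with these functionals. -/
theorem exists_skew_contract {ι : Type w} [Fintype ι] [DecidableEq ι]
    {α : ι → Module.Dual k⟦X⟧ 𝔥} {θ : ι → 𝔥} (hθ : ∀ i j, α j (θ i) = if i = j then 1 else 0)
    {L : ι → 𝔥} (hL : ∀ i j, α i (L j) = -α j (L i)) :
    ∃ c : Matrix (Fin τ) (Fin τ) k⟦X⟧, c.transpose = -c ∧ ∀ i, contract c b (α i) = L i := by
  -- Contracting the first sum with `α m` gives `L m - ∑ α m (L i) θ i`. The second sum is skew by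
  -- `hL` and contributes `-∑ α j (L m) θ j`, which cancels the error.
  refine ⟨∑ i, (tensorMatrix b (θ i) (L i) - tensorMatrix b (L i) (θ i)) -
    ∑ i, ∑ j, α j (L i) • tensorMatrix b (θ i) (θ j), ?_, fun m => ?_⟩
  · have h1 : (∑ i, ∑ j, α j (L i) • tensorMatrix b (θ i) (θ j)).transpose =
        -∑ i, ∑ j, α j (L i) • tensorMatrix b (θ i) (θ j) := by
      conv_lhs => rw [Finset.sum_comm]
      simp only [Matrix.transpose_sum, Matrix.transpose_smul, transpose_tensorMatrix,
        ← Finset.sum_neg_distrib]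
      refine Finset.sum_congr rfl fun i _ => Finset.sum_congr rfl fun j _ => ?_
      rw [hL, neg_smul]
    rw [Matrix.transpose_sub, h1, Matrix.transpose_sum]
    simp only [Matrix.transpose_sub, transpose_tensorMatrix, Finset.sum_sub_distrib]
    abel
  · simp only [contract_sub, contract_sum, contract_smul, contract_tensorMatrix, hθ, ite_smul,
      one_smul, zero_smul, smul_ite, smul_zero, Finset.sum_sub_distrib, Finset.sum_ite_eq',
      Finset.mem_univ, if_true]
    rw [Finset.sum_comm]
    simp only [Finset.sum_ite_eq', Finset.mem_univ, if_true]
    simp only [hL m, neg_smul, Finset.sum_neg_distrib]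
    abel

end Contraction

/-! ### Companion realizations and the existence of shifts -/

section Existence

variable {k : Type u} [Field k] {n : ℕ} {C : CartanDatum n}
  {P P' : Matrix (Fin n) (Fin n) k⟦X⟧} {𝔥 : Type v} [AddCommGroup 𝔥] [Module k⟦X⟧ 𝔥]
  {𝔥' : Type w} [AddCommGroup 𝔥'] [Module k⟦X⟧ 𝔥']

/-- Every straight realization of `P` has a companion for `P'` on the same module. -/
theorem exists_realization [Module.Free k⟦X⟧ 𝔥] [Module.Finite k⟦X⟧ 𝔥] (hP : C.IsCartanType P)
    (hP' : C.IsCartanType P') {R : Realization P 𝔥} (hR : R.IsStraight) :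
    ∃ R' : Realization P' 𝔥, R'.IsStraight := by
  obtain ⟨θ, hθ⟩ := LinIndepModH.exists_dual hR
  have key : ∀ i j, R.α j (∑ m, (P' i m - P i m) • θ m) = P' i j - P i j := fun i j => by
    simp [map_sum, hθ]
  -- The roots are kept and the two coroots are moved by opposite amounts, so `S i` and its
  -- independence are unaffected. The dual family `θ` turns the required changes of pairing into
  -- vectors.
  refine ⟨⟨R.α, fun i => R.Tp i + ∑ m, (P' i m - P i m) • θ m,
    fun i => R.Tm i - ∑ m, (P' i m - P i m) • θ m, fun i j => ?_, fun i j => ?_, ?_⟩, hR⟩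
  · rw [map_add, key, R.α_Tp, add_sub_cancel]
  · have e1 := hP.add_eq i j
    have e2 := hP'.add_eq i j
    rw [map_sub, key, R.α_Tm]
    linear_combination e1 - e2
  · convert R.indep using 2 with i
    rw [halfSum, halfSum]
    congr 1
    abel

theorem CartanDatum.isCartanType_DA (C : CartanDatum n) : C.IsCartanType (C.DA k) := by
  ext1 i j
  have : C.DA k j i = C.DA k i j := congrArg (Int.cast (R := k⟦X⟧)) (C.symm j i)
  rw [Matrix.add_apply, Matrix.transpose_apply, this, Matrix.smul_apply, smul_eq_mul, two_mul]

theorem pi_linearCombination {x : Fin n → 𝔥} {α : Fin n → Module.Dual k⟦X⟧ 𝔥}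
    {Q : Matrix (Fin n) (Fin n) k⟦X⟧} (h : ∀ i j, α j (x i) = Q i j) (w : Fin n → k⟦X⟧) :
    LinearMap.pi α (Fintype.linearCombination k⟦X⟧ x w) = Q.vecMulLinear w := by
  ext1 j
  simp [Fintype.linearCombination_apply, h, Matrix.vecMul, dotProduct]

theorem leftInverse_linearCombination {x : Fin n → 𝔥} {l : 𝔥 →ₗ[k⟦X⟧] Fin n → k⟦X⟧}
    (h : ∀ i, l (x i) = Pi.single i 1) (w : Fin n → k⟦X⟧) :
    l (Fintype.linearCombination k⟦X⟧ x w) = w := by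
  rw [Fintype.linearCombination_apply, map_sum]
  simp only [map_smul, h]
  exact (pi_eq_sum_univ' w).symm

/-- The entries of `D A` are constants, so a generalized inverse over the field `k` serves. A
general matrix over `k⟦ħ⟧`, such as `(ħ)`, has none. -/
theorem CartanDatum.exists_generalized_inverse_DA (C : CartanDatum n) :
    ∃ N : Matrix (Fin n) (Fin n) k⟦X⟧, C.DA k * N * C.DA k = C.DA k := by
  let D : Matrix (Fin n) (Fin n) k := Matrix.of fun i j => (((C.d i : ℤ) * C.A i j : ℤ) : k)
  have hD : C.DA k = D.map (PowerSeries.C (R := k)) := by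
    ext1 i j
    exact (map_intCast (PowerSeries.C (R := k)) _).symm
  obtain ⟨N, hN⟩ := exists_generalized_inverse D
  refine ⟨N.map (PowerSeries.C (R := k)), ?_⟩
  rw [hD, ← Matrix.map_mul, ← Matrix.map_mul, hN]

variable [CharZero k]

theorem halfSum_add_self {M : Type v} [AddCommGroup M] [Module k⟦X⟧ M] (x y : M) :
    halfSum (k := k) x y + halfSum (k := k) x y = x + y := by
  rw [halfSum, ← add_smul, ← map_add]
  have : (2⁻¹ : k) + 2⁻¹ = 1 := by norm_num
  rw [this, map_one, one_smul]

theorem Realization.α_halfSum (R : Realization P 𝔥) (hP : C.IsCartanType P) (i j : Fin n) :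
    R.α j (halfSum (k := k) (R.Tp i) (R.Tm i)) = C.DA k i j := by
  refine mul_left_cancel₀ (two_ne_zero_powerSeries (k := k)) ?_
  rw [two_mul, ← map_add, halfSum_add_self, map_add, R.α_Tp, R.α_Tm]
  exact congrFun (congrFun hP i) j

/-- The skew part of the matrix plays no role here: for both realizations the pairing of roots with
`S i` is `D A`, so `exists_equiv_of_system` applies with `G` given by `D A`. -/
theorem exists_linearEquiv [Module.Free k⟦X⟧ 𝔥] [Module.Finite k⟦X⟧ 𝔥] [Module.Free k⟦X⟧ 𝔥']
    [Module.Finite k⟦X⟧ 𝔥'] (hP : C.IsCartanType P) (hP' : C.IsCartanType P')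
    {R : Realization P 𝔥} {R' : Realization P' 𝔥'} (hR : R.IsStraight) (hR' : R'.IsStraight)
    (hr : Module.finrank k⟦X⟧ 𝔥 = Module.finrank k⟦X⟧ 𝔥') :
    ∃ g : 𝔥' ≃ₗ[k⟦X⟧] 𝔥, (∀ j x, R.α j (g x) = R'.α j x) ∧
      ∀ i, g (R'.Tp i + R'.Tm i) = R.Tp i + R.Tm i := by
  obtain ⟨N, hN⟩ := C.exists_generalized_inverse_DA (k := k)
  obtain ⟨l, hl⟩ := LinIndepModH.exists_leftInverse R.indep
  obtain ⟨l', hl'⟩ := LinIndepModH.exists_leftInverse R'.indep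
  obtain ⟨θ, hθ⟩ := LinIndepModH.exists_dual hR
  obtain ⟨θ', hθ'⟩ := LinIndepModH.exists_dual hR'
  obtain ⟨g, hg1, hg2⟩ := exists_equiv_of_system hr (G := (C.DA k).vecMulLinear)
    (G' := N.vecMulLinear)
    (fun w => by simp only [Matrix.vecMulLinear_apply, Matrix.vecMul_vecMul, hN])
    (pi_linearCombination (R.α_halfSum hP))
    (θ := Fintype.linearCombination k⟦X⟧ θ)
    (fun w => (pi_linearCombination (Q := 1) (fun i j => by rw [hθ, Matrix.one_apply]) w).trans
      (Matrix.vecMul_one w))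
    (leftInverse_linearCombination hl)
    (pi_linearCombination (R'.α_halfSum hP'))
    (θ' := Fintype.linearCombination k⟦X⟧ θ')
    (fun w => (pi_linearCombination (Q := 1) (fun i j => by rw [hθ', Matrix.one_apply]) w).trans
      (Matrix.vecMul_one w))
    (leftInverse_linearCombination hl')
  have hg : ∀ i, g (halfSum (k := k) (R'.Tp i) (R'.Tm i)) = halfSum (k := k) (R.Tp i) (R.Tm i) :=
    fun i => by
      simpa [Fintype.linearCombination_apply_single] using hg1 (Pi.single i 1)
  refine ⟨g, fun j x => congrFun (hg2 x) j, fun i => ?_⟩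
  rw [← halfSum_add_self (k := k) (R'.Tp i), map_add, hg, halfSum_add_self]

theorem exists_toralShift [Module.Free k⟦X⟧ 𝔥] [Module.Finite k⟦X⟧ 𝔥] [Module.Free k⟦X⟧ 𝔥']
    [Module.Finite k⟦X⟧ 𝔥'] (hP : C.IsCartanType P) (hP' : C.IsCartanType P')
    {R : Realization P 𝔥} {R' : Realization P' 𝔥'} (hR : R.IsStraight) (hR' : R'.IsStraight)
    (hr : Module.finrank k⟦X⟧ 𝔥 = Module.finrank k⟦X⟧ 𝔥') : Nonempty (ToralShift R' R) := by
  obtain ⟨g, hg1, hg2⟩ := exists_linearEquiv hP hP' hR hR' hr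
  have h2 : ∀ x : 𝔥, PowerSeries.C (2⁻¹ : k) • x + PowerSeries.C (2⁻¹ : k) • x = x := fun x => by
    have h := halfSum_add_self (k := k) x 0
    rwa [halfSum, add_zero] at h
  -- The formula for `L i` is forced by the `T⁺` condition. The one for `T⁻` follows since `g`
  -- preserves `T⁺ + T⁻`, and skewness since `P` and `P'` have equal symmetric parts.
  refine ⟨⟨g, fun i => PowerSeries.C (2⁻¹ : k) • (R.Tp i - g (R'.Tp i)), hg1, fun i => ?_,
    fun i => ?_, fun i j => ?_⟩⟩
  · rw [h2, sub_sub_cancel]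
  · rw [h2, add_sub_assoc', add_comm (R.Tm i), ← hg2, map_add, add_sub_cancel_left]
  · have e1 := hP.add_eq i j
    have e2 := hP'.add_eq i j
    simp only [map_smul, map_sub, hg1, R.α_Tp, R'.α_Tp, smul_eq_mul]
    linear_combination PowerSeries.C (2⁻¹ : k) * (e1 - e2)

/-- The defects of a shift are contractions of a skew tensor `c`, and `Φ = 2 c` absorbs the factor
`1/2` in the exponent of the twist. The same shift and the same `Φ` serve the whole algebra and both
Borel subalgebras. -/
theorem exists_toralTwist [Module.Free k⟦X⟧ 𝔥] [Module.Finite k⟦X⟧ 𝔥] [Module.Free k⟦X⟧ 𝔥']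
    [Module.Finite k⟦X⟧ 𝔥'] (hP : C.IsCartanType P) (hP' : C.IsCartanType P')
    {R : Realization P 𝔥} {R' : Realization P' 𝔥'} (hR : R.IsStraight) (hR' : R'.IsStraight)
    (hr : Module.finrank k⟦X⟧ 𝔥 = Module.finrank k⟦X⟧ 𝔥') (t : ℕ)
    (b : Module.Basis (Fin t) k⟦X⟧ 𝔥) :
    ∃ Φ : Matrix (Fin t) (Fin t) k⟦X⟧, Φ.transpose = -Φ ∧
      IsToralTwist C R' R b Φ ∧ ∀ s, IsBorelToralTwist C s R' R b Φ := by
  obtain ⟨s⟩ := exists_toralShift hP hP' hR hR' hr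
  obtain ⟨θ, hθ⟩ := LinIndepModH.exists_dual hR
  obtain ⟨c, hc, hcL⟩ := exists_skew_contract b hθ s.skew
  have hΦ : PowerSeries.C (2⁻¹ : k) • (2 : k⟦X⟧) • c = c := by
    have h2 : (2 : k⟦X⟧) = PowerSeries.C (2 : k) := (map_ofNat _ 2).symm
    rw [smul_smul, h2, ← map_mul, inv_mul_cancel₀ two_ne_zero, map_one, one_smul]
  have hΦt : ((2 : k⟦X⟧) • c).transpose = -((2 : k⟦X⟧) • c) := by
    rw [Matrix.transpose_smul, hc, smul_neg]
  have hL : ∀ i, s.L i = contract (PowerSeries.C (2⁻¹ : k) • (2 : k⟦X⟧) • c) b (R.α i) :=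
    fun i => by rw [hΦ, hcL]
  exact ⟨(2 : k⟦X⟧) • c, hΦt, s.isToralTwist hP hP' hΦt hL, s.isBorelToralTwist hP hP' hΦt hL⟩

/-- Every straight realization has a standard companion on the same module. -/
theorem exists_standard_realization (hP : C.IsCartanType P) {R : Realization P 𝔥}
    (hR : R.IsStraight) :
    ∃ R₀ : Realization (C.DA k) 𝔥, R₀.IsStraight ∧ R₀.IsSmall ∧ R₀.Tp = R₀.Tm := by
  have hS : ∀ x : 𝔥, halfSum (k := k) x x = x := fun x => by
    have h2 : (2⁻¹ : k) + 2⁻¹ = 1 := by norm_num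
    rw [halfSum, smul_add, ← add_smul, ← map_add, h2, map_one, one_smul]
  -- Both coroots are replaced by their mean, which pairs with the roots by `D A` and coincides with
  -- its own half sum.
  refine ⟨⟨R.α, fun i => halfSum (k := k) (R.Tp i) (R.Tm i),
    fun i => halfSum (k := k) (R.Tp i) (R.Tm i), R.α_halfSum hP, fun i j => ?_, ?_⟩, hR, ?_, rfl⟩
  · rw [R.α_halfSum hP]
    exact congrArg (Int.cast (R := k⟦X⟧)) (C.symm i j)
  · simp only [hS]
    exact R.indep
  · simp only [Realization.IsSmall, hS, Set.union_self]

end Existence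

end FoMp

/-! ### The theorem -/

theorem mainTheorem5 {k : Type*} [Field k] [CharZero k] {n : ℕ} (C : FoMp.CartanDatum n)
    (P P' : Matrix (Fin n) (Fin n) k⟦X⟧) (hP : C.IsCartanType P) (hP' : C.IsCartanType P')
    {𝔥 : Type*} [AddCommGroup 𝔥] [Module k⟦X⟧ 𝔥] [Module.Free k⟦X⟧ 𝔥] [Module.Finite k⟦X⟧ 𝔥]
    {𝔥' : Type*} [AddCommGroup 𝔥'] [Module k⟦X⟧ 𝔥'] [Module.Free k⟦X⟧ 𝔥']
    [Module.Finite k⟦X⟧ 𝔥'] :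
    -- from a straight realization of `P` to a straight realization of `P'` of the same rank
    (∀ R : FoMp.Realization P 𝔥, R.IsStraight →
      ∃ R' : FoMp.Realization P' 𝔥, R'.IsStraight ∧
        ∀ (t : ℕ) (b : Module.Basis (Fin t) k⟦X⟧ 𝔥),
          ∃ Φ : Matrix (Fin t) (Fin t) k⟦X⟧, Φ.transpose = -Φ ∧
            FoMp.IsToralTwist C R' R b Φ ∧ ∀ s, FoMp.IsBorelToralTwist C s R' R b Φ) ∧
    -- conversely, from a straight realization of `P'` to one of `P` of the same rank
    (∀ R' : FoMp.Realization P' 𝔥', R'.IsStraight →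
      ∃ R : FoMp.Realization P 𝔥', R.IsStraight ∧
        ∀ (t : ℕ) (b : Module.Basis (Fin t) k⟦X⟧ 𝔥'),
          ∃ Φ : Matrix (Fin t) (Fin t) k⟦X⟧, Φ.transpose = -Φ ∧
            FoMp.IsToralTwist C R' R b Φ ∧ ∀ s, FoMp.IsBorelToralTwist C s R' R b Φ) ∧
    -- any two straight small realizations of the same rank
    (∀ (R : FoMp.Realization P 𝔥) (R' : FoMp.Realization P' 𝔥'),
      R.IsStraight → R.IsSmall → R'.IsStraight → R'.IsSmall →
      Module.finrank k⟦X⟧ 𝔥 = Module.finrank k⟦X⟧ 𝔥' →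
        ∀ (t : ℕ) (b : Module.Basis (Fin t) k⟦X⟧ 𝔥),
          ∃ Φ : Matrix (Fin t) (Fin t) k⟦X⟧, Φ.transpose = -Φ ∧
            FoMp.IsToralTwist C R' R b Φ ∧ ∀ s, FoMp.IsBorelToralTwist C s R' R b Φ) ∧
    -- Drinfeld's standard FoMpQUEA over `D A` (with `T⁺ = T⁻`, or its split minimal double):
    -- it exists in the same rank, and every straight small one is a toral twist of it
    (∀ R' : FoMp.Realization P' 𝔥', R'.IsStraight → R'.IsSmall →
      (∃ R₀ : FoMp.Realization (C.DA k) 𝔥', R₀.IsStraight ∧ R₀.IsSmall ∧ R₀.Tp = R₀.Tm) ∧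
      ∀ R₀ : FoMp.Realization (C.DA k) 𝔥, R₀.IsStraight →
        (R₀.Tp = R₀.Tm ∨ (R₀.IsSplit ∧ R₀.IsMinimal)) →
        Module.finrank k⟦X⟧ 𝔥 = Module.finrank k⟦X⟧ 𝔥' →
          ∀ (t : ℕ) (b : Module.Basis (Fin t) k⟦X⟧ 𝔥),
            ∃ Φ : Matrix (Fin t) (Fin t) k⟦X⟧, Φ.transpose = -Φ ∧
              FoMp.IsToralTwist C R' R₀ b Φ ∧ ∀ s, FoMp.IsBorelToralTwist C s R' R₀ b Φ) := by
  -- Each claim is an instance of `exists_toralTwist`. In the first two the companion realization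
  -- lives on the same module, so equality of ranks is trivial.
  refine ⟨fun R hR => ?_, fun R' hR' => ?_, fun R R' hR _ hR' _ hr t b => ?_,
    fun R' hR' _ => ⟨?_, fun R₀ hR₀ _ hr t b => ?_⟩⟩
  · obtain ⟨R', hR'⟩ := FoMp.exists_realization hP hP' hR
    exact ⟨R', hR', fun t b => FoMp.exists_toralTwist hP hP' hR hR' rfl t b⟩
  · obtain ⟨R, hR⟩ := FoMp.exists_realization hP' hP hR'
    exact ⟨R, hR, fun t b => FoMp.exists_toralTwist hP hP' hR hR' rfl t b⟩
  · exact FoMp.exists_toralTwist hP hP' hR hR' hr t b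
  · exact FoMp.exists_standard_realization hP' hR'
  · exact FoMp.exists_toralTwist C.isCartanType_DA hP' hR₀ hR' hr t b
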